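/- Let $k$ be a field of characteristic $0$. Let $\mathcal{N}_k^{\mathbb{N}_0}$ be the category of finite-dimensional nilpotent $\mathbb{N}_0$-graded Lie algebras $\mathfrak{g}_*=\bigoplus_{n\ge 0}\mathfrak{g}_n$ over $k$, with the Koszul sign rule: $[\mathfrak g_i,\mathfrak g_j]\subset\mathfrak g_{i+j}$ and, for $x\in\mathfrak g_i$, $y\in\mathfrak g_j$ and $z\in\mathfrak g_*$, $[x,y]=-(-1)^{ij}[y,x]$ and $[x,[y,z]]=[[x,y],z]+(-1)^{ij}[y,[x,z]]$; the morphisms are the degree-preserving Lie algebra homomorphisms. Let $G:\mathcal{N}_k^{\mathbb{N}_0}\to\mathrm{Grp}$ be a functor with $G(0)$ trivial that is * smooth: $G(M)\to G(N)$ is surjective for every surjection $M\twoheadrightarrow N$; * homogeneous: $G(N'\times_N N'')\to G(N')\times_{G(N)}G(N'')$ is bijective for every surjection $N'\twoheadrightarrow N$ and every morphism $N''\to N$. For $n\ge 0$ let $k\epsilon_n$ be the one-dimensional abelian graded Lie algebra concentrated in degree $n$, and let $A^n:=G(k\epsilon_n)$ be the degree $n$ part of the tangent space of $G$, with its canonical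 vector space structure: the addition is $G(k\epsilon_n)\times G(k\epsilon_n)\cong G(k\epsilon_n\oplus k\epsilon_n)\to G(k\epsilon_n)$, induced by the sum map (it agrees with the group law), and $c\in k$ acts through $\epsilon_n\mapsto c\,\epsilon_n$. Then there is a bilinear product on $A^*$, with $A^i\cdot A^j\subset A^{i+j}$, making it an associative graded-commutative algebra, not required to have a unit ($ab=(-1)^{ij}ba$ for $a\in A^i$, $b\in A^j$), together with group isomorphisms $$\exp\Bigl(\bigoplus_n A^n\otimes\mathfrak{g}_n\Bigr)\;\cong\;G(\mathfrak{g}_*),$$ functorial in $\mathfrak{g}_*\in\mathcal{N}_k^{\mathbb{N}_0}$ and canonical in the sense that for $\mathfrak{g}_*=k\epsilon_n$ the isomorphism sends $a\otimes\epsilon_n$ to $a\in A^n=G(k\epsilon_n)$ for all $n\ge 0$ and $a\in A^n$. Here $\bigoplus_n A^n\otimes\mathfrak{g}_n$ is the nilpotent Lie algebra with bracket $[a\otimes x,b\otimes y]=(-1)^{ij}\,ab\otimes[x,y]$ for $a\in A^i$, $x\in\mathfrak g_i$, $b\in A^j$, $y\in\mathfrak g_j$, and $\exp(L)$ is the set $L$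 with the group law given by the Baker–Campbell–Hausdorff formula. -/

import Mathlib

open CategoryTheory DirectSum TensorProduct

universe u w

/-! ### Graded Lie algebras -/

/-- An `ℕ`-graded Lie algebra over a field `k` of characteristic zero, with the Koszul sign rule.
The bracket `g_i × g_j → g_n` is recorded for every `n` with a proof of `i + j = n`. -/
structure GradedLie (k : Type u) [Field k] where
  carrier : ℕ → Type u
  [addCommGroup : ∀ n, AddCommGroup (carrier n)]
  [module : ∀ n, Module k (carrier n)]
  bracket : ∀ i j n : ℕ, i + j = n → (carrier i →ₗ[k] carrier j →ₗ[k] carrier n)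
  skew : ∀ (i j n : ℕ) (h : i + j = n) (h' : j + i = n) (x : carrier i) (y : carrier j),
    bracket i j n h x y = -((-1 : k) ^ (i * j) • bracket j i n h' y x)
  jacobi : ∀ (i j l ij il jl n : ℕ) (hij : i + j = ij) (hil : i + l = il) (hjl : j + l = jl)
    (h₁ : i + jl = n) (h₂ : ij + l = n) (h₃ : j + il = n)
    (x : carrier i) (y : carrier j) (z : carrier l),
    bracket i jl n h₁ x (bracket j l jl hjl y z) =
      bracket ij l n h₂ (bracket i j ij hij x y) z +
        (-1 : k) ^ (i * j) • bracket j il n h₃ y (bracket i l il hil x z)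

attribute [instance] GradedLie.addCommGroup GradedLie.module

/-- The lower central series of `g` (indexed from `0`); `g.lcs r n` is its degree `n` part. -/
def GradedLie.lcs {k : Type u} [Field k] (g : GradedLie k) :
    ℕ → ∀ n : ℕ, Submodule k (g.carrier n)
  | 0, _ => ⊤
  | r + 1, n => Submodule.span k
      {z | ∃ (i j : ℕ) (h : i + j = n) (x : g.carrier i) (y : g.carrier j),
        y ∈ GradedLie.lcs g r j ∧ g.bracket i j n h x y = z}

/-- A finite-dimensional nilpotent `ℕ`-graded Lie algebra. -/
structure GrNilpLie (k : Type u) [Field k] extends GradedLie k where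
  finite : ∀ n, Module.Finite k (carrier n)
  bounded : ∃ N, ∀ n, N ≤ n → Subsingleton (carrier n)
  nilpotent : ∃ r, ∀ n, toGradedLie.lcs r n = ⊥

namespace GrNilpLie

variable {k : Type u} [Field k]

/-- Morphisms: linear maps in each degree, compatible with brackets. -/
@[ext]
structure Hom (g h : GrNilpLie k) where
  app : ∀ n, g.carrier n →ₗ[k] h.carrier n
  map_bracket : ∀ (i j n : ℕ) (e : i + j = n) (x : g.carrier i) (y : g.carrier j),
    app n (g.bracket i j n e x y) = h.bracket i j n e (app i x) (app j y)

/-- The category of finite-dimensional nilpotent `ℕ`-graded Lie algebras over `k`. -/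
instance : Category (GrNilpLie k) where
  Hom := Hom
  id g := ⟨fun _ => LinearMap.id, fun _ _ _ _ _ _ => rfl⟩
  comp f f' := ⟨fun n => (f'.app n).comp (f.app n), fun i j n e x y => by
    simp [f.map_bracket, f'.map_bracket]⟩

/-- Surjective morphisms. -/
def Surj {g h : GrNilpLie k} (f : g ⟶ h) : Prop :=
  ∀ n, Function.Surjective (Hom.app f n)

/-- `p`, `q` exhibit `P` as the fibre product `N' ×_N N''` of `f` and `f'`. -/
def IsFibreProduct {P N' N'' N : GrNilpLie k} (p : P ⟶ N') (q : P ⟶ N'')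
    (f : N' ⟶ N) (f' : N'' ⟶ N) : Prop :=
  p ≫ f = q ≫ f' ∧
    ∀ (n : ℕ) (x : N'.carrier n) (y : N''.carrier n), Hom.app f n x = Hom.app f' n y →
      ∃! z : P.carrier n, Hom.app p n z = x ∧ Hom.app q n z = y

/-- The standing condition on functors: the value at the zero Lie algebra is the one-point set. -/
class IsReduced (G : GrNilpLie k ⥤ GrpCat.{w}) : Prop where
  subsingleton : ∀ g : GrNilpLie k, (∀ n, Subsingleton (g.carrier n)) → Subsingleton (G.obj g)

/-- A group-valued functor is smooth if it sends surjections to surjections. -/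
def IsSmooth (G : GrNilpLie k ⥤ GrpCat.{w}) : Prop :=
  ∀ ⦃M N : GrNilpLie k⦄ (f : M ⟶ N), Surj f → Function.Surjective (G.map f)

/-- A group-valued functor is homogeneous if
`G(N' ×_N N'') → G(N') ×_{G(N)} G(N'')` is bijective for all `N' ↠ N` and `N'' → N`. -/
class IsHomogeneous (G : GrNilpLie k ⥤ GrpCat.{w}) : Prop where
  existsUnique : ∀ ⦃P N' N'' N : GrNilpLie k⦄ (p : P ⟶ N') (q : P ⟶ N'')
    (f : N' ⟶ N) (f' : N'' ⟶ N), IsFibreProduct p q f f' → Surj f →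
      ∀ (a : G.obj N') (b : G.obj N''), G.map f a = G.map f' b →
        ∃! c : G.obj P, G.map p c = a ∧ G.map q c = b

/-! ### The tangent space -/

/-- A finite-dimensional vector space `V` placed in degree `n` (and zero in the other degrees),
with zero bracket. -/
def conc (n : ℕ) (V : Type u) [AddCommGroup V] [Module k V] [Module.Finite k V] :
    GrNilpLie k where
  carrier m := PLift (m = n) → V
  bracket _ _ _ _ := 0
  skew := by intros; simp
  jacobi := by intros; simp
  finite m := inferInstance
  bounded := ⟨n + 1, fun m hm => ⟨fun a b => funext fun h => absurd h.down (by omega)⟩⟩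
  nilpotent := ⟨1, fun m => by
    rw [GradedLie.lcs, Submodule.span_eq_bot]
    rintro z ⟨i, j, h, x, y, -, rfl⟩
    rfl⟩

/-- The morphism of abelian graded Lie algebras induced by a linear map. -/
def concMap (n : ℕ) {V W : Type u} [AddCommGroup V] [Module k V] [Module.Finite k V]
    [AddCommGroup W] [Module k W] [Module.Finite k W] (f : V →ₗ[k] W) :
    conc (k := k) n V ⟶ conc (k := k) n W :=
  Hom.mk (fun m => f.compLeft (PLift (m = n))) (fun _ _ _ _ _ _ =>
    map_zero (f.compLeft _))

variable (k) in
/-- The one-dimensional abelian graded Lie algebra `k ε` with `ε` in degree `n`. -/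
abbrev line (n : ℕ) : GrNilpLie k := conc n k

variable (k) in
/-- The generator `ε` of `line k n`. -/
def eps (n : ℕ) : (line k n).carrier n := fun _ => 1

section conc

variable {n : ℕ} {V W X : Type u} [AddCommGroup V] [Module k V] [Module.Finite k V]
  [AddCommGroup W] [Module k W] [Module.Finite k W]
  [AddCommGroup X] [Module k X] [Module.Finite k X]

theorem concMap_comp (f : V →ₗ[k] W) (f' : W →ₗ[k] X) :
    concMap n f ≫ concMap n f' = concMap (k := k) n (f' ∘ₗ f) := rfl

theorem concMap_id : concMap n (LinearMap.id : V →ₗ[k] V) = 𝟙 (conc (k := k) n V) := rfl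

variable (G : GrNilpLie k ⥤ GrpCat.{w})

theorem map_concMap_comp (f : V →ₗ[k] W) (f' : W →ₗ[k] X) (a : G.obj (conc n V)) :
    G.map (concMap n f') (G.map (concMap n f) a) = G.map (concMap n (f' ∘ₗ f)) a := by
  rw [← concMap_comp, G.map_comp]; rfl

theorem map_concMap_id (a : G.obj (conc (k := k) n V)) :
    G.map (concMap n (LinearMap.id : V →ₗ[k] V)) a = a := by
  rw [concMap_id, G.map_id]; rfl

/-- A reduced functor sends zero maps to trivial maps. -/
theorem map_concMap_zero [IsReduced G] (a : G.obj (conc (k := k) n V)) :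
    G.map (concMap n (0 : V →ₗ[k] W)) a = 1 := by
  have hs : Subsingleton (G.obj (conc (k := k) n PUnit.{u+1})) :=
    IsReduced.subsingleton _ fun m => ⟨fun _ _ => funext fun _ => rfl⟩
  have h0 : (0 : V →ₗ[k] W) = (0 : PUnit.{u+1} →ₗ[k] W) ∘ₗ (0 : V →ₗ[k] PUnit.{u+1}) := rfl
  rw [h0, ← map_concMap_comp, Subsingleton.elim (G.map _ a) 1, map_one]

theorem isFibreProduct_prod : IsFibreProduct
    (concMap n (LinearMap.fst k V W)) (concMap n (LinearMap.snd k V W))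
    (concMap n (0 : V →ₗ[k] PUnit.{u+1})) (concMap n (0 : W →ₗ[k] PUnit.{u+1})) :=
  ⟨rfl, fun _ x y _ => ⟨fun h => (x h, y h), ⟨rfl, rfl⟩, by
    rintro z ⟨rfl, rfl⟩
    rfl⟩⟩

variable [IsReduced G] [IsHomogeneous G]

/-- `G(V ⊕ W) → G(V) × G(W)` is injective. -/
theorem prod_ext {c d : G.obj (conc (k := k) n (V × W))}
    (h₁ : G.map (concMap n (LinearMap.fst k V W)) c = G.map (concMap n (LinearMap.fst k V W)) d)
    (h₂ : G.map (concMap n (LinearMap.snd k V W)) c = G.map (concMap n (LinearMap.snd k V W)) d) :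
    c = d := by
  refine (IsHomogeneous.existsUnique (G := G) _ _ _ _ (isFibreProduct_prod (n := n))
    (fun m y => ⟨0, funext fun _ => rfl⟩) (G.map (concMap n (LinearMap.fst k V W)) d)
    (G.map (concMap n (LinearMap.snd k V W)) d) ?_).unique ⟨h₁, h₂⟩ ⟨rfl, rfl⟩
  rw [map_concMap_zero, map_concMap_zero]

/-- Addition of linear maps becomes multiplication in `G`. -/
theorem map_concMap_add (f f' : V →ₗ[k] W) (a : G.obj (conc (k := k) n V)) :
    G.map (concMap n (f + f')) a = G.map (concMap n f) a * G.map (concMap n f') a := by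
  have key : G.map (concMap n (f.prod f')) a =
      G.map (concMap n (LinearMap.inl k W W)) (G.map (concMap n f) a) *
        G.map (concMap n (LinearMap.inr k W W)) (G.map (concMap n f') a) := by
    apply prod_ext G
    · simp only [map_mul, map_concMap_comp, ← LinearMap.comp_assoc]
      simp [map_concMap_zero]
    · simp only [map_mul, map_concMap_comp, ← LinearMap.comp_assoc]
      simp [map_concMap_zero]
  have := congrArg (G.map (concMap n (LinearMap.coprod LinearMap.id LinearMap.id))) key
  simp only [map_mul, map_concMap_comp, ← LinearMap.comp_assoc] at this
  simpa [LinearMap.coprod_comp_prod] using this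

/-- The groups `G(V)` are commutative. -/
theorem conc_mul_comm (a b : G.obj (conc (k := k) n V)) : a * b = b * a := by
  have key : G.map (concMap n (LinearMap.inl k V V)) a * G.map (concMap n (LinearMap.inr k V V)) b =
      G.map (concMap n (LinearMap.inr k V V)) b * G.map (concMap n (LinearMap.inl k V V)) a := by
    apply prod_ext G
    · simp [map_concMap_comp, map_concMap_zero]
    · simp [map_concMap_comp, map_concMap_zero]
  have := congrArg (G.map (concMap n (LinearMap.coprod LinearMap.id LinearMap.id))) key
  simpa [map_concMap_comp, map_concMap_id] using this

end conc

/-- The degree `n` part `A^n = G(k ε)`, `ε` in degree `n`, of the tangent space of `G`. -/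
def Tangent (G : GrNilpLie k ⥤ GrpCat.{w}) (n : ℕ) : Type w := G.obj (line k n)

namespace Tangent

variable (G : GrNilpLie k ⥤ GrpCat.{w}) {n : ℕ}

/-- A tangent vector, seen as an element of the group `G(k ε)`. -/
def toGroup (a : Tangent G n) : G.obj (line k n) := a

variable [IsReduced G] [IsHomogeneous G]

/-- The addition of the tangent space: `G(k ⊕ k) ≅ G(k) × G(k)` followed by `G` of the sum map.
By `map_concMap_add`, applied to the two projections, this is the multiplication of `G(k ε)`. -/
instance : AddCommGroup (Tangent G n) :=
  { (inferInstanceAs (AddGroup (Additive (G.obj (line k n)))) : AddGroup (Tangent G n)) with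
    add_comm := fun a b => conc_mul_comm G (toGroup G a) (toGroup G b) }

/-- The scalar `c` acts on the tangent space through the endomorphism `ε ↦ c ε` of `k ε`. -/
instance : Module k (Tangent G n) where
  smul c a := G.map (concMap n (c • (LinearMap.id : k →ₗ[k] k))) (toGroup G a)
  one_smul a := by
    change G.map (concMap n ((1 : k) • LinearMap.id)) (toGroup G a) = toGroup G a
    rw [one_smul, map_concMap_id]
  mul_smul c d a := by
    change G.map (concMap n ((c * d) • LinearMap.id)) (toGroup G a) =
      G.map (concMap n (c • LinearMap.id)) (G.map (concMap n (d • LinearMap.id)) (toGroup G a))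
    rw [map_concMap_comp, LinearMap.smul_comp, LinearMap.id_comp, mul_smul]
  smul_zero c := map_one (G.map (concMap n (c • LinearMap.id))).hom
  smul_add c a b := map_mul (G.map (concMap n (c • LinearMap.id))).hom (toGroup G a) (toGroup G b)
  add_smul c d a := by
    change G.map (concMap n ((c + d) • LinearMap.id)) (toGroup G a) =
      G.map (concMap n (c • LinearMap.id)) (toGroup G a) *
        G.map (concMap n (d • LinearMap.id)) (toGroup G a)
    rw [add_smul, map_concMap_add]
  zero_smul a := by
    change G.map (concMap n ((0 : k) • LinearMap.id)) (toGroup G a) = 1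
    rw [zero_smul, map_concMap_zero]

end Tangent
end GrNilpLie

/-! ### Graded-commutative algebras -/

/-- The structure of a graded-commutative associative algebra, without unit, on a graded vector
space `A^*`. The product `A^i × A^j → A^n` is recorded for every `n` with a proof of `i + j = n`. -/
structure GAStructure (k : Type u) [Field k] (A : ℕ → Type w)
    [∀ n, AddCommGroup (A n)] [∀ n, Module k (A n)] where
  mul : ∀ i j n : ℕ, i + j = n → (A i →ₗ[k] A j →ₗ[k] A n)
  comm : ∀ (i j n : ℕ) (h : i + j = n) (h' : j + i = n) (a : A i) (b : A j),
    mul i j n h a b = (-1 : k) ^ (i * j) • mul j i n h' b a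
  assoc : ∀ (i j l ij jl n : ℕ) (hij : i + j = ij) (hjl : j + l = jl)
    (h₁ : ij + l = n) (h₂ : i + jl = n) (a : A i) (b : A j) (c : A l),
    mul ij l n h₁ (mul i j ij hij a b) c = mul i jl n h₂ a (mul j l jl hjl b c)

/-! ### The Lie algebra `⨁ A^n ⊗ g_n` -/

section Total

variable {k : Type u} [Field k] {A : ℕ → Type w}
  [∀ n, AddCommGroup (A n)] [∀ n, Module k (A n)]

/-- The vector space `⨁ A^n ⊗ g_n`. (The product of `A^*` is a parameter, since the Lie bracket
below depends on it.) -/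
def TotalLie (_ : GAStructure k A) (g : GradedLie k) : Type (max u w) :=
  ⨁ n, A n ⊗[k] g.carrier n

namespace TotalLie

variable (M : GAStructure k A) (g : GradedLie k)

noncomputable instance : AddCommGroup (TotalLie M g) :=
  inferInstanceAs (AddCommGroup (⨁ n, A n ⊗[k] g.carrier n))

noncomputable instance : Module k (TotalLie M g) :=
  inferInstanceAs (Module k (⨁ n, A n ⊗[k] g.carrier n))

/-- The inclusion of the summand `A^n ⊗ g_n`. -/
noncomputable def incl (n : ℕ) : A n ⊗[k] g.carrier n →ₗ[k] TotalLie M g :=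
  DirectSum.lof k ℕ (fun n => A n ⊗[k] g.carrier n) n

/-- The bracket on `⨁ A^n ⊗ g_n`:
`[a ⊗ x, b ⊗ y] = (-1)^{ij} (a b) ⊗ [x, y]` for `a ∈ A^i`, `x ∈ g_i`, `b ∈ A^j`, `y ∈ g_j`. -/
noncomputable def bracket : TotalLie M g →ₗ[k] TotalLie M g →ₗ[k] TotalLie M g :=
  DirectSum.toModule k ℕ (TotalLie M g →ₗ[k] TotalLie M g) fun i => LinearMap.flip <|
    DirectSum.toModule k ℕ (A i ⊗[k] g.carrier i →ₗ[k] TotalLie M g) fun j => LinearMap.flip <|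
      (-1 : k) ^ (i * j) • (TensorProduct.map₂ (M.mul i j (i + j) rfl)
        (g.bracket i j (i + j) rfl)).compr₂ (incl M g (i + j))

theorem bracket_tmul (i j n : ℕ) (h : i + j = n) (a : A i) (x : g.carrier i) (b : A j)
    (y : g.carrier j) :
    bracket M g (incl M g i (a ⊗ₜ x)) (incl M g j (b ⊗ₜ y)) =
      (-1 : k) ^ (i * j) • incl M g n (M.mul i j n h a b ⊗ₜ g.bracket i j n h x y) := by
  subst h
  simp only [bracket]
  erw [DirectSum.toModule_lof, LinearMap.flip_apply, DirectSum.toModule_lof]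
  simp

variable {M g} in
theorem induction {p : TotalLie M g → Prop} (x : TotalLie M g) (zero : p 0)
    (tmul : ∀ n a y, p (incl M g n (a ⊗ₜ y))) (add : ∀ x y, p x → p y → p (x + y)) : p x := by
  refine DirectSum.induction_on x zero (fun n t => ?_) add
  change p (incl M g n t)
  induction t using TensorProduct.induction_on with
  | zero => rwa [map_zero]
  | tmul a y => exact tmul n a y
  | add s t hs ht => rw [map_add]; exact add _ _ hs ht

theorem bracket_skew (x y : TotalLie M g) : bracket M g x y = -bracket M g y x := by
  induction x using TotalLie.induction with
  | zero => simp
  | add x x' hx hx' => rw [map_add, LinearMap.add_apply, hx, hx', map_add, neg_add]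
  | tmul i a x =>
    induction y using TotalLie.induction with
    | zero => simp
    | add y y' hy hy' => rw [map_add, hy, hy', map_add, LinearMap.add_apply, neg_add]
    | tmul j b y =>
      rw [bracket_tmul M g i j (i + j) rfl, bracket_tmul M g j i (i + j) (add_comm j i),
        M.comm i j (i + j) rfl (add_comm j i), g.skew i j (i + j) rfl (add_comm j i),
        mul_comm j i]
      simp only [TensorProduct.tmul_neg, TensorProduct.tmul_smul, ← TensorProduct.smul_tmul',
        map_neg, map_smul, smul_neg, smul_smul]
      rw [← mul_pow]
      simp

theorem bracket_jacobi (x y z : TotalLie M g) :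
    bracket M g x (bracket M g y z) =
      bracket M g (bracket M g x y) z + bracket M g y (bracket M g x z) := by
  induction x using TotalLie.induction with
  | zero => simp
  | add x x' hx hx' =>
    simp only [map_add, LinearMap.add_apply, hx, hx']
    abel
  | tmul i a x =>
    induction y using TotalLie.induction with
    | zero => simp
    | add y y' hy hy' =>
      simp only [map_add, LinearMap.add_apply, hy, hy']
      abel
    | tmul j b y =>
      induction z using TotalLie.induction with
      | zero => simp
      | add z z' hz hz' =>
        simp only [map_add, hz, hz']
        abel
      | tmul l c z =>
        have e₁ : i + (j + l) = i + j + l := (add_assoc i j l).symm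
        have e₂ : j + (i + l) = i + j + l := by omega
        simp only [bracket_tmul M g i j _ rfl, bracket_tmul M g j l _ rfl,
          bracket_tmul M g i l _ rfl, map_smul, LinearMap.smul_apply,
          bracket_tmul M g i (j + l) _ e₁, bracket_tmul M g (i + j) l _ rfl,
          bracket_tmul M g j (i + l) _ e₂]
        have hm : M.mul j (i + l) (i + j + l) e₂ b (M.mul i l (i + l) rfl a c) =
            (-1 : k) ^ (i * j) • M.mul i (j + l) (i + j + l) e₁ a (M.mul j l (j + l) rfl b c) := by
          rw [← M.assoc j i l (i + j) (i + l) (i + j + l) (add_comm j i) rfl rfl e₂,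
            M.comm j i (i + j) (add_comm j i) rfl, map_smul, LinearMap.smul_apply,
            M.assoc i j l (i + j) (j + l) (i + j + l) rfl rfl rfl e₁, mul_comm j i]
        rw [hm, M.assoc i j l (i + j) (j + l) (i + j + l) rfl rfl rfl e₁,
          g.jacobi i j l (i + j) (i + l) (j + l) (i + j + l) rfl rfl rfl e₁ rfl e₂]
        simp only [TensorProduct.tmul_add, TensorProduct.tmul_smul, ← TensorProduct.smul_tmul',
          map_add, map_smul, smul_add, smul_smul, ← pow_add]
        congr 2
        · congr 1; ring
        · congr 1; ring

noncomputable instance [CharZero k] : LieRing (TotalLie M g) where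
  bracket x y := bracket M g x y
  add_lie x y z := by
    change bracket M g (x + y) z = bracket M g x z + bracket M g y z
    simp
  lie_add x y z := by
    change bracket M g x (y + z) = bracket M g x y + bracket M g x z
    simp
  lie_self x := by
    change bracket M g x x = 0
    have h : (2 : k) • bracket M g x x = 0 := by
      rw [two_smul]
      nth_rewrite 1 [bracket_skew]
      simp
    simpa using h
  leibniz_lie x y z := bracket_jacobi M g x y z

noncomputable instance [CharZero k] : LieAlgebra k (TotalLie M g) where
  lie_smul c x y := by
    change bracket M g x (c • y) = c • bracket M g x y
    simp

/-- Functoriality of `⨁ A^n ⊗ g_n` in `g`. -/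
noncomputable def map {g h : GrNilpLie k} (f : g ⟶ h) :
    TotalLie M g.toGradedLie →ₗ[k] TotalLie M h.toGradedLie :=
  DirectSum.lmap fun n => (GrNilpLie.Hom.app f n).lTensor (A n)

end TotalLie
end Total

/-! ### The group `exp(L)` of a nilpotent Lie algebra -/

/-- The right-nested bracket `[x₁, [x₂, [… , x_r]]]` of a nonempty list of elements. -/
def nestedBracket {L : Type*} [LieRing L] : List L → L
  | [] => 0
  | [x] => x
  | x :: y :: l => ⁅x, nestedBracket (y :: l)⁆

/-- The coefficient
`(-1)^{m-1} / m · 1 / ((r₁ + s₁) + ⋯ + (r_m + s_m)) · 1 / (r₁! s₁! ⋯ r_m! s_m!)`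
of Dynkin's formula, for a list `(r₁, s₁), …, (r_m, s_m)` with `m ≥ 1`. -/
def dynkinCoeff (p : List (ℕ × ℕ)) : ℚ :=
  (-1) ^ (p.length + 1) / p.length / (p.map fun q => q.1 + q.2).sum *
    (p.map fun q => (1 / (q.1.factorial * q.2.factorial) : ℚ)).prod

/-- The list `x, …, x, y, …, y, x, …` with `r₁` times `x`, `s₁` times `y`, `r₂` times `x`, … -/
def dynkinWord {L : Type*} (p : List (ℕ × ℕ)) (x y : L) : List L :=
  p.flatMap fun q => List.replicate q.1 x ++ List.replicate q.2 y

/-- The Baker–Campbell–Hausdorff product `log(e^x e^y)`, by Dynkin's formula: the sum runs over all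
lists `(r₁, s₁), …, (r_m, s_m)` with `r_i + s_i > 0`. In a nilpotent Lie algebra, only finitely
many terms are nonzero. -/
noncomputable def bch (k : Type*) {L : Type*} [Field k] [LieRing L] [LieAlgebra k L] (x y : L) :
    L :=
  ∑ᶠ (p : List (ℕ × ℕ)) (_ : ∀ q ∈ p, q ≠ (0, 0)),
    (dynkinCoeff p : k) • nestedBracket (dynkinWord p x y)

/-- The group `exp(L)` of a nilpotent Lie algebra `L` over a field `k` of characteristic zero:
the set `L` with the Baker–Campbell–Hausdorff product. -/
def ExpLie (k : Type*) (L : Type*) [Field k] [LieRing L] [LieAlgebra k L] : Type _ := L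

namespace ExpLie

variable (k : Type*) {L : Type*} [Field k] [LieRing L] [LieAlgebra k L]

/-- The element of `exp(L)` given by `x ∈ L`. -/
def of (x : L) : ExpLie k L := x

/-- The element of `L` given by an element of `exp(L)`. -/
def log (x : ExpLie k L) : L := x

noncomputable instance : Mul (ExpLie k L) := ⟨fun x y => of k (bch k (log k x) (log k y))⟩

end ExpLie

/-!
The proof replaces power series by nilpotent parameters. For a graded Lie algebra `g` let `ab g` be
the abelian graded Lie algebra with the same underlying vector space, and put `L(g) = G(ab g)`
(`LieT`). By homogeneity, `L(g)` is a vector space which depends functorially on linear maps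
of `g`, and a basis of `g` gives `L(g) = ⨁ A^n ⊗ g_n` (`LieT.tensorEquiv`). Left exactness of `G`
(`existsUnique_of_map_eq_one`) identifies `L(g)` with the kernel of `G(g[ε]) → G(g)`, where
`ε² = 0`. Three structures come out of this identification:

* the conjugation action `Ad` of `G(g)` on `L(g)`; its derivative is a Lie bracket on `L(g)`, which
  is skew because `ε₁` and `ε₂` can be exchanged in `G(g[ε₁][ε₂])` (`LieT.br_skew`);
* the product of `A^*`: evaluated on the generators of a Heisenberg algebra of matrices, the bracket
  of `L` is a multiple `± a b` of the central element, and naturality carries this over to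
  `[a ⊗ x, b ⊗ y] = ± a b ⊗ [x, y]` for all `g` (`LieT.br_tens`). Skew symmetry of the bracket
  yields commutativity of the product, and the Jacobi identity for `4 × 4` matrices yields
  associativity;
* the logarithmic derivative `LieT.dlog` of elements of `G(g)` along a derivation of `g`.

The exponential map `Phi : L(g) → G(g)` is obtained by solving a differential equation. In the
truncated Rees algebra `rees N g = ⨁_{1 ≤ w ≤ N} lcs (w - 1) t^w`, the derivation `t d/dt` has
positive weights, so that `u ↦ dlog u` is a bijection from `G(rees N g)` to `L(rees N g)`: the
kernel of `rees (N + 1) g → rees N g` is central, smoothness lifts solutions, and characteristic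
zero allows to divide by the weight (`LieT.dlog_reesT_injective`, `LieT.dlog_reesT_surjective`).
The element `e^{tX}` is the solution of `dlog u = X t`, and `Phi X` is its value at `t = 1`, which
makes sense as soon as `N` exceeds the nilpotency class. Uniqueness of solutions of linear
differential equations gives `Ad (Phi X) = e^{ad X}` and `dlog (Phi X) = (e^{ad X} - 1) / (ad X)
(D X)` (`LieT.Ad_Phi`, `LieT.dlog_Phi`).

On `rees N g`, the map `Phi` is surjective by induction on `N`, and injective since the formula for
`dlog (Phi W)` can be solved for `t dW/dt`. For the element `Phi (X t) * Phi (Y t) = Phi W` this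
solution is Dynkin's series, so `W = bch (X t) (Y t)` (`LieT.Phi_bch_rees`,
`map_bch_of_derivation`). The evaluation at `t = 1` transports multiplicativity and surjectivity to
`g`, and surjectivity for the kernel of the evaluation gives injectivity (`LieT.Phi_injective`).
-/

set_option linter.unusedSectionVars false

/-! ### Constructions with graded Lie algebras -/

namespace GradedLie

variable {k : Type u} [Field k]

theorem lcs_succ (g : GradedLie k) (r n : ℕ) : g.lcs (r + 1) n = Submodule.span k
    {z | ∃ (i j : ℕ) (h : i + j = n) (x : g.carrier i) (y : g.carrier j),
      y ∈ g.lcs r j ∧ g.bracket i j n h x y = z} := rfl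

theorem bracket_mem_lcs_succ (g : GradedLie k) {r i j n : ℕ} (h : i + j = n) (x : g.carrier i)
    {y : g.carrier j} (hy : y ∈ g.lcs r j) : g.bracket i j n h x y ∈ g.lcs (r + 1) n :=
  Submodule.subset_span ⟨i, j, h, x, y, hy, rfl⟩

/-- The lower central series is the fastest descending central filtration. -/
theorem lcs_le (g : GradedLie k) (P : ℕ → ∀ n, Submodule k (g.carrier n))
    (h0 : ∀ n, P 0 n = ⊤)
    (hP : ∀ r i j n (h : i + j = n) (x : g.carrier i) (y : g.carrier j), y ∈ P r j →
      g.bracket i j n h x y ∈ P (r + 1) n) (r n : ℕ) : g.lcs r n ≤ P r n := by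
  induction r generalizing n with
  | zero => rw [h0]; exact le_top
  | succ r ih =>
    rw [lcs_succ, Submodule.span_le]
    rintro z ⟨i, j, h, x, y, hy, rfl⟩
    exact hP r i j n h x y (ih j hy)

theorem lcs_antitone (g : GradedLie k) (r n : ℕ) : g.lcs (r + 1) n ≤ g.lcs r n := by
  induction r generalizing n with
  | zero => exact le_top
  | succ r ih =>
    rw [lcs_succ, lcs_succ]
    refine Submodule.span_mono ?_
    rintro z ⟨i, j, h, x, y, hy, rfl⟩
    exact ⟨i, j, h, x, y, ih j hy, rfl⟩

/-- `[lcs a, lcs b] ⊆ lcs (a + b + 1)`; recall that `lcs` is indexed from `0`. -/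
theorem bracket_mem_lcs (g : GradedLie k) {a b i j n : ℕ} (h : i + j = n) {x : g.carrier i}
    {y : g.carrier j} (hx : x ∈ g.lcs a i) (hy : y ∈ g.lcs b j) :
    g.bracket i j n h x y ∈ g.lcs (a + b + 1) n := by
  induction a generalizing b i j n with
  | zero => simpa using g.bracket_mem_lcs_succ h x hy
  | succ a ih =>
    rw [lcs_succ] at hx
    induction hx using Submodule.span_induction with
    | zero => simp
    | add x x' _ _ hx hx' => rw [map_add, LinearMap.add_apply]; exact add_mem hx hx'
    | smul c x _ hx => rw [map_smul, LinearMap.smul_apply]; exact Submodule.smul_mem _ c hx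
    | mem z hz =>
      obtain ⟨p, q, hpq, x, x', hx', rfl⟩ := hz
      have e : p + (q + j) = n := by omega
      have e' : q + (p + j) = n := by omega
      have key := g.jacobi p q j i (p + j) (q + j) n hpq rfl rfl e h e' x x' y
      rw [← sub_eq_iff_eq_add] at key
      rw [← key]
      have h1 := ih (b := b) (i := q) (j := j) rfl hx' hy
      have h2 := g.bracket_mem_lcs_succ (r := b) (i := p) (j := j) rfl x hy
      refine sub_mem ?_ (Submodule.smul_mem _ _ ?_)
      · have := g.bracket_mem_lcs_succ e x h1
        rwa [show a + 1 + b + 1 = a + b + 1 + 1 by ring]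
      · have := ih e' hx' h2
        rwa [show a + 1 + b + 1 = a + (b + 1) + 1 by ring]

end GradedLie

namespace GrNilpLie

variable {k : Type u} [Field k]

/-- Degree-preserving linear maps, with no condition on brackets. -/
abbrev GLin (g h : GrNilpLie k) := ∀ n, g.carrier n →ₗ[k] h.carrier n

theorem hom_ext {g h : GrNilpLie k} {f f' : g ⟶ h}
    (H : ∀ n x, Hom.app f n x = Hom.app f' n x) : f = f' :=
  Hom.ext (funext fun n => LinearMap.ext (H n))

theorem bracket_eq_zero_of_swap (g : GrNilpLie k) {i j n : ℕ} (h : i + j = n) {x : g.carrier i}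
    {y : g.carrier j} (h0 : g.bracket j i n (by omega) y x = 0) : g.bracket i j n h x y = 0 := by
  rw [g.skew i j n h (by omega), h0, smul_zero, neg_zero]

/-- The abelian graded Lie algebra on the graded vector space underlying `g`. -/
abbrev ab (g : GrNilpLie k) : GrNilpLie k where
  carrier := g.carrier
  bracket _ _ _ _ := 0
  skew := by intros; simp
  jacobi := by intros; simp
  finite := g.finite
  bounded := g.bounded
  nilpotent := ⟨1, fun m => by
    rw [GradedLie.lcs, Submodule.span_eq_bot]
    rintro z ⟨i, j, h, x, y, -, rfl⟩
    rfl⟩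

/-- The morphism from an abelian graded Lie algebra given by a linear map with commutative
image. -/
def abHom {g h : GrNilpLie k} (f : GLin g h)
    (hf : ∀ i j n e x y, h.bracket i j n e (f i x) (f j y) = 0) : ab g ⟶ h :=
  Hom.mk f fun i j n e x y => (map_zero (f n)).trans (hf i j n e x y).symm

/-- Linear maps are morphisms between the underlying abelian graded Lie algebras. -/
def abMap {g h : GrNilpLie k} (f : GLin g h) : ab g ⟶ ab h :=
  Hom.mk f fun _ _ n _ _ _ => map_zero (f n)

/-- The graded Lie algebra `g[ε] = g ⊗ k[ε]/(ε²)`, where `ε` has degree zero; the pair `(x, y)`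
stands for `x + ε y`. -/
abbrev dualLie (g : GradedLie k) : GradedLie k where
  carrier n := g.carrier n × g.carrier n
  bracket i j n h := LinearMap.mk₂ k
    (fun x y => (g.bracket i j n h x.1 y.1, g.bracket i j n h x.1 y.2 + g.bracket i j n h x.2 y.1))
    (by intros; ext <;> simp; abel) (by intros; ext <;> simp)
    (by intros; ext <;> simp; abel) (by intros; ext <;> simp)
  skew i j n h h' x y := by
    ext
    · simpa using g.skew i j n h h' x.1 y.1
    · simp only [LinearMap.mk₂_apply, Prod.snd_neg, Prod.smul_snd]
      rw [g.skew i j n h h' x.1 y.2, g.skew i j n h h' x.2 y.1, smul_add, neg_add, add_comm]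
  jacobi i j l ij il jl n hij hil hjl h₁ h₂ h₃ x y z := by
    ext
    · simpa using g.jacobi i j l ij il jl n hij hil hjl h₁ h₂ h₃ x.1 y.1 z.1
    · simp only [LinearMap.mk₂_apply, Prod.snd_add, Prod.smul_snd, map_add, LinearMap.add_apply]
      rw [g.jacobi i j l ij il jl n hij hil hjl h₁ h₂ h₃ x.2 y.1 z.1,
        g.jacobi i j l ij il jl n hij hil hjl h₁ h₂ h₃ x.1 y.2 z.1,
        g.jacobi i j l ij il jl n hij hil hjl h₁ h₂ h₃ x.1 y.1 z.2]
      simp only [smul_add]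
      abel

theorem dualLie_lcs_le (g : GradedLie k) (r n : ℕ) (x : (dualLie g).carrier n)
    (hx : x ∈ (dualLie g).lcs r n) : x.1 ∈ g.lcs r n ∧ x.2 ∈ g.lcs r n := by
  refine GradedLie.lcs_le (dualLie g) (fun r n => (g.lcs r n).prod (g.lcs r n)) ?_ ?_ r n hx
  · intro n
    exact Submodule.prod_top
  · intro r i j n h x y hy
    exact ⟨g.bracket_mem_lcs_succ h x.1 hy.1,
      add_mem (g.bracket_mem_lcs_succ h x.1 hy.2) (g.bracket_mem_lcs_succ h x.2 hy.1)⟩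

/-- The graded Lie algebra `g[ε]` is finite-dimensional and nilpotent if `g` is. -/
abbrev dual (g : GrNilpLie k) : GrNilpLie k where
  toGradedLie := dualLie g.toGradedLie
  finite n := by have := g.finite n; exact Module.Finite.prod
  bounded := by
    obtain ⟨N, hN⟩ := g.bounded
    exact ⟨N, fun n hn => by have := hN n hn; exact inferInstanceAs (Subsingleton (_ × _))⟩
  nilpotent := by
    obtain ⟨r, hr⟩ := g.nilpotent
    refine ⟨r, fun n => (Submodule.eq_bot_iff _).2 fun x hx => ?_⟩
    have h := dualLie_lcs_le _ r n x hx
    rw [hr, Submodule.mem_bot, Submodule.mem_bot] at h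
    exact Prod.ext h.1 h.2

theorem dual_bracket (g : GrNilpLie k) (i j n : ℕ) (h : i + j = n) (x : (dual g).carrier i)
    (y : (dual g).carrier j) : (dual g).bracket i j n h x y =
      (g.bracket i j n h x.1 y.1, g.bracket i j n h x.1 y.2 + g.bracket i j n h x.2 y.1) := rfl

section dual

variable (g : GrNilpLie k)

/-- `x + ε y ↦ x`, as a linear map. -/
def dfst : GLin (dual g) g := fun _ => LinearMap.fst k _ _
/-- `x + ε y ↦ y`. -/
def dsnd : GLin (dual g) g := fun _ => LinearMap.snd k _ _
/-- `x ↦ x`, as a linear map `g → g[ε]`. -/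
def dinl : GLin g (dual g) := fun _ => LinearMap.inl k _ _
/-- `x ↦ ε x`. -/
def dinr : GLin g (dual g) := fun _ => LinearMap.inr k _ _

/-- The inclusion of `g` in `g[ε]`. -/
def dualIncl : g ⟶ dual g := Hom.mk (dinl g) fun i j n e x y => by
  rw [dual_bracket]
  exact Prod.ext rfl (by simp [dinl])

/-- The reduction modulo `ε`. -/
def dualProj : dual g ⟶ g := Hom.mk (dfst g) fun _ _ _ _ _ _ => rfl

/-- The inclusion of the abelian ideal `ε g` in `g[ε]`. -/
def dualEps : ab g ⟶ dual g := abHom (dinr g) fun i j n e x y => by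
  rw [dual_bracket]
  exact Prod.ext (by simp [dinr]) (by simp [dinr])

/-- The endomorphism `ε ↦ c ε` of `g[ε]`. -/
def dualScale (c : k) : dual g ⟶ dual g :=
  Hom.mk (fun _ => LinearMap.prodMap LinearMap.id (c • LinearMap.id)) fun i j n e x y => by
    rw [dual_bracket, dual_bracket]
    exact Prod.ext rfl (by simp)

/-- The exchange of `ε₁` and `ε₂` in `g[ε₁][ε₂]`. -/
def dualSwap : dual (dual g) ⟶ dual (dual g) :=
  Hom.mk (fun _ => (LinearMap.prodMap (LinearMap.fst k _ _) (LinearMap.fst k _ _)).prod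
    (LinearMap.prodMap (LinearMap.snd k _ _) (LinearMap.snd k _ _))) fun i j n e x y => by
    refine Prod.ext (Prod.ext rfl rfl) (Prod.ext rfl ?_)
    change (g.bracket i j n e x.1.1 y.2.2 + g.bracket i j n e x.1.2 y.2.1) +
        (g.bracket i j n e x.2.1 y.1.2 + g.bracket i j n e x.2.2 y.1.1) =
      (g.bracket i j n e x.1.1 y.2.2 + g.bracket i j n e x.2.1 y.1.2) +
        (g.bracket i j n e x.1.2 y.2.1 + g.bracket i j n e x.2.2 y.1.1)
    abel

/-- The morphism `g[ε] ⟶ g[ε₁][ε₂]` with `ε ↦ ε₁ ε₂`. -/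
def dualMul : dual g ⟶ dual (dual g) :=
  Hom.mk (fun _ => LinearMap.prodMap (LinearMap.inl k _ _) (LinearMap.inr k _ _))
    fun i j n e x y => by
    refine Prod.ext (Prod.ext rfl ?_) (Prod.ext ?_ ?_) <;> simp

end dual

/-- The functor `g ↦ g[ε]` on morphisms. -/
def dualMap {g h : GrNilpLie k} (f : g ⟶ h) : dual g ⟶ dual h :=
  Hom.mk (fun n => LinearMap.prodMap (Hom.app f n) (Hom.app f n)) fun i j n e x y => by
    rw [dual_bracket, dual_bracket]
    exact Prod.ext (f.map_bracket _ _ _ _ _ _) (by simp [f.map_bracket])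

/-- Derivations of degree zero. -/
def IsDer {g : GrNilpLie k} (D : GLin g g) : Prop :=
  ∀ i j n e x y, D n (g.bracket i j n e x y) =
    g.bracket i j n e (D i x) y + g.bracket i j n e x (D j y)

/-- The morphism `1 + ε D : g ⟶ g[ε]` given by a derivation `D`. -/
def derHom {g : GrNilpLie k} {D : GLin g g} (hD : IsDer D) : g ⟶ dual g :=
  Hom.mk (fun n => LinearMap.id.prod (D n)) fun i j n e x y => by
    rw [dual_bracket]
    exact Prod.ext rfl ((hD i j n e x y).trans (add_comm _ _))

/-- The `ε`-linear extension to `g[ε]` of a linear map. -/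
def dualLin {g h : GrNilpLie k} (D : GLin g h) : GLin (dual g) (dual h) :=
  fun n => LinearMap.prodMap (D n) (D n)

theorem IsDer.dualLin {g : GrNilpLie k} {D : GLin g g} (hD : IsDer D) :
    IsDer (GrNilpLie.dualLin D) := by
  intro i j n e x y
  refine Prod.ext (hD i j n e x.1 y.1) ?_
  change D n (g.bracket i j n e x.1 y.2 + g.bracket i j n e x.2 y.1) =
    (g.bracket i j n e (D i x.1) y.2 + g.bracket i j n e (D i x.2) y.1) +
      (g.bracket i j n e x.1 (D j y.2) + g.bracket i j n e x.2 (D j y.1))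
  rw [map_add, hD, hD]
  abel

/-- The morphism `(z, y) ↦ s z + ε r y` from an abelian graded Lie algebra. -/
def pairHom {g' g : GrNilpLie k} (s r : GLin g' g)
    (hs : ∀ i j n e x y, g.bracket i j n e (s i x) (s j y) = 0)
    (hr : ∀ i j n e x y, g.bracket i j n e (s i x) (r j y) = 0) :
    ab (dual g') ⟶ dual g :=
  abHom (g := dual g') (fun n => LinearMap.prodMap (s n) (r n)) fun i j n e x y => by
    rw [dual_bracket]
    refine Prod.ext (hs _ _ _ _ _ _) ?_
    simp only [LinearMap.prodMap_apply, hr, zero_add]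
    exact bracket_eq_zero_of_swap _ _ (hr _ _ _ _ _ _)

/-- The abelian graded Lie algebra on a graded subspace of `g`. -/
abbrev abSub (g : GrNilpLie k) (S : ∀ n, Submodule k (g.carrier n)) : GrNilpLie k where
  carrier n := S n
  bracket _ _ _ _ := 0
  skew := by intros; simp
  jacobi := by intros; simp
  finite n := by have := g.finite n; infer_instance
  bounded := by
    obtain ⟨N, hN⟩ := g.bounded
    exact ⟨N, fun n hn => by have := hN n hn; infer_instance⟩
  nilpotent := ⟨1, fun m => by
    rw [GradedLie.lcs, Submodule.span_eq_bot]
    rintro z ⟨i, j, h, x, y, -, rfl⟩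
    rfl⟩

/-- The kernel of a morphism. -/
abbrev kerLie {g h : GrNilpLie k} (f : g ⟶ h) : GradedLie k where
  carrier n := LinearMap.ker (Hom.app f n)
  bracket i j n e := LinearMap.mk₂ k (fun x y => ⟨g.bracket i j n e x.1 y.1, by
      rw [LinearMap.mem_ker, f.map_bracket, LinearMap.mem_ker.1 x.2, map_zero,
        LinearMap.zero_apply]⟩)
    (by intros; ext; simp) (by intros; ext; simp)
    (by intros; ext; simp) (by intros; ext; simp)
  skew i j n h h' x y := Subtype.ext (g.skew i j n h h' x.1 y.1)
  jacobi i j l ij il jl n hij hil hjl h₁ h₂ h₃ x y z :=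
    Subtype.ext (g.jacobi i j l ij il jl n hij hil hjl h₁ h₂ h₃ x.1 y.1 z.1)

theorem kerLie_lcs_le {g h : GrNilpLie k} (f : g ⟶ h) (r n : ℕ) (x : (kerLie f).carrier n)
    (hx : x ∈ (kerLie f).lcs r n) : x.1 ∈ g.lcs r n := by
  refine GradedLie.lcs_le (kerLie f)
    (fun r n => (g.lcs r n).comap (LinearMap.ker (Hom.app f n)).subtype) ?_ ?_ r n hx
  · intro n
    exact Submodule.comap_top _
  · intro r i j n h x y hy
    exact g.bracket_mem_lcs_succ h x.1 hy

/-- The kernel of a morphism is finite-dimensional and nilpotent. -/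
abbrev kerObj {g h : GrNilpLie k} (f : g ⟶ h) : GrNilpLie k where
  toGradedLie := kerLie f
  finite n := by
    have := g.finite n
    exact inferInstanceAs (Module.Finite k (LinearMap.ker (Hom.app f n)))
  bounded := by
    obtain ⟨N, hN⟩ := g.bounded
    exact ⟨N, fun n hn => by
      have := hN n hn
      exact inferInstanceAs (Subsingleton (LinearMap.ker (Hom.app f n)))⟩
  nilpotent := by
    obtain ⟨r, hr⟩ := g.nilpotent
    refine ⟨r, fun n => (Submodule.eq_bot_iff _).2 fun x hx => ?_⟩
    have h := kerLie_lcs_le f r n x hx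
    rw [hr, Submodule.mem_bot] at h
    exact Subtype.ext h

/-- The inclusion of the kernel of a morphism. -/
def kerIncl {g h : GrNilpLie k} (f : g ⟶ h) : kerObj f ⟶ g :=
  Hom.mk (fun n => (LinearMap.ker (Hom.app f n)).subtype) fun _ _ _ _ _ _ => rfl

end GrNilpLie

/-! ### The tangent Lie algebra of `G` at `g`: the underlying vector space -/

namespace GrNilpLie

variable {k : Type u} [Field k] (G : GrNilpLie k ⥤ GrpCat.{w})

theorem map_map {g h l : GrNilpLie k} (f : g ⟶ h) (f' : h ⟶ l) (a : G.obj g) :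
    G.map f' (G.map f a) = G.map (f ≫ f') a := by
  rw [G.map_comp]; rfl

theorem map_id_apply {g : GrNilpLie k} (a : G.obj g) : G.map (𝟙 g) a = a := by
  rw [G.map_id]; rfl

/-- A morphism that vanishes factors through the zero Lie algebra. -/
theorem map_eq_one [IsReduced G] {g h : GrNilpLie k} (f : g ⟶ h) (hf : ∀ n x, Hom.app f n x = 0)
    (a : G.obj g) : G.map f a = 1 := by
  have hs : Subsingleton (G.obj (conc (k := k) 0 PUnit.{u+1})) :=
    IsReduced.subsingleton _ fun m => ⟨fun _ _ => funext fun _ => rfl⟩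
  let p : g ⟶ conc (k := k) 0 PUnit.{u+1} := Hom.mk 0 fun _ _ _ _ _ _ => rfl
  let q : conc (k := k) 0 PUnit.{u+1} ⟶ h := Hom.mk 0 fun _ _ _ _ _ _ => by simp
  have h0 : f = p ≫ q := hom_ext fun n x => hf n x
  rw [h0, ← map_map, Subsingleton.elim (G.map p a) 1, map_one]

/-- Left exactness: `G` sends the kernel of a surjection to the kernel. -/
theorem existsUnique_of_map_eq_one [IsReduced G] [IsHomogeneous G] {P g h : GrNilpLie k}
    (p : P ⟶ g) (f : g ⟶ h) (hf : Surj f) (hp : ∀ n, Function.Injective (Hom.app p n))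
    (hpf : ∀ n z, Hom.app f n (Hom.app p n z) = 0)
    (hfp : ∀ n x, Hom.app f n x = 0 → ∃ z, Hom.app p n z = x)
    (u : G.obj g) (hu : G.map f u = 1) : ∃! c : G.obj P, G.map p c = u := by
  let z : GrNilpLie k := conc (k := k) 0 PUnit.{u+1}
  have hz : ∀ n (x y : z.carrier n), x = y := fun n x y => funext fun _ => rfl
  have hs : Subsingleton (G.obj z) := IsReduced.subsingleton _ fun m => ⟨hz m⟩
  let q : P ⟶ z := Hom.mk 0 fun _ _ _ _ _ _ => rfl
  let f' : z ⟶ h := Hom.mk 0 fun _ _ _ _ _ _ => by simp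
  have key : IsFibreProduct p q f f' := by
    refine ⟨hom_ext fun n x => hpf n x, fun n x y hxy => ?_⟩
    obtain ⟨c, hc⟩ := hfp n x hxy
    exact ⟨c, ⟨hc, hz _ _ _⟩, fun d hd => hp n (hd.1.trans hc.symm)⟩
  obtain ⟨c, hc, hu⟩ := IsHomogeneous.existsUnique (G := G) p q f f' key hf u 1
    (hu.trans (map_one _).symm)
  exact ⟨c, hc.1, fun d hd => hu d ⟨hd, Subsingleton.elim _ _⟩⟩

/-- The vector space `L(g)`: the value of `G` at the abelian graded Lie algebra underlying `g`. -/
def LieT (g : GrNilpLie k) : Type w := G.obj (ab g)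

namespace LieT

variable {G}

/-- The map `L(g) → G(h)` induced by a morphism from the abelian graded Lie algebra underlying
`g` to `h`. -/
def push {g h : GrNilpLie k} (s : ab g ⟶ h) (X : LieT G g) : G.obj h := G.map s X

theorem map_push {g h l : GrNilpLie k} (s : ab g ⟶ h) (f : h ⟶ l) (X : LieT G g) :
    G.map f (push s X) = push (s ≫ f) X := map_map G s f X

/-- The reduction modulo `ε` kills exactly the elements `1 + ε X`. -/
theorem existsUnique_push_dualEps [IsReduced G] [IsHomogeneous G] {g : GrNilpLie k}
    (v : G.obj (dual g)) (hv : G.map (dualProj g) v = 1) :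
    ∃! X : LieT G g, push (dualEps g) X = v :=
  existsUnique_of_map_eq_one G (dualEps g) (dualProj g) (fun _ x => ⟨(x, 0), rfl⟩)
    (fun _ _ _ h => congrArg Prod.snd h) (fun _ _ => rfl)
    (fun _ x hx => ⟨x.2, Prod.ext (Eq.symm hx) rfl⟩) v hv

section group

variable [IsReduced G] [IsHomogeneous G] {g h : GrNilpLie k}

/-- As a vector space, `g[ε]` is the fibre product of two copies of `g` over zero. -/
theorem isFibreProduct_dual (g : GrNilpLie k) : IsFibreProduct (abMap (dfst g)) (abMap (dsnd g))
    (Hom.mk 0 (fun _ _ _ _ _ _ => rfl) : ab g ⟶ conc (k := k) 0 PUnit.{u+1})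
    (Hom.mk 0 (fun _ _ _ _ _ _ => rfl) : ab g ⟶ conc (k := k) 0 PUnit.{u+1}) :=
  ⟨rfl, fun _ x y _ => ⟨(x, y), ⟨rfl, rfl⟩, by
    rintro z ⟨rfl, rfl⟩
    rfl⟩⟩

theorem dual_ext_aux {c d : G.obj (ab (dual g))}
    (h₁ : G.map (abMap (dfst g)) c = G.map (abMap (dfst g)) d)
    (h₂ : G.map (abMap (dsnd g)) c = G.map (abMap (dsnd g)) d) : c = d := by
  have hs : Subsingleton (G.obj (conc (k := k) 0 PUnit.{u+1})) :=
    IsReduced.subsingleton _ fun m => ⟨fun _ _ => funext fun _ => rfl⟩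
  exact (IsHomogeneous.existsUnique (G := G) _ _ _ _ (isFibreProduct_dual g)
    (fun m y => ⟨0, funext fun _ => rfl⟩) (G.map (abMap (dfst g)) d)
    (G.map (abMap (dsnd g)) d) (Subsingleton.elim _ _)).unique ⟨h₁, h₂⟩ ⟨rfl, rfl⟩

/-- The sum map `x + ε y ↦ x + y`. -/
def dsum (g : GrNilpLie k) : GLin (dual g) g := fun n => dfst g n + dsnd g n

/-- Addition of linear maps becomes multiplication in `G`. -/
theorem map_abMap_add (f f' : GLin g h) (a : G.obj (ab g)) :
    G.map (abMap (f + f')) a = G.map (abMap f) a * G.map (abMap f') a := by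
  have key : G.map (abMap (h := dual h) fun n => (f n).prod (f' n)) a =
      G.map (abMap (dinl h)) (G.map (abMap f) a) * G.map (abMap (dinr h)) (G.map (abMap f') a) := by
    apply dual_ext_aux
    · rw [map_mul]
      simp only [map_map]
      rw [map_eq_one G ((abMap f' ≫ abMap (dinr h)) ≫ abMap (dfst h)) fun _ _ => rfl, mul_one]
      rfl
    · rw [map_mul]
      simp only [map_map]
      rw [map_eq_one G ((abMap f ≫ abMap (dinl h)) ≫ abMap (dsnd h)) fun _ _ => rfl, one_mul]
      rfl
  have := congrArg (G.map (abMap (dsum h))) key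
  rw [map_mul] at this
  simp only [map_map] at this
  have e1 : (abMap f ≫ abMap (dinl h)) ≫ abMap (dsum h) = abMap f :=
    hom_ext fun n x => add_zero _
  have e2 : (abMap f' ≫ abMap (dinr h)) ≫ abMap (dsum h) = abMap f' :=
    hom_ext fun n x => zero_add _
  rw [e1, e2] at this
  exact this

/-- The group `G(ab g)` is commutative, since the two copies of `g` in `ab (g[ε])` commute. -/
theorem ab_mul_comm (a b : G.obj (ab g)) : a * b = b * a := by
  have e1 : G.map (abMap (dinl g) ≫ abMap (dsum g)) = 𝟙 _ := by
    rw [← G.map_id]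
    exact congrArg G.map (hom_ext fun n x => add_zero _)
  have e2 : G.map (abMap (dinr g) ≫ abMap (dsum g)) = 𝟙 _ := by
    rw [← G.map_id]
    exact congrArg G.map (hom_ext fun n x => zero_add _)
  have key : G.map (abMap (dinl g)) a * G.map (abMap (dinr g)) b =
      G.map (abMap (dinr g)) b * G.map (abMap (dinl g)) a := by
    apply dual_ext_aux
    · rw [map_mul, map_mul]
      simp only [map_map]
      rw [map_eq_one G (abMap (dinr g) ≫ abMap (dfst g)) fun _ _ => rfl, mul_one, one_mul]
    · rw [map_mul, map_mul]
      simp only [map_map]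
      rw [map_eq_one G (abMap (dinl g) ≫ abMap (dsnd g)) fun _ _ => rfl, mul_one, one_mul]
  have := congrArg (G.map (abMap (dsum g))) key
  rw [map_mul, map_mul] at this
  simp only [map_map, e1, e2] at this
  exact this

instance : AddCommGroup (LieT G g) :=
  { (inferInstanceAs (AddGroup (Additive (G.obj (ab g)))) : AddGroup (LieT G g)) with
    add_comm := fun a b => ab_mul_comm (G := G) (g := g) a b }

theorem push_add (s : ab g ⟶ h) (X Y : LieT G g) : push s (X + Y) = push s X * push s Y :=
  map_mul (G.map s).hom _ _

theorem push_zero (s : ab g ⟶ h) : push s (0 : LieT G g) = 1 := map_one (G.map s).hom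

theorem push_mul_comm (s : ab g ⟶ h) (X Y : LieT G g) :
    push s X * push s Y = push s Y * push s X := by
  rw [← push_add, ← push_add, add_comm]

theorem push_congr {s s' : ab g ⟶ h} (H : ∀ n x, Hom.app s n x = Hom.app s' n x)
    (X : LieT G g) : push s X = push s' X := by
  rw [hom_ext H]

/-- Scalars act on `L(g)` through the scalar endomorphisms of the vector space `g`. -/
instance : Module k (LieT G g) where
  smul c X := push (abMap fun _ => c • LinearMap.id) X
  one_smul X := by
    change G.map _ _ = _
    have : abMap (fun n => (1 : k) • LinearMap.id (M := g.carrier n)) = 𝟙 (ab g) :=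
      hom_ext fun n x => one_smul _ _
    rw [this]
    exact map_id_apply G X
  mul_smul c d X := by
    change push _ _ = G.map _ (push _ _)
    rw [map_push]
    congr 1
    exact hom_ext fun n x => mul_smul _ _ _
  smul_zero c := push_zero _
  smul_add c X Y := push_add _ X Y
  add_smul c d X := by
    refine Eq.trans ?_ (map_abMap_add (G := G) (g := g) (h := g) (fun _ => c • LinearMap.id)
      (fun _ => d • LinearMap.id) X)
    change push _ X = push _ X
    congr 1
    exact hom_ext fun n x => add_smul _ _ _
  zero_smul X := map_eq_one G _ (fun n x => zero_smul _ _) X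

/-- The functoriality of `L(g)` for linear maps. -/
def map (f : GLin g h) : LieT G g →ₗ[k] LieT G h where
  toFun X := push (abMap f) X
  map_add' X Y := push_add _ X Y
  map_smul' c X := by
    change G.map _ (push _ _) = G.map _ (push _ _)
    rw [map_push, map_push]
    exact push_congr (fun n x => map_smul (f n) c x) X

theorem map_congr {f f' : GLin g h} (H : ∀ n x, f n x = f' n x) (X : LieT G g) :
    map f X = map f' X := push_congr H X

theorem push_map {l : GrNilpLie k} (f : GLin g h) (s : ab h ⟶ l) (X : LieT G g) :
    push s (map f X) = push (abMap f ≫ s) X := map_map G _ _ X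

theorem map_map' {l : GrNilpLie k} (f : GLin g h) (f' : GLin h l) (X : LieT G g) :
    map f' (map f X) = map (fun n => f' n ∘ₗ f n) X := map_map G _ _ X

theorem map_add_lin (f f' : GLin g h) (X : LieT G g) :
    map (f + f') X = map f X + map f' X := map_abMap_add f f' X

theorem map_zero_lin (X : LieT G g) : map (0 : GLin g h) X = 0 :=
  map_eq_one G _ (fun _ _ => rfl) X

theorem map_id (X : LieT G g) : map (fun _ => LinearMap.id : GLin g g) X = X := by
  exact map_id_apply G X

theorem map_smul_lin (c : k) (f : GLin g h) (X : LieT G g) :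
    map (c • f) X = c • map f X := by
  change push _ X = G.map _ (push _ X)
  rw [map_push]
  rfl

/-- A linear combination of linear maps acts as the linear combination of their actions. -/
theorem map_sum_lin {ι : Type*} (s : Finset ι) (f : ι → GLin g h) (X : LieT G g) :
    map (∑ i ∈ s, f i) X = ∑ i ∈ s, map (f i) X := by
  classical
  induction s using Finset.induction_on with
  | empty => rw [Finset.sum_empty, Finset.sum_empty, map_zero_lin]
  | insert i s hi ih => rw [Finset.sum_insert hi, Finset.sum_insert hi, map_add_lin, ih]

theorem map_eq_of {l : GrNilpLie k} {f : GLin g h} {f' : GLin h l} {q : GLin g l}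
    (H : ∀ n x, f' n (f n x) = q n x) (X : LieT G g) : map f' (map f X) = map q X := by
  rw [map_map']
  exact map_congr H X

/-- Elements of `L(g[ε]) = L(g) ⊕ ε L(g)` are determined by their components. -/
theorem dual_decomp (V : LieT G (dual g)) :
    V = map (dinl g) (map (dfst g) V) + map (dinr g) (map (dsnd g) V) := by
  rw [map_map', map_map', ← map_add_lin]
  nth_rewrite 1 [← map_id V]
  exact map_congr (fun n x => Prod.ext (add_zero _).symm (zero_add _).symm) V

theorem dfst_dinl (X : LieT G g) : map (dfst g) (map (dinl g) X) = X :=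
  (map_map' _ _ _).trans (map_id X)

theorem dsnd_dinr (X : LieT G g) : map (dsnd g) (map (dinr g) X) = X :=
  (map_map' _ _ _).trans (map_id X)

theorem dsnd_dinl (X : LieT G g) : map (dsnd g) (map (dinl g) X) = 0 :=
  (map_map' _ _ _).trans (map_zero_lin X)

theorem dualEps_injective : Function.Injective (push (G := G) (dualEps g)) := by
  intro X Y hXY
  refine (existsUnique_push_dualEps (push (dualEps g) Y) ?_).unique hXY rfl
  rw [map_push]
  exact map_eq_one G _ (fun _ _ => rfl) _

end group

end LieT

end GrNilpLie

/-! ### The adjoint action and the Lie bracket of the tangent Lie algebra -/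

namespace GrNilpLie

variable {k : Type u} [Field k] {G : GrNilpLie k ⥤ GrpCat.{w}}

namespace LieT

variable [IsReduced G] [IsHomogeneous G] {g h : GrNilpLie k}

theorem proj_incl (u : G.obj g) : G.map (dualProj g) (G.map (dualIncl g) u) = u := by
  rw [map_map]
  exact map_id_apply G u

theorem proj_eps (X : LieT G g) : G.map (dualProj g) (push (dualEps g) X) = 1 := by
  rw [map_push]
  exact map_eq_one G _ (fun _ _ => rfl) _

theorem adFun_aux (u : G.obj g) (Y : LieT G g) : G.map (dualProj g)
    (G.map (dualIncl g) u * push (dualEps g) Y * (G.map (dualIncl g) u)⁻¹) = 1 := by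
  rw [map_mul, map_mul, map_inv, proj_incl, proj_eps, mul_one, mul_inv_cancel]

/-- The adjoint action of `u ∈ G(g)` on `L(g)`: the conjugate of `1 + ε Y` by `u` is
`1 + ε Ad u Y`. -/
noncomputable def adFun (u : G.obj g) (Y : LieT G g) : LieT G g :=
  (existsUnique_push_dualEps _ (adFun_aux u Y)).choose

theorem push_adFun (u : G.obj g) (Y : LieT G g) : push (dualEps g) (adFun u Y) =
    G.map (dualIncl g) u * push (dualEps g) Y * (G.map (dualIncl g) u)⁻¹ :=
  (existsUnique_push_dualEps _ (adFun_aux u Y)).choose_spec.1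

/-- The adjoint action, as a linear map. -/
noncomputable def Ad (u : G.obj g) : LieT G g →ₗ[k] LieT G g where
  toFun := adFun u
  map_add' X Y := by
    apply dualEps_injective
    simp only [push_add, push_adFun]
    group
  map_smul' c X := by
    apply dualEps_injective
    -- The substitution `ε ↦ c ε` multiplies `Y` by `c` in `1 + ε Y`, and it fixes `u`.
    have h1 : ∀ Z : LieT G g, push (dualEps g) (c • Z) =
        G.map (dualScale g c) (push (dualEps g) Z) := fun Z => by
      rw [map_push]
      change push _ (push _ _) = _
      exact (map_push _ _ _).trans (push_congr (fun n x => Prod.ext (by rfl) rfl) Z)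
    have h2 : G.map (dualScale g c) (G.map (dualIncl g) u) = G.map (dualIncl g) u := by
      have e : dualIncl g ≫ dualScale g c = dualIncl g :=
        hom_ext fun n x => Prod.ext (by rfl) (by exact smul_zero c)
      rw [map_map, e]
    rw [push_adFun, RingHom.id_apply, h1, h1, push_adFun, map_mul, map_mul, map_inv, h2]

theorem push_Ad (u : G.obj g) (Y : LieT G g) : push (dualEps g) (Ad u Y) =
    G.map (dualIncl g) u * push (dualEps g) Y * (G.map (dualIncl g) u)⁻¹ := push_adFun u Y

theorem Ad_mul (u v : G.obj g) (Y : LieT G g) : Ad (u * v) Y = Ad u (Ad v Y) := by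
  apply dualEps_injective
  simp only [push_Ad, map_mul, mul_inv_rev, mul_assoc]

theorem Ad_one (Y : LieT G g) : Ad (1 : G.obj g) Y = Y := by
  apply dualEps_injective
  simp only [push_Ad, map_one, inv_one, mul_one, one_mul]

/-- The linear map underlying a morphism. -/
abbrev lin (f : g ⟶ h) : GLin g h := Hom.app f

theorem dualMap_eps (f : g ⟶ h) (X : LieT G g) :
    G.map (dualMap f) (push (dualEps g) X) = push (dualEps h) (map (lin f) X) := by
  rw [map_push, push_map]
  exact push_congr (fun n x => Prod.ext (by exact map_zero (Hom.app f n)) (by rfl)) X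

theorem dualMap_incl (f : g ⟶ h) (u : G.obj g) :
    G.map (dualMap f) (G.map (dualIncl g) u) = G.map (dualIncl h) (G.map f u) := by
  have e : dualIncl g ≫ dualMap f = f ≫ dualIncl h :=
    hom_ext fun n x => Prod.ext (by rfl) (by exact map_zero (Hom.app f n))
  rw [map_map, map_map, e]

theorem map_Ad (f : g ⟶ h) (u : G.obj g) (Y : LieT G g) :
    map (lin f) (Ad u Y) = Ad (G.map f u) (map (lin f) Y) := by
  apply dualEps_injective
  rw [← dualMap_eps, push_Ad, push_Ad, map_mul, map_mul, map_inv, dualMap_eps, dualMap_incl]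

/-- Elements coming from commuting parts of `g` act trivially on each other. -/
theorem Ad_push_map {g' : GrNilpLie k} (s r : GLin g' g)
    (hs : ∀ i j n e x y, g.bracket i j n e (s i x) (s j y) = 0)
    (hr : ∀ i j n e x y, g.bracket i j n e (s i x) (r j y) = 0) (X Y : LieT G g') :
    Ad (push (abHom s hs) X) (map r Y) = map r Y := by
  apply dualEps_injective
  rw [push_Ad, mul_inv_eq_iff_eq_mul]
  -- Both factors come from the same commutative group `L(g'[ε])`.
  have h1 : G.map (dualIncl g) (push (abHom s hs) X) =
      push (pairHom s r hs hr) (map (dinl g') X) := by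
    rw [map_push, push_map]
    exact push_congr (fun n x => Prod.ext (by rfl) (by exact (map_zero (r n)).symm)) X
  have h2 : push (dualEps g) (map r Y) = push (pairHom s r hs hr) (map (dinr g') Y) := by
    rw [push_map, push_map]
    exact push_congr (fun n x => Prod.ext (by exact (map_zero (s n)).symm) (by rfl)) Y
  rw [h1, h2, push_mul_comm]

/-- The Lie bracket of `L(g)`, the derivative of the adjoint action: on `L(g[ε])`,
`Ad (1 + ε X) Y = Y + ε [X, Y]`. -/
noncomputable def br (X Y : LieT G g) : LieT G g :=
  map (dsnd g) (Ad (push (dualEps g) X) (map (dinl g) Y))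

theorem Ad_eps_inl (X Y : LieT G g) : Ad (push (dualEps g) X) (map (dinl g) Y) =
    map (dinl g) Y + map (dinr g) (br X Y) := by
  conv_lhs => rw [dual_decomp (Ad (push (dualEps g) X) (map (dinl g) Y))]
  congr 2
  have := map_Ad (dualProj g) (push (dualEps g) X) (map (dinl g) Y)
  rw [proj_eps, Ad_one] at this
  exact this.trans (dfst_dinl Y)

/-- Since `ε² = 0`, conjugation by `1 + ε X` fixes `ε L(g)`. -/
theorem Ad_eps_inr (X W : LieT G g) :
    Ad (push (dualEps g) X) (map (dinr g) W) = map (dinr g) W :=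
  Ad_push_map (dinr g) (dinr g) _ (fun i j n e x y => Prod.ext (by simp [dinr])
    (by simp [dinr])) X W

theorem br_add_right (X Y Z : LieT G g) : br X (Y + Z) = br X Y + br X Z := by
  simp only [br, map_add]

theorem br_smul_right (c : k) (X Y : LieT G g) : br X (c • Y) = c • br X Y := by
  simp only [br, map_smul]

theorem br_add_left (X Y Z : LieT G g) : br (X + Y) Z = br X Z + br Y Z := by
  rw [br, push_add, Ad_mul, Ad_eps_inl, map_add, Ad_eps_inl, Ad_eps_inr]
  simp only [map_add, dsnd_dinl, dsnd_dinr, zero_add]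

theorem map_br (f : g ⟶ h) (X Y : LieT G g) :
    map (lin f) (br X Y) = br (map (lin f) X) (map (lin f) Y) := by
  have h1 : map (dsnd h) (map (lin (dualMap f)) (Ad (push (dualEps g) X) (map (dinl g) Y))) =
      map (lin f) (br X Y) := by
    rw [br, map_map', map_map']
    rfl
  rw [← h1, map_Ad, dualMap_eps, br]
  congr 2
  rw [map_map', map_map']
  exact map_congr (fun n x => Prod.ext (by rfl) (by exact map_zero (Hom.app f n))) Y

theorem dual_swap_inl_eps (X : LieT G g) :
    G.map (dualSwap g) (push (dualEps (dual g)) (map (dinl g) X)) =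
      G.map (dualIncl (dual g)) (push (dualEps g) X) := by
  rw [map_push, push_map, map_push]
  exact push_congr (fun n x => rfl) X

theorem dual_swap_eps_inl (X : LieT G g) :
    G.map (dualSwap g) (G.map (dualIncl (dual g)) (push (dualEps g) X)) =
      push (dualEps (dual g)) (map (dinl g) X) := by
  rw [map_push, map_push, push_map]
  exact push_congr (fun n x => rfl) X

theorem dual_swap_eps_inr (X : LieT G g) :
    G.map (dualSwap g) (push (dualEps (dual g)) (map (dinr g) X)) =
      push (dualEps (dual g)) (map (dinr g) X) := by
  rw [map_push, push_map, push_map]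
  exact push_congr (fun n x => rfl) X

theorem dinr_injective : Function.Injective (map (G := G) (dinr g)) := fun X Y hXY => by
  rw [← dsnd_dinr X, hXY, dsnd_dinr]

/-- `(1 + ε₁ X) (1 + ε₂ Y) = (1 + ε₂ Y) (1 + ε₁ ε₂ [X, Y]) (1 + ε₁ X)` in `G(g[ε₁][ε₂])`. -/
theorem eps_mul_eps (X Y : LieT G g) :
    G.map (dualIncl (dual g)) (push (dualEps g) X) * push (dualEps (dual g)) (map (dinl g) Y) =
      push (dualEps (dual g)) (map (dinl g) Y) *
        push (dualEps (dual g)) (map (dinr g) (br X Y)) *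
          G.map (dualIncl (dual g)) (push (dualEps g) X) := by
  rw [← mul_inv_eq_iff_eq_mul, ← push_Ad, ← push_add, Ad_eps_inl]

/-- The elements `1 + ε₁ X` and `1 + ε₁ ε₂ W` commute. -/
theorem eps_mul_eps_eps (X W : LieT G g) :
    G.map (dualIncl (dual g)) (push (dualEps g) X) * push (dualEps (dual g)) (map (dinr g) W) =
      push (dualEps (dual g)) (map (dinr g) W) *
        G.map (dualIncl (dual g)) (push (dualEps g) X) := by
  rw [← mul_inv_eq_iff_eq_mul, ← push_Ad, Ad_eps_inr]

/-- The exchange of `ε₁` and `ε₂` inverts the commutator of `1 + ε₁ X` and `1 + ε₂ Y`. -/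
theorem br_skew (X Y : LieT G g) : br X Y = -br Y X := by
  -- Compare the commutator of `1 + ε₁ X` and `1 + ε₂ Y` with the image under the exchange of the
  -- commutator of `1 + ε₁ Y` and `1 + ε₂ X`.
  have h1 := eps_mul_eps X Y
  have h2 := congrArg (G.map (dualSwap g)) (eps_mul_eps Y X)
  simp only [map_mul, dual_swap_inl_eps, dual_swap_eps_inl, dual_swap_eps_inr] at h2
  have h3 := eps_mul_eps_eps X (br Y X)
  have h4 := push_mul_comm (dualEps (dual g)) (map (dinl g) Y) (map (dinr g) (br X Y))
  rw [h3, mul_assoc, h1, h4, mul_assoc, ← mul_assoc, ← push_add, ← map_add] at h2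
  have h5 : push (dualEps (dual g)) (map (dinr g) (br Y X + br X Y)) = 1 := by
    have := h2.symm
    rwa [mul_eq_right] at this
  rw [← push_zero (dualEps (dual g))] at h5
  have h6 := dualEps_injective h5
  rw [← map_zero (map (G := G) (dinr g))] at h6
  have h7 := dinr_injective h6
  rwa [add_comm, add_eq_zero_iff_eq_neg] at h7

theorem br_smul_left (c : k) (X Y : LieT G g) : br (c • X) Y = c • br X Y := by
  rw [br_skew, br_smul_right, br_skew Y X, smul_neg, neg_neg]

theorem dualMul_eps (X : LieT G g) : G.map (dualMul g) (push (dualEps g) X) =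
    push (dualEps (dual g)) (map (dinr g) X) := by
  rw [map_push, push_map]
  exact push_congr (fun n x => rfl) X

theorem dualMul_incl (u : G.obj g) : G.map (dualMul g) (G.map (dualIncl g) u) =
    G.map (dualIncl (dual g)) (G.map (dualIncl g) u) := by
  rw [map_map, map_map]
  rfl

theorem br_inr_inl (X Y : LieT G g) :
    br (map (dinr g) X) (map (dinl g) Y) = map (dinr g) (br X Y) := by
  have h1 := map_Ad (dualMul g) (push (dualEps g) X) (map (dinl g) Y)
  have h2 : map (lin (dualMul g)) (map (dinl g) Y) = map (dinl (dual g)) (map (dinl g) Y) := by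
    rw [map_map', map_map']
    rfl
  rw [br, ← dualMul_eps, ← h2, ← h1, br, map_map', map_map']
  rfl

theorem br_inl_inr (X Y : LieT G g) :
    br (map (dinl g) X) (map (dinr g) Y) = map (dinr g) (br X Y) := by
  rw [br_skew, br_inr_inl, br_skew Y X, map_neg, neg_neg]

theorem br_inl_inl (X Y : LieT G g) :
    br (map (dinl g) X) (map (dinl g) Y) = map (dinl g) (br X Y) :=
  (map_br (dualIncl g) X Y).symm

/-- `[ε X, ε Y] = 0`, since `ε g` is an abelian ideal. -/
theorem br_inr_inr (X Y : LieT G g) : br (map (dinr g) X) (map (dinr g) Y) = 0 := by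
  have h := Ad_push_map (G := G) (g := dual (dual g)) (g' := g)
    (fun n => dinr (dual g) n ∘ₗ dinr g n) (fun n => dinl (dual g) n ∘ₗ dinr g n)
    (fun i j n e x y => by simp [dinr])
    (fun i j n e x y => by simp [dinr, dinl]) X Y
  have h' : push (dualEps (dual g)) (map (dinr g) X) = push (abHom (h := dual (dual g))
      (fun n => dinr (dual g) n ∘ₗ dinr g n) (fun i j n e x y => by simp [dinr])) X := by
    rw [push_map]
    rfl
  rw [br, h', map_map', h, ← map_map' (G := G) (dinr g) (dinl (dual g)), dsnd_dinl]

theorem Ad_incl_inl (u : G.obj g) (Y : LieT G g) :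
    Ad (G.map (dualIncl g) u) (map (dinl g) Y) = map (dinl g) (Ad u Y) :=
  (map_Ad (dualIncl g) u Y).symm

theorem Ad_incl_inr (u : G.obj g) (Y : LieT G g) :
    Ad (G.map (dualIncl g) u) (map (dinr g) Y) = map (dinr g) (Ad u Y) := by
  apply dualEps_injective
  rw [push_Ad, ← dualMul_eps, ← dualMul_eps, push_Ad, ← dualMul_incl, map_mul, map_mul, map_inv]

/-- The adjoint action preserves the bracket, since it preserves commutators in
`G(g[ε₁][ε₂])`. -/
theorem Ad_br (u : G.obj g) (Y Z : LieT G g) : Ad u (br Y Z) = br (Ad u Y) (Ad u Z) := by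
  set U := G.map (dualIncl (dual g)) (G.map (dualIncl g) u) with hU
  have c1 : ∀ Y : LieT G g, G.map (dualIncl (dual g)) (push (dualEps g) (Ad u Y)) =
      U * G.map (dualIncl (dual g)) (push (dualEps g) Y) * U⁻¹ := fun Y => by
    rw [push_Ad, map_mul, map_mul, map_inv]
  have c2 : ∀ Z : LieT G g, push (dualEps (dual g)) (map (dinl g) (Ad u Z)) =
      U * push (dualEps (dual g)) (map (dinl g) Z) * U⁻¹ := fun Z => by
    rw [← Ad_incl_inl, push_Ad]
  have c3 : ∀ W : LieT G g, push (dualEps (dual g)) (map (dinr g) (Ad u W)) =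
      U * push (dualEps (dual g)) (map (dinr g) W) * U⁻¹ := fun W => by
    rw [← Ad_incl_inr, push_Ad]
  apply dinr_injective (G := G)
  apply dualEps_injective
  have h1 := eps_mul_eps Y Z
  have h2 := eps_mul_eps (Ad u Y) (Ad u Z)
  rw [c1, c2] at h2
  rw [c3]
  have e1 : push (dualEps (dual g)) (map (dinr g) (br Y Z)) =
      (push (dualEps (dual g)) (map (dinl g) Z))⁻¹ *
        (G.map (dualIncl (dual g)) (push (dualEps g) Y) *
        push (dualEps (dual g)) (map (dinl g) Z)) *
          (G.map (dualIncl (dual g)) (push (dualEps g) Y))⁻¹ := by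
    rw [h1]; group
  have e2 : push (dualEps (dual g)) (map (dinr g) (br (Ad u Y) (Ad u Z))) =
      (U * push (dualEps (dual g)) (map (dinl g) Z) * U⁻¹)⁻¹ *
        (U * G.map (dualIncl (dual g)) (push (dualEps g) Y) * U⁻¹ *
        (U * push (dualEps (dual g)) (map (dinl g) Z) * U⁻¹)) *
          (U * G.map (dualIncl (dual g)) (push (dualEps g) Y) * U⁻¹)⁻¹ := by
    rw [h2]; group
  rw [e1, e2]
  group

/-- The Jacobi identity, the derivative of `Ad_br` at `u = 1 + ε X`. -/
theorem br_leibniz (X Y Z : LieT G g) :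
    br X (br Y Z) = br (br X Y) Z + br Y (br X Z) := by
  have h := Ad_br (push (dualEps g) X) (map (dinl g) Y) (map (dinl g) Z)
  rw [br_inl_inl, Ad_eps_inl, Ad_eps_inl, Ad_eps_inl, br_add_left, br_add_right, br_add_right,
    br_inl_inl, br_inl_inr, br_inr_inl, br_inr_inr] at h
  have h' := congrArg (map (G := G) (dsnd g)) h
  simp only [map_add, dsnd_dinl, dsnd_dinr, zero_add, add_zero] at h'
  rw [h', add_comm]

noncomputable instance [CharZero k] : LieRing (LieT G g) where
  bracket := br
  add_lie := br_add_left
  lie_add := br_add_right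
  lie_self X := by
    have h : (2 : k) • br X X = 0 := by
      rw [two_smul]
      nth_rewrite 1 [br_skew]
      simp
    simpa using h
  leibniz_lie := br_leibniz

theorem lie_def [CharZero k] (X Y : LieT G g) : ⁅X, Y⁆ = br X Y := rfl

noncomputable instance [CharZero k] : LieAlgebra k (LieT G g) where
  lie_smul c X Y := br_smul_right c X Y

/-- The functoriality of the Lie algebra `L(g)` for morphisms. -/
theorem map_lie [CharZero k] (f : g ⟶ h) (X Y : LieT G g) :
    map (lin f) ⁅X, Y⁆ = ⁅map (lin f) X, map (lin f) Y⁆ := map_br f X Y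

end LieT

end GrNilpLie

/-! ### The tangent Lie algebra as a tensor product -/

namespace GrNilpLie

variable {k : Type u} [Field k]

/-- The linear map `k ε → g` with `ε ↦ x`, where `x` has degree `i`. It is a morphism of graded
Lie algebras only if `[x, x] = 0`. -/
noncomputable def lineMap {g : GrNilpLie k} {i : ℕ} (x : g.carrier i) : GLin (line k i) g :=
    fun m =>
  (LinearMap.toSpanSingleton k (g.carrier m) (Pi.single (M := g.carrier) i x m)).comp
    (if h : m = i then LinearMap.proj ⟨h⟩ else 0)

theorem lineMap_same {g : GrNilpLie k} {i : ℕ} (x : g.carrier i) (c : (line k i).carrier i) :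
    lineMap x i c = c ⟨rfl⟩ • x := by
  simp [lineMap]
  rfl

theorem line_ext {i : ℕ} {g : GrNilpLie k} {f f' : GLin (line k i) g}
    (h : f i (eps k i) = f' i (eps k i)) : f = f' := by
  funext m
  refine LinearMap.ext fun c => ?_
  by_cases hm : m = i
  · subst hm
    have hc : c = c ⟨rfl⟩ • eps k m := funext fun p => (mul_one (c p)).symm
    rw [hc, map_smul, map_smul, h]
  · have hc : c = 0 := funext fun p => absurd p.down hm
    rw [hc, map_zero, map_zero]

theorem lineMap_eps {g : GrNilpLie k} {i : ℕ} (x : g.carrier i) :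
    lineMap x i (eps k i) = x := by
  rw [lineMap_same]
  exact one_smul k x

/-- The linear map `g → k ε` given by a linear form on the degree `i` part. -/
noncomputable def coordMap {g : GrNilpLie k} {i : ℕ} (ℓ : g.carrier i →ₗ[k] k) :
    GLin g (line k i) := fun m => LinearMap.pi fun h : PLift (m = i) =>
  (Eq.rec (motive := fun j _ => g.carrier j →ₗ[k] k) ℓ h.down.symm)

theorem coordMap_same {g : GrNilpLie k} {i : ℕ} (ℓ : g.carrier i →ₗ[k] k) (y : g.carrier i) :
    coordMap ℓ i y = ℓ y • eps k i := by
  funext h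
  exact (mul_one (ℓ y)).symm

theorem coordMap_of_ne {g : GrNilpLie k} {i m : ℕ} (hm : m ≠ i) (ℓ : g.carrier i →ₗ[k] k)
    (y : g.carrier m) : coordMap ℓ m y = 0 :=
  funext fun h => absurd h.down hm

variable {G : GrNilpLie k ⥤ GrpCat.{w}}

namespace LieT

variable [IsReduced G] [IsHomogeneous G] {g h : GrNilpLie k}

/-- `A^i` is `L(k ε)`. -/
def tangentEquiv (i : ℕ) : Tangent G i ≃ₗ[k] LieT G (line k i) where
  toFun a := a
  map_add' _ _ := rfl
  map_smul' _ _ := rfl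
  invFun a := a
  left_inv _ := rfl
  right_inv _ := rfl

/-- The element `a ⊗ x` of `L(g)`, as a linear function of `a ∈ A^i`. -/
noncomputable def tens {i : ℕ} (x : g.carrier i) : Tangent G i →ₗ[k] LieT G g :=
  (map (lineMap x)).comp (tangentEquiv i).toLinearMap

/-- The coordinate `L(g) → A^i` given by a linear form on the degree `i` part of `g`. -/
noncomputable def coord {i : ℕ} (ℓ : g.carrier i →ₗ[k] k) : LieT G g →ₗ[k] Tangent G i :=
  (tangentEquiv i).symm.toLinearMap.comp (map (coordMap ℓ))

theorem map_tens (f : GLin g h) {i : ℕ} (x : g.carrier i) (a : Tangent G i) :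
    map f (tens x a) = tens (f i x) a := by
  change map f (map _ (tangentEquiv i a)) = map _ (tangentEquiv i a)
  rw [map_map']
  congr 2
  apply line_ext
  rw [LinearMap.comp_apply, lineMap_eps, lineMap_eps]

theorem tens_add {i : ℕ} (x y : g.carrier i) (a : Tangent G i) :
    tens (x + y) a = tens x a + tens y a := by
  change map _ (tangentEquiv i a) = map _ (tangentEquiv i a) + map _ (tangentEquiv i a)
  rw [← map_add_lin]
  congr 2
  apply line_ext
  rw [Pi.add_apply, LinearMap.add_apply]
  simp only [lineMap_eps]

theorem tens_smul {i : ℕ} (c : k) (x : g.carrier i) (a : Tangent G i) :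
    tens (c • x) a = c • tens x a := by
  change map _ (tangentEquiv i a) = c • map _ (tangentEquiv i a)
  rw [← map_smul_lin]
  congr 2
  apply line_ext
  rw [Pi.smul_apply, LinearMap.smul_apply]
  simp only [lineMap_eps]

theorem tens_zero {i : ℕ} (a : Tangent G i) : tens (0 : g.carrier i) a = 0 := by
  rw [← zero_smul k (0 : g.carrier i), tens_smul, zero_smul]

theorem tens_neg {i : ℕ} (x : g.carrier i) (a : Tangent G i) :
    tens (-x) a = -tens x a := by
  rw [← neg_one_smul k x, tens_smul, neg_one_smul]

theorem tens_eps {i : ℕ} (a : Tangent G i) : tens (eps k i) a = tangentEquiv i a := by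
  change map _ (tangentEquiv i a) = _
  nth_rewrite 2 [← map_id (tangentEquiv i a)]
  congr 2
  apply line_ext
  exact lineMap_eps _

theorem coord_tens {i : ℕ} (ℓ : g.carrier i →ₗ[k] k) (x : g.carrier i) (a : Tangent G i) :
    coord ℓ (tens x a) = ℓ x • a := by
  change map (coordMap ℓ) (tens x a) = _
  rw [map_tens, coordMap_same, tens_smul, tens_eps]
  rfl

theorem coord_tens_of_ne {i m : ℕ} (hm : m ≠ i) (ℓ : g.carrier i →ₗ[k] k) (x : g.carrier m)
    (a : Tangent G m) : coord ℓ (tens x a) = 0 := by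
  change map (coordMap ℓ) (tens x a) = _
  rw [map_tens, coordMap_of_ne hm, tens_zero]
  rfl

theorem tens_coord {i : ℕ} (ℓ : g.carrier i →ₗ[k] k) (x : g.carrier i) (X : LieT G g) :
    tens x (coord ℓ X) = map (fun m => lineMap x m ∘ₗ coordMap ℓ m) X := by
  rw [← map_map']
  rfl

theorem lineMap_coordMap {i : ℕ} (ℓ : g.carrier i →ₗ[k] k) (x y : g.carrier i) :
    lineMap x i (coordMap ℓ i y) = ℓ y • x := by
  rw [coordMap_same, map_smul, lineMap_eps]

theorem lineMap_coordMap_of_ne {i m : ℕ} (hm : m ≠ i) (ℓ : g.carrier i →ₗ[k] k) (x : g.carrier i)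
    (y : g.carrier m) : lineMap x m (coordMap ℓ m y) = 0 := by
  rw [coordMap_of_ne hm, map_zero]

variable (g) in
/-- A bound for the degrees of `g`. -/
noncomputable def bound : ℕ := g.bounded.choose

variable (g) in
/-- A basis of the degree `n` part of `g`. -/
noncomputable def basis (n : ℕ) :
    Module.Basis (Fin (Module.finrank k (g.carrier n))) k (g.carrier n) :=
  have := g.finite n
  Module.finBasis k (g.carrier n)

/-- The expansion of an element of `L(g)` in a homogeneous basis of `g`. -/
theorem eq_sum_tens (X : LieT G g) : X = ∑ n ∈ Finset.range (bound g), ∑ i,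
    tens (basis g n i) (coord ((basis g n).coord i) X) := by
  simp only [tens_coord, ← map_sum_lin]
  nth_rewrite 1 [← map_id X]
  refine map_congr (fun m y => ?_) X
  simp only [Finset.sum_apply, LinearMap.sum_apply, LinearMap.comp_apply]
  by_cases hm : m < bound g
  · rw [Finset.sum_eq_single_of_mem m (Finset.mem_range.2 hm)]
    · simp only [lineMap_coordMap]
      exact ((basis g m).sum_repr y).symm
    · intro n _ hn
      exact Finset.sum_eq_zero fun i _ => lineMap_coordMap_of_ne (Ne.symm hn) _ _ _
  · have := g.bounded.choose_spec m (not_lt.1 hm)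
    exact Subsingleton.elim _ _

/-- `L(g)` is spanned by the elements `a ⊗ x`. -/
theorem induction {p : LieT G g → Prop} (X : LieT G g) (zero : p 0)
    (tens : ∀ n (x : g.carrier n) a, p (tens x a)) (add : ∀ X Y, p X → p Y → p (X + Y)) : p X := by
  rw [eq_sum_tens X]
  exact Finset.sum_induction _ _ add zero fun n _ =>
    Finset.sum_induction _ _ add zero fun i _ => tens n _ _

/-- The map `a ⊗ x ↦ a ⊗ x` from `⨁ A^n ⊗ g_n` to `L(g)`. -/
noncomputable def ofTensor (g : GrNilpLie k) :
    (⨁ n, Tangent G n ⊗[k] g.carrier n) →ₗ[k] LieT G g :=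
  DirectSum.toModule k ℕ _ fun _ => TensorProduct.lift
    (LinearMap.mk₂ k (fun a x => tens x a) (fun a b _ => map_add _ a b)
      (fun c a _ => map_smul _ c a) (fun a x y => tens_add x y a) (fun c a x => tens_smul c x a))

theorem ofTensor_lof (n : ℕ) (a : Tangent G n) (x : g.carrier n) :
    ofTensor g (DirectSum.lof k ℕ (fun n => Tangent G n ⊗[k] g.carrier n) n (a ⊗ₜ x)) =
      tens x a := by
  simp [ofTensor]

/-- The inverse of `ofTensor`, by means of bases. -/
noncomputable def toTensor (g : GrNilpLie k) :
    LieT G g →ₗ[k] ⨁ n, Tangent G n ⊗[k] g.carrier n :=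
  ∑ n ∈ Finset.range (bound g), ∑ i,
    (DirectSum.lof k ℕ (fun n => Tangent G n ⊗[k] g.carrier n) n).comp
      (((TensorProduct.mk k (Tangent G n) (g.carrier n)).flip (basis g n i)).comp
        (coord ((basis g n).coord i)))

theorem toTensor_apply (X : LieT G g) : toTensor g X = ∑ n ∈ Finset.range (bound g), ∑ i,
    DirectSum.lof k ℕ (fun n => Tangent G n ⊗[k] g.carrier n) n
      (coord ((basis g n).coord i) X ⊗ₜ basis g n i) := by
  simp [toTensor, LinearMap.sum_apply]

theorem toTensor_tens {m : ℕ} (x : g.carrier m) (a : Tangent G m) : toTensor g (tens x a) =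
    DirectSum.lof k ℕ (fun n => Tangent G n ⊗[k] g.carrier n) m (a ⊗ₜ x) := by
  rw [toTensor_apply]
  by_cases hm : m < bound g
  · rw [Finset.sum_eq_single_of_mem m (Finset.mem_range.2 hm)]
    · simp only [coord_tens]
      conv_rhs => rw [← (basis g m).sum_repr x]
      rw [TensorProduct.tmul_sum, map_sum]
      simp only [TensorProduct.tmul_smul, TensorProduct.smul_tmul', Module.Basis.coord_apply]
    · intro n _ hn
      exact Finset.sum_eq_zero fun i _ => by
        rw [coord_tens_of_ne (Ne.symm hn), TensorProduct.zero_tmul, map_zero]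
  · have := g.bounded.choose_spec m (not_lt.1 hm)
    rw [Subsingleton.elim x 0, tens_zero, TensorProduct.tmul_zero, map_zero]
    simp

/-- `L(g)` is the direct sum of the `A^n ⊗ g_n`. -/
noncomputable def tensorEquiv (g : GrNilpLie k) :
    (⨁ n, Tangent G n ⊗[k] g.carrier n) ≃ₗ[k] LieT G g where
  __ := ofTensor g
  invFun := toTensor g
  left_inv t := by
    change toTensor g (ofTensor g t) = t
    refine DirectSum.induction_on t (by simp) (fun n t => ?_) fun x y hx hy => by
      rw [map_add, map_add, hx, hy]
    change toTensor g (ofTensor g (DirectSum.lof k ℕ _ n t)) = DirectSum.lof k ℕ _ n t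
    induction t using TensorProduct.induction_on with
    | zero => simp
    | tmul a y => rw [ofTensor_lof, toTensor_tens]
    | add s t hs ht => rw [map_add, map_add, map_add, hs, ht]
  right_inv X := by
    change ofTensor g (toTensor g X) = X
    rw [toTensor_apply, map_sum]
    simp only [map_sum, ofTensor_lof]
    exact (eq_sum_tens X).symm

/-- `a ↦ a ⊗ x` is injective for `x ≠ 0`, which is expressed by a linear form. -/
theorem tens_injective {i : ℕ} {x : g.carrier i} {ℓ : g.carrier i →ₗ[k] k} (h : ℓ x = 1)
    {a b : Tangent G i} (hab : tens x a = tens x b) : a = b := by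
  have := congrArg (coord (G := G) ℓ) hab
  rwa [coord_tens, coord_tens, h, one_smul, one_smul] at this

/-- Elements from parts of `g` that commute have bracket zero. -/
theorem br_map_map_eq_zero {g' : GrNilpLie k} (s r : GLin g' g)
    (hr : ∀ i j n e x y, g.bracket i j n e (s i x) (r j y) = 0) (X Y : LieT G g') :
    br (map s X) (map r Y) = 0 := by
  have h := Ad_push_map (G := G) (g := dual g) (g' := g')
    (fun n => dinr g n ∘ₗ s n) (fun n => dinl g n ∘ₗ r n)
    (fun _ _ _ _ _ _ => by simp [dinr])
    (fun _ _ _ _ _ _ => by simp [dinr, dinl, hr]) X Y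
  have h' : push (dualEps g) (map s X) = push (abHom (h := dual g)
      (fun n => dinr g n ∘ₗ s n) (fun _ _ _ _ _ _ => by simp [dinr])) X := by
    rw [push_map]
    rfl
  rw [br, h', map_map', h, ← map_map' (G := G) r (dinl g), dsnd_dinl]

end LieT

end GrNilpLie

/-! ### Graded Lie algebras of strictly upper triangular matrices -/

namespace GrNilpLie

variable {k : Type u} [Field k]

/-- The strictly upper triangular matrices whose `(a, b)` entry vanishes unless
`m = s b - s a`. -/
abbrev triSub {r : ℕ} (s : Fin r → ℕ) (m : ℕ) : Submodule k (Matrix (Fin r) (Fin r) k) where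
  carrier := {A | ∀ a b, A a b ≠ 0 → a < b ∧ s a + m = s b}
  zero_mem' := fun a b h => absurd rfl h
  add_mem' := by
    intro A B hA hB a b h
    by_cases h' : A a b = 0
    · exact hB a b (by rw [Matrix.add_apply, h', zero_add] at h; exact h)
    · exact hA a b h'
  smul_mem' := by
    intro c A hA a b h
    exact hA a b fun h' => h (by rw [Matrix.smul_apply, h', smul_zero])

theorem triSub_mul {r : ℕ} {s : Fin r → ℕ} {i j n : ℕ} (h : i + j = n)
    {A B : Matrix (Fin r) (Fin r) k} (hA : A ∈ triSub (k := k) s i) (hB : B ∈ triSub (k := k) s j) :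
    A * B ∈ triSub (k := k) s n := by
  intro a b hab
  rw [Matrix.mul_apply] at hab
  obtain ⟨c, -, hc⟩ := Finset.exists_ne_zero_of_sum_ne_zero hab
  have h1 := hA a c (left_ne_zero_of_mul hc)
  have h2 := hB c b (right_ne_zero_of_mul hc)
  exact ⟨h1.1.trans h2.1, by omega⟩

/-- The graded Lie algebra of strictly upper triangular matrices, where the `a`-th basis vector
has degree `s a`. -/
abbrev triLie {r : ℕ} (s : Fin r → ℕ) : GradedLie k where
  carrier m := triSub (k := k) s m
  bracket i j n h := LinearMap.mk₂ k
    (fun A B => ⟨A.1 * B.1 - (-1 : k) ^ (i * j) • (B.1 * A.1),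
      sub_mem (triSub_mul h A.2 B.2)
        (Submodule.smul_mem _ _ (triSub_mul ((add_comm j i).trans h) B.2 A.2))⟩)
    (by intro A A' B; ext1; simp only [Submodule.coe_add, add_mul, mul_add, smul_add]; abel)
    (by intro c A B; ext1; simp only [Submodule.coe_smul, smul_mul_assoc, mul_smul_comm, smul_sub]
        rw [smul_comm c])
    (by intro A A' B; ext1; simp only [Submodule.coe_add, add_mul, mul_add, smul_add]; abel)
    (by intro c A B; ext1; simp only [Submodule.coe_smul, smul_mul_assoc, mul_smul_comm, smul_sub]
        rw [smul_comm c])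
  skew i j n h h' A B := by
    ext1
    simp only [LinearMap.mk₂_apply, Submodule.coe_neg, Submodule.coe_smul]
    rw [smul_sub, smul_smul, mul_comm j i, ← mul_pow]
    simp
  jacobi i j l ij il jl n hij hil hjl h₁ h₂ h₃ A B C := by
    ext1
    simp only [LinearMap.mk₂_apply, Submodule.coe_add, Submodule.coe_smul]
    subst hij hil hjl
    have e1 : (-1 : k) ^ (i * (j + l)) = (-1) ^ (i * j) * (-1) ^ (i * l) := by rw [mul_add, pow_add]
    have e2 : (-1 : k) ^ ((i + j) * l) = (-1) ^ (i * l) * (-1) ^ (j * l) := by rw [add_mul, pow_add]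
    have e3 : (-1 : k) ^ (j * (i + l)) = (-1) ^ (i * j) * (-1) ^ (j * l) := by
      rw [mul_add, pow_add, mul_comm j i]
    have e : (-1 : k) ^ (i * j) * (-1) ^ (i * j) = 1 := by rw [← mul_pow]; simp
    rw [e1, e2, e3]
    generalize (-1 : k) ^ (i * j) = σ at *
    generalize (-1 : k) ^ (i * l) = ρ at *
    generalize (-1 : k) ^ (j * l) = τ at *
    obtain ⟨A, -⟩ := A
    obtain ⟨B, -⟩ := B
    obtain ⟨C, -⟩ := C
    simp only [mul_sub, sub_mul, mul_smul_comm, smul_mul_assoc, mul_assoc]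
    linear_combination (norm := module) e • (τ • (A * (C * B)) - (ρ * τ) • (C * (A * B)))

theorem triLie_bracket {r : ℕ} (s : Fin r → ℕ) (i j n : ℕ) (h : i + j = n)
    (A : (triLie (k := k) s).carrier i) (B : (triLie (k := k) s).carrier j) :
    ((triLie (k := k) s).bracket i j n h A B).1 = A.1 * B.1 - (-1 : k) ^ (i * j) • (B.1 * A.1) :=
  rfl

/-- Elements of the `t`-th term of the lower central series are supported above the `t`-th
superdiagonal. -/
theorem triLie_lcs {r : ℕ} (s : Fin r → ℕ) (t n : ℕ) (A : (triLie (k := k) s).carrier n)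
    (hA : A ∈ (triLie (k := k) s).lcs t n) (a b : Fin r) (hab : A.1 a b ≠ 0) :
    (a : ℕ) + t < b := by
  let P : ℕ → ∀ n, Submodule k ((triLie (k := k) s).carrier n) := fun t n =>
    { carrier := {A | ∀ a b : Fin r, ¬ (a : ℕ) + t < b → A.1 a b = 0}
      zero_mem' := fun a b _ => rfl
      add_mem' := fun {A B} hA hB a b h => by
        change A.1 a b + B.1 a b = 0
        rw [hA a b h, hB a b h, add_zero]
      smul_mem' := fun c A hA a b h => by
        change c * A.1 a b = 0
        rw [hA a b h, mul_zero] }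
  have key : A ∈ P t n := by
    refine GradedLie.lcs_le _ P ?_ ?_ t n hA
    · refine fun n => eq_top_iff.2 fun A _ a b h => ?_
      by_contra h'
      exact h (A.2 a b h').1
    · intro t i j n h A B hB a b hab
      rw [triLie_bracket, Matrix.sub_apply, Matrix.smul_apply, Matrix.mul_apply, Matrix.mul_apply,
        Finset.sum_eq_zero, Finset.sum_eq_zero, smul_zero, sub_zero]
      · intro c _
        by_cases h1 : A.1 c b = 0
        · rw [h1, mul_zero]
        · have := (A.2 c b h1).1
          rw [hB a c (by omega), zero_mul]
      · intro c _
        by_cases h1 : A.1 a c = 0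
        · rw [h1, zero_mul]
        · have := (A.2 a c h1).1
          rw [hB c b (by omega), mul_zero]
  by_contra h
  exact hab (key a b h)

/-- Strictly upper triangular matrices form a finite-dimensional nilpotent graded Lie algebra. -/
abbrev tri {r : ℕ} (s : Fin r → ℕ) : GrNilpLie k where
  toGradedLie := triLie s
  finite n := inferInstanceAs (Module.Finite k (triSub (k := k) s n))
  bounded := ⟨∑ a, s a + 1, fun n hn => ⟨fun A B => by
    have h0 : ∀ A : triSub (k := k) s n, A = 0 := fun A => by
      ext a b
      by_contra h
      have h1 := A.2 a b h
      have h2 := Finset.single_le_sum (f := s) (fun _ _ => Nat.zero_le _) (Finset.mem_univ b)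
      omega
    exact (h0 A).trans (h0 B).symm⟩⟩
  nilpotent := ⟨r, fun n => (Submodule.eq_bot_iff _).2 fun A hA => by
    ext a b
    by_contra h
    have := triLie_lcs s r n A hA a b h
    omega⟩

section tri

variable {r : ℕ} {s : Fin r → ℕ}

/-- The elementary matrix with entry `1` at `(a, b)`, in degree `s b - s a`. -/
def elem (s : Fin r → ℕ) {m : ℕ} (a b : Fin r) (hab : a < b) (h : s a + m = s b) :
    (tri (k := k) s).carrier m :=
  ⟨Matrix.single a b 1, fun c d hcd => by
    by_cases h' : a = c ∧ b = d
    · obtain ⟨rfl, rfl⟩ := h'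
      exact ⟨hab, h⟩
    · exact absurd (Matrix.single_apply_of_ne (c := (1 : k)) (h := h')) hcd⟩

theorem elem_bracket {i j n : ℕ} (h : i + j = n) {a b c : Fin r} (hab : a < b)
    (h1 : s a + i = s b) (hbc : b < c) (h2 : s b + j = s c) :
    (tri (k := k) s).bracket i j n h (elem s a b hab h1) (elem s b c hbc h2) =
      elem s a c (hab.trans hbc) (by omega) := by
  ext1
  rw [triLie_bracket]
  simp [elem, (hab.trans hbc).ne']

theorem elem_bracket_of_ne {i j n : ℕ} (h : i + j = n) {a b c d : Fin r} (hab : a < b)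
    (h1 : s a + i = s b) (hcd : c < d) (h2 : s c + j = s d) (hbc : b ≠ c) (had : d ≠ a) :
    (tri (k := k) s).bracket i j n h (elem s a b hab h1) (elem s c d hcd h2) = 0 := by
  ext1
  rw [triLie_bracket]
  simp [elem, hbc, had]

/-- The `(a, b)` entry. -/
def entry (s : Fin r → ℕ) (m : ℕ) (a b : Fin r) : (tri (k := k) s).carrier m →ₗ[k] k where
  toFun A := A.1 a b
  map_add' _ _ := rfl
  map_smul' _ _ := rfl

theorem entry_elem {m : ℕ} (a b : Fin r) (hab : a < b) (h : s a + m = s b) :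
    entry (k := k) s m a b (elem s a b hab h) = 1 := by
  exact Matrix.single_apply_same a b (1 : k)

end tri

/-- The Heisenberg algebra, as an algebra of `3 × 3` matrices: generators in degrees `i` and
`n - i`, and their bracket in degree `n`. -/
abbrev heis (k : Type u) [Field k] (i n : ℕ) : GrNilpLie k := tri ![0, i, n]

section heis

variable {i j n : ℕ}

/-- The first generator of the Heisenberg algebra. -/
def heisX (k : Type u) [Field k] (i n : ℕ) : (heis k i n).carrier i :=
  elem ![0, i, n] 0 1 (by decide) (by simp)

/-- The second generator of the Heisenberg algebra. -/
def heisY (k : Type u) [Field k] (h : i + j = n) : (heis k i n).carrier j :=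
  elem ![0, i, n] 1 2 (by decide) (by simpa)

/-- The central element of the Heisenberg algebra. -/
def heisZ (k : Type u) [Field k] (i n : ℕ) : (heis k i n).carrier n :=
  elem ![0, i, n] 0 2 (by decide) (by simp)

theorem heis_bracket (h : i + j = n) :
    (heis k i n).bracket i j n h (heisX k i n) (heisY k h) = heisZ k i n :=
  elem_bracket h _ _ _ _

theorem heis_bracket' (h : i + j = n) (h' : j + i = n) :
    (heis k i n).bracket j i n h' (heisY k h) (heisX k i n) =
      -((-1 : k) ^ (i * j) • heisZ k i n) := by
  rw [GradedLie.skew _ j i n h' h, heis_bracket, mul_comm]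

theorem heis_entry {m : ℕ} (A : (heis k i n).carrier m) (a b : Fin 3) (h : A.1 a b ≠ 0) :
    a < b ∧ ![0, i, n] a + m = ![0, i, n] b := A.2 a b h

/-- The degrees of the entries of a homogeneous matrix. -/
theorem heis_deg {m : ℕ} (A : (heis k i n).carrier m) :
    (A.1 0 1 ≠ 0 → m = i) ∧ (A.1 1 2 ≠ 0 → i + m = n) ∧ (A.1 0 2 ≠ 0 → m = n) := by
  refine ⟨fun h => ?_, fun h => ?_, fun h => ?_⟩ <;> simpa using (heis_entry A _ _ h).2

theorem heis_zero {m : ℕ} (A : (heis k i n).carrier m) (a b : Fin 3) (hab : ¬ a < b) :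
    A.1 a b = 0 := by
  by_contra h
  exact hab (heis_entry A _ _ h).1

theorem heis_bracket_apply {p q m : ℕ} (e : p + q = m) (A : (heis k i n).carrier p)
    (B : (heis k i n).carrier q) :
    ((heis k i n).bracket p q m e A B).1 0 1 = 0 ∧
    ((heis k i n).bracket p q m e A B).1 1 2 = 0 ∧
    ((heis k i n).bracket p q m e A B).1 0 2 =
      A.1 0 1 * B.1 1 2 - (-1 : k) ^ (p * q) * (B.1 0 1 * A.1 1 2) := by
  have z : ∀ {m : ℕ} (A : (heis k i n).carrier m), A.1 0 0 = 0 ∧ A.1 1 1 = 0 ∧ A.1 2 2 = 0 ∧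
      A.1 1 0 = 0 ∧ A.1 2 0 = 0 ∧ A.1 2 1 = 0 := fun A =>
    ⟨heis_zero A _ _ (by decide), heis_zero A _ _ (by decide), heis_zero A _ _ (by decide),
      heis_zero A _ _ (by decide), heis_zero A _ _ (by decide), heis_zero A _ _ (by decide)⟩
  obtain ⟨a1, a2, a3, a4, -, a6⟩ := z A
  obtain ⟨b1, b2, b3, b4, -, b6⟩ := z B
  refine ⟨?_, ?_, ?_⟩ <;>
  · rw [triLie_bracket, Matrix.sub_apply, Matrix.smul_apply, Matrix.mul_apply, Matrix.mul_apply,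
      Fin.sum_univ_three, Fin.sum_univ_three]
    simp [a1, a2, a3, a4, a6, b1, b2, b3, b4, b6]

/-- The morphism from the Heisenberg algebra to `g[ε₁][ε₂]` that sends the generators to
`ε₁ x` and `ε₂ y`, and their bracket to `ε₁ ε₂ [x, y]`. The parameters are needed since `[x, x]`
need not vanish for odd `x`. -/
noncomputable def heisHom {g : GrNilpLie k} (h : i + j = n) (x : g.carrier i) (y : g.carrier j) :
    heis k i n ⟶ dual (dual g) :=
  Hom.mk (fun m =>
    { toFun := fun A => ((0, A.1 0 1 • Pi.single (M := g.carrier) i x m),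
        (A.1 1 2 • Pi.single (M := g.carrier) j y m,
          A.1 0 2 • Pi.single (M := g.carrier) n (g.bracket i j n h x y) m))
      map_add' := fun A B => Prod.ext (Prod.ext (add_zero _).symm (add_smul _ _ _))
        (Prod.ext (add_smul _ _ _) (add_smul _ _ _))
      map_smul' := fun c A => Prod.ext (Prod.ext (smul_zero _).symm (mul_smul _ _ _))
        (Prod.ext (mul_smul _ _ _) (mul_smul _ _ _)) }) <| by
    intro p q m e A B
    obtain ⟨h1, h2, h3⟩ := heis_bracket_apply e A B
    obtain ⟨a1, a2, -⟩ := heis_deg A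
    obtain ⟨b1, b2, -⟩ := heis_deg B
    refine Prod.ext (Prod.ext ?_ ?_) (Prod.ext ?_ ?_)
    · simp
    · change ((heis k i n).bracket p q m e A B).1 0 1 • _ =
        g.bracket p q m e 0 (B.1 0 1 • Pi.single (M := g.carrier) i x q)
          + g.bracket p q m e (A.1 0 1 • Pi.single (M := g.carrier) i x p) 0
      rw [h1, zero_smul, map_zero, map_zero, LinearMap.zero_apply, add_zero]
    · change ((heis k i n).bracket p q m e A B).1 1 2 • _ =
        g.bracket p q m e 0 (B.1 1 2 • Pi.single (M := g.carrier) j y q)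
          + g.bracket p q m e (A.1 1 2 • Pi.single (M := g.carrier) j y p) 0
      rw [h2, zero_smul, map_zero, map_zero, LinearMap.zero_apply, add_zero]
    · change ((heis k i n).bracket p q m e A B).1 0 2 • _ =
        (g.bracket p q m e 0 _ + g.bracket p q m e (A.1 0 1 • _) (B.1 1 2 • _)) +
          (g.bracket p q m e (A.1 1 2 • _) (B.1 0 1 • _) + g.bracket p q m e _ 0)
      rw [h3, map_zero, LinearMap.zero_apply, zero_add, map_zero, add_zero, sub_smul]
      simp only [map_smul, LinearMap.smul_apply, smul_smul, sub_eq_add_neg]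
      congr 1
      · by_cases hA : A.1 0 1 = 0
        · simp [hA]
        by_cases hB : B.1 1 2 = 0
        · simp [hB]
        obtain rfl := a1 hA
        have hq := b2 hB
        obtain rfl : j = q := by omega
        obtain rfl := h
        obtain rfl := e
        simp [mul_comm]
      · by_cases hA : A.1 1 2 = 0
        · simp [hA]
        by_cases hB : B.1 0 1 = 0
        · simp [hB]
        obtain rfl := b1 hB
        have hq := a2 hA
        obtain rfl : j = p := by omega
        obtain rfl := e
        obtain rfl : n = j + q := by omega
        simp only [Pi.single_eq_same]
        rw [g.skew j q (j + q) rfl h, smul_neg, smul_smul]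
        congr 2
        ring

theorem heisHom_X {g : GrNilpLie k} (h : i + j = n) (x : g.carrier i) (y : g.carrier j) :
    Hom.app (heisHom h x y) i (heisX k i n) = dinl (dual g) i (dinr g i x) := by
  refine Prod.ext (Prod.ext rfl ?_) (Prod.ext ?_ ?_)
  · change (Matrix.single (0 : Fin 3) (1 : Fin 3) (1 : k)) 0 1 •
        Pi.single (M := g.carrier) i x i = x
    simp
  · change (Matrix.single (0 : Fin 3) (1 : Fin 3) (1 : k)) 1 2 • _ = 0
    simp
  · change (Matrix.single (0 : Fin 3) (1 : Fin 3) (1 : k)) 0 2 • _ = 0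
    simp

theorem heisHom_Y {g : GrNilpLie k} (h : i + j = n) (x : g.carrier i) (y : g.carrier j) :
    Hom.app (heisHom h x y) j (heisY k h) = dinr (dual g) j (dinl g j y) := by
  refine Prod.ext (Prod.ext rfl ?_) (Prod.ext ?_ ?_)
  · change (Matrix.single (1 : Fin 3) (2 : Fin 3) (1 : k)) 0 1 • _ = 0
    simp
  · change (Matrix.single (1 : Fin 3) (2 : Fin 3) (1 : k)) 1 2 •
        Pi.single (M := g.carrier) j y j = y
    simp
  · change (Matrix.single (1 : Fin 3) (2 : Fin 3) (1 : k)) 0 2 • _ = 0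
    simp

theorem heisHom_Z {g : GrNilpLie k} (h : i + j = n) (x : g.carrier i) (y : g.carrier j) :
    Hom.app (heisHom h x y) n (heisZ k i n) =
      dinr (dual g) n (dinr g n (g.bracket i j n h x y)) := by
  refine Prod.ext (Prod.ext rfl ?_) (Prod.ext ?_ ?_)
  · change (Matrix.single (0 : Fin 3) (2 : Fin 3) (1 : k)) 0 1 • _ = 0
    simp
  · change (Matrix.single (0 : Fin 3) (2 : Fin 3) (1 : k)) 1 2 • _ = 0
    simp
  · change (Matrix.single (0 : Fin 3) (2 : Fin 3) (1 : k)) 0 2 •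
      Pi.single (M := g.carrier) n (g.bracket i j n h x y) n = _
    simp
    rfl

end heis

end GrNilpLie

/-! ### The product of the tangent space -/

namespace GrNilpLie

variable {k : Type u} [Field k] {G : GrNilpLie k ⥤ GrpCat.{w}}

namespace LieT

variable [IsReduced G] [IsHomogeneous G] {g h : GrNilpLie k}

theorem heis_decomp {i n : ℕ} {j : ℕ} (e : i + j = n) (X : LieT G (heis k i n)) :
    X = tens (heisX k i n) (coord (entry _ _ 0 1) X) + tens (heisY k e) (coord (entry _ _ 1 2) X) +
      tens (heisZ k i n) (coord (entry _ _ 0 2) X) := by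
  rw [tens_coord, tens_coord, tens_coord, ← map_add_lin, ← map_add_lin]
  nth_rewrite 1 [← map_id X]
  refine map_congr (fun m A => ?_) X
  have key : ∀ (a b : Fin 3) (d : ℕ) (hab : a < b) (hd : (![0, i, n] : Fin 3 → ℕ) a + d =
      ![0, i, n] b),
      lineMap (elem (k := k) ![0, i, n] a b hab hd) m (coordMap (entry _ d a b) m A) =
        ⟨Matrix.single a b (A.1 a b), fun c d hcd => by
          by_cases h' : a = c ∧ b = d
          · obtain ⟨rfl, rfl⟩ := h'
            rw [Matrix.single_apply_same] at hcd
            exact A.2 _ _ hcd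
          · exact absurd (Matrix.single_apply_of_ne (c := (A.1 a b : k)) (h := h')) hcd⟩ := by
    intro a b d hab hd
    by_cases hm : m = d
    · subst hm
      rw [lineMap_coordMap]
      ext1
      change A.1 a b • Matrix.single a b (1 : k) = _
      rw [Matrix.smul_single, smul_eq_mul, mul_one]
    · rw [lineMap_coordMap_of_ne hm]
      ext1
      have : A.1 a b = 0 := by
        by_contra h
        have := (heis_entry A a b h).2
        omega
      change 0 = Matrix.single a b (A.1 a b)
      rw [this, Matrix.single_zero]
  have k1 := key 0 1 i (by decide) (by simp)
  have k2 := key 1 2 j (by decide) (by simpa)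
  have k3 := key 0 2 n (by decide) (by simp)
  refine Eq.trans ?_ (congrArg₂ (· + ·) (congrArg₂ (· + ·) k1 k2) k3).symm
  ext a b
  change A.1 a b = Matrix.single 0 1 (A.1 0 1) a b + Matrix.single 1 2 (A.1 1 2) a b +
    Matrix.single 0 2 (A.1 0 2) a b
  by_cases hab : a < b
  · fin_cases a <;> fin_cases b <;> first | exact absurd hab (by decide) | simp
  · rw [heis_zero A a b hab]
    have : ∀ (c d : Fin 3), c < d → ∀ x : k, Matrix.single c d x a b = 0 := fun c d hcd x => by
      rw [Matrix.single_apply, if_neg]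
      rintro ⟨rfl, rfl⟩
      exact hab hcd
    rw [this _ _ (by decide), this _ _ (by decide), this _ _ (by decide), add_zero, add_zero]

/-- The bracket of an abelian graded Lie algebra induces the zero bracket. -/
theorem br_eq_zero_of_abelian (H : ∀ i j n e x y, g.bracket i j n e x y = 0) (X Y : LieT G g) :
    br X Y = 0 := by
  have := br_map_map_eq_zero (g := g) (g' := g) (fun _ => LinearMap.id) (fun _ => LinearMap.id)
    (fun i j n e x y => H i j n e x y) X Y
  rwa [map_id, map_id] at this

/-- A coordinate of the Heisenberg algebra that vanishes on brackets, as a morphism. -/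
noncomputable def heisCoord (i n d : ℕ) (a b : Fin 3)
    (H : ∀ p q m e (A : (heis k i n).carrier p) (B : (heis k i n).carrier q),
      ((heis k i n).bracket p q m e A B).1 a b = 0) : heis k i n ⟶ line k d :=
  Hom.mk (coordMap (entry _ d a b)) fun p q m e A B => by
    by_cases hm : m = d
    · subst hm
      rw [coordMap_same]
      exact (congrArg (· • eps k m) (H p q m e A B)).trans (zero_smul k _)
    · exact coordMap_of_ne hm _ _

/-- The value of the product of `A^*`, read off from the bracket of the two generators of the
Heisenberg algebra. -/
noncomputable def prodCoord {i j n : ℕ} (h : i + j = n) (a : Tangent G i) (b : Tangent G j) :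
    Tangent G n :=
  coord (entry _ _ 0 2) (br (tens (heisX k i n) a) (tens (heisY k h) b))

/-- The bracket has no component along the generators, because their coordinates are morphisms to
abelian graded Lie algebras. -/
theorem br_heis {i j n : ℕ} (h : i + j = n) (a : Tangent G i) (b : Tangent G j) :
    br (tens (heisX k i n) a) (tens (heisY k h) b) = tens (heisZ k i n) (prodCoord h a b) := by
  conv_lhs => rw [heis_decomp h (br (tens (heisX k i n) a) (tens (heisY k h) b))]
  have key : ∀ (d : ℕ) (a' b' : Fin 3) (H : ∀ p q m e (A : (heis k i n).carrier p)
      (B : (heis k i n).carrier q), ((heis k i n).bracket p q m e A B).1 a' b' = 0),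
      coord (entry _ d a' b') (br (tens (heisX k i n) a) (tens (heisY k h) b)) = 0 := by
    intro d a' b' H
    have := map_br (heisCoord i n d a' b' H) (tens (heisX k i n) a) (tens (heisY k h) b)
    rw [br_eq_zero_of_abelian (g := line k d) (fun _ _ _ _ _ _ => rfl)] at this
    exact this
  rw [key _ _ _ (fun p q m e A B => (heis_bracket_apply e A B).1),
    key _ _ _ (fun p q m e A B => (heis_bracket_apply e A B).2.1), map_zero, map_zero, zero_add,
    zero_add]
  rfl

/-- The morphism `heisHom` carries `br_heis` over to `g`. -/
theorem br_tens_aux {i j n : ℕ} (h : i + j = n) (x : g.carrier i) (y : g.carrier j)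
    (a : Tangent G i) (b : Tangent G j) :
    br (tens x a) (tens y b) = tens (g.bracket i j n h x y) (prodCoord h a b) := by
  have h1 := map_br (heisHom h x y) (tens (heisX k i n) a) (tens (heisY k h) b)
  rw [br_heis, map_tens, map_tens, map_tens, heisHom_X, heisHom_Y, heisHom_Z] at h1
  rw [← map_tens (dinl (dual g)), ← map_tens (dinr (dual g)), ← map_tens (dinr (dual g)),
    ← map_tens (dinr g), ← map_tens (dinr g), ← map_tens (dinl g)] at h1
  rw [br_inl_inr, br_inr_inl] at h1
  exact (dinr_injective (dinr_injective h1)).symm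

theorem neg_one_pow_mul_self (n : ℕ) : (-1 : k) ^ n * (-1) ^ n = 1 := by
  rw [← mul_pow]; simp

variable (G) in
/-- The product of the tangent space `A^*`, determined by
`[a ⊗ x, b ⊗ y] = (-1)^{ij} a b ⊗ [x, y]`. -/
noncomputable def mulT (i j n : ℕ) (h : i + j = n) :
    Tangent G i →ₗ[k] Tangent G j →ₗ[k] Tangent G n :=
  LinearMap.mk₂ k (fun a b => (-1 : k) ^ (i * j) • prodCoord h a b)
    (fun a a' b => by simp only [prodCoord, map_add, br_add_left, smul_add])
    (fun c a b => by simp only [prodCoord, map_smul, br_smul_left]; rw [smul_comm])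
    (fun a b b' => by simp only [prodCoord, map_add, br_add_right, smul_add])
    (fun c a b => by simp only [prodCoord, map_smul, br_smul_right]; rw [smul_comm])

/-- The bracket of `L(g)` in terms of the product of `A^*`. -/
theorem br_tens {i j n : ℕ} (h : i + j = n) (x : g.carrier i) (y : g.carrier j)
    (a : Tangent G i) (b : Tangent G j) : br (tens x a) (tens y b) =
      (-1 : k) ^ (i * j) • tens (g.bracket i j n h x y) (mulT G i j n h a b) := by
  rw [br_tens_aux h]
  change _ = _ • tens _ ((-1 : k) ^ (i * j) • prodCoord h a b)
  rw [map_smul, smul_smul, neg_one_pow_mul_self, one_smul]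

/-- Commutativity follows from the skew symmetry of the bracket of the Heisenberg algebra. -/
theorem mulT_comm (i j n : ℕ) (h : i + j = n) (h' : j + i = n) (a : Tangent G i)
    (b : Tangent G j) : mulT G i j n h a b = (-1 : k) ^ (i * j) • mulT G j i n h' b a := by
  have h1 := br_skew (G := G) (tens (heisX k i n) a) (tens (heisY k h) b)
  rw [br_tens h, br_tens h', heis_bracket, heis_bracket', tens_neg, tens_smul, smul_neg, neg_neg,
    mul_comm j i, smul_smul, neg_one_pow_mul_self, one_smul, ← map_smul (tens (heisZ k i n))] at h1
  have h2 := tens_injective (ℓ := entry _ _ 0 2) (entry_elem _ _ _ _) h1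
  have h3 := congrArg ((-1 : k) ^ (i * j) • ·) h2
  simpa only [smul_smul, neg_one_pow_mul_self, one_smul] using h3

/-- Associativity follows from the Jacobi identity for the three generators of the algebra of
strictly upper triangular `4 × 4` matrices, the first and the last of which commute. -/
theorem mulT_assoc (i j l ij jl n : ℕ) (hij : i + j = ij) (hjl : j + l = jl)
    (h₁ : ij + l = n) (h₂ : i + jl = n) (a : Tangent G i) (b : Tangent G j) (c : Tangent G l) :
    mulT G ij l n h₁ (mulT G i j ij hij a b) c = mulT G i jl n h₂ a (mulT G j l jl hjl b c) := by
  let s : Fin 4 → ℕ := ![0, i, ij, n]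
  have s0 : s 0 = 0 := rfl
  have s1 : s 1 = i := rfl
  have s2 : s 2 = ij := rfl
  have s3 : s 3 = n := rfl
  let x := elem (k := k) s (m := i) 0 1 (by decide) (by omega)
  let y := elem (k := k) s (m := j) 1 2 (by decide) (by omega)
  let z := elem (k := k) s (m := l) 2 3 (by decide) (by omega)
  have hJ := br_leibniz (G := G) (tens x a) (tens y b) (tens z c)
  have e1 : (tri s).bracket i j ij hij x y = elem s 0 2 (by decide) (by omega) :=
    elem_bracket hij _ _ _ _
  have e2 : (tri s).bracket j l jl hjl y z = elem s 1 3 (by decide) (by omega) :=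
    elem_bracket hjl _ _ _ _
  have e3 : (tri s).bracket i l (i + l) rfl x z = 0 :=
    elem_bracket_of_ne rfl _ _ _ _ (by decide) (by decide)
  have e4 : (tri s).bracket i jl n h₂ x (elem s 1 3 (by decide) (by omega)) =
      elem s 0 3 (by decide) (by omega) := elem_bracket h₂ _ _ _ _
  have e5 : (tri s).bracket ij l n h₁ (elem s 0 2 (by decide) (by omega)) z =
      elem s 0 3 (by decide) (by omega) := elem_bracket h₁ _ _ _ _
  rw [br_tens (rfl : i + l = i + l), e3, tens_zero, smul_zero, br_tens hij, br_tens hjl, e1, e2,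
    br_smul_right, br_smul_left, br_tens h₂, br_tens h₁, e4, e5,
    ← zero_smul k (0 : LieT G (tri s)), br_smul_right, zero_smul, add_zero, smul_smul, smul_smul,
    ← map_smul (tens (elem (k := k) s 0 3 _ _)), ← map_smul (tens (elem (k := k) s 0 3 _ _))] at hJ
  have h2 := tens_injective (ℓ := entry _ _ 0 3) (entry_elem _ _ _ _) hJ
  have hs : (-1 : k) ^ (j * l) * (-1) ^ (i * jl) = (-1) ^ (i * j) * (-1) ^ (ij * l) := by
    rw [← pow_add, ← pow_add, ← hij, ← hjl]
    congr 1
    ring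
  rw [hs, ← pow_add] at h2
  have h3 := congrArg ((-1 : k) ^ (i * j + ij * l) • ·) h2
  simp only [smul_smul, neg_one_pow_mul_self, one_smul] at h3
  exact h3.symm

variable (G) in
/-- The graded-commutative algebra structure of the tangent space. -/
noncomputable def algebraT : GAStructure k (Tangent G) := ⟨mulT G, mulT_comm, mulT_assoc⟩

variable [CharZero k]

/-- The Lie algebra `⨁ A^n ⊗ g_n` is `L(g)`. -/
noncomputable def totalEquiv (g : GrNilpLie k) :
    TotalLie (algebraT G) g.toGradedLie ≃ₗ[k] LieT G g := tensorEquiv g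

theorem totalEquiv_incl {n : ℕ} (a : Tangent G n) (x : g.carrier n) :
    totalEquiv g (TotalLie.incl (algebraT G) g.toGradedLie n (a ⊗ₜ x)) = tens x a :=
  ofTensor_lof n a x

theorem totalEquiv_lie (X Y : TotalLie (algebraT G) g.toGradedLie) :
    totalEquiv g ⁅X, Y⁆ = ⁅totalEquiv g X, totalEquiv g Y⁆ := by
  change totalEquiv g (TotalLie.bracket _ _ X Y) = _
  induction X using TotalLie.induction with
  | zero => simp
  | add x x' hx hx' => rw [map_add, LinearMap.add_apply, map_add, hx, hx', map_add, add_lie]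
  | tmul i a x =>
    induction Y using TotalLie.induction with
    | zero => simp
    | add y y' hy hy' => rw [map_add, map_add, hy, hy', map_add, lie_add]
    | tmul j b y =>
      rw [TotalLie.bracket_tmul _ _ i j _ rfl, map_smul, totalEquiv_incl, totalEquiv_incl,
        totalEquiv_incl, lie_def, br_tens rfl]
      rfl

theorem totalEquiv_map (f : g ⟶ h) (X : TotalLie (algebraT G) g.toGradedLie) :
    totalEquiv h (TotalLie.map (algebraT G) f X) = map (lin f) (totalEquiv g X) := by
  induction X using TotalLie.induction with
  | zero => simp
  | add x x' hx hx' => rw [map_add, map_add, hx, hx', map_add, map_add]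
  | tmul i a x =>
    have : TotalLie.map (algebraT G) f (TotalLie.incl (algebraT G) g.toGradedLie i (a ⊗ₜ x)) =
        TotalLie.incl (algebraT G) h.toGradedLie i (a ⊗ₜ Hom.app f i x) := by
      change DirectSum.lmap _ (DirectSum.lof k ℕ _ i _) = _
      rw [DirectSum.lmap_lof]
      rfl
    rw [this, totalEquiv_incl, totalEquiv_incl, map_tens]

end LieT

end GrNilpLie

/-! ### Logarithmic derivatives -/

namespace GrNilpLie

variable {k : Type u} [Field k] {G : GrNilpLie k ⥤ GrpCat.{w}}

namespace LieT

variable [IsReduced G] [IsHomogeneous G] {g h : GrNilpLie k} {D D' : GLin g g}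

theorem proj_derHom (hD : IsDer D) (u : G.obj g) :
    G.map (dualProj g) (G.map (derHom hD) u) = u := by
  rw [map_map]
  exact map_id_apply G u

theorem dlog_aux (hD : IsDer D) (u : G.obj g) : G.map (dualProj g)
    (G.map (derHom hD) u * (G.map (dualIncl g) u)⁻¹) = 1 := by
  rw [map_mul, map_inv, proj_incl, proj_derHom, mul_inv_cancel]

/-- The logarithmic derivative of `u ∈ G(g)` along a derivation `D` of `g`:
`(1 + ε D) u = (1 + ε dlog u) u`. -/
noncomputable def dlog (hD : IsDer D) (u : G.obj g) : LieT G g :=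
  (existsUnique_push_dualEps _ (dlog_aux hD u)).choose

theorem map_derHom (hD : IsDer D) (u : G.obj g) : G.map (derHom hD) u =
    push (dualEps g) (dlog hD u) * G.map (dualIncl g) u := by
  rw [← mul_inv_eq_iff_eq_mul]
  exact (existsUnique_push_dualEps _ (dlog_aux hD u)).choose_spec.1.symm

theorem dlog_eq_of (hD : IsDer D) (u : G.obj g) (X : LieT G g)
    (h : G.map (derHom hD) u = push (dualEps g) X * G.map (dualIncl g) u) : dlog hD u = X := by
  apply dualEps_injective
  rw [map_derHom] at h
  exact mul_right_cancel h

/-- The logarithmic derivative is a crossed homomorphism. -/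
theorem dlog_mul (hD : IsDer D) (u v : G.obj g) :
    dlog hD (u * v) = dlog hD u + Ad u (dlog hD v) := by
  apply dlog_eq_of
  rw [map_mul, map_derHom, map_derHom, push_add, push_Ad, map_mul]
  group

theorem dlog_one (hD : IsDer D) : dlog hD (1 : G.obj g) = 0 := by
  apply dlog_eq_of
  rw [map_one, map_one, push_zero, one_mul]

theorem map_dlog (f : g ⟶ h) (hD : IsDer D) {E : GLin h h} (hE : IsDer E)
    (H : ∀ n x, Hom.app f n (D n x) = E n (Hom.app f n x)) (u : G.obj g) :
    dlog hE (G.map f u) = map (lin f) (dlog hD u) := by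
  apply dlog_eq_of
  have e : derHom hD ≫ dualMap f = f ≫ derHom hE :=
    hom_ext fun n x => Prod.ext (by rfl) (by exact H n x)
  rw [← dualMap_eps, ← dualMap_incl, ← map_mul, ← map_derHom, map_map, map_map, e]

/-- The logarithmic derivative on an abelian part of `g`. -/
theorem dlog_push {g' : GrNilpLie k} (s : GLin g' g)
    (hs : ∀ i j n e x y, g.bracket i j n e (s i x) (s j y) = 0) (hD : IsDer D)
    (hr : ∀ i j n e x y, g.bracket i j n e (s i x) (D j (s j y)) = 0) (X : LieT G g') :
    dlog hD (push (abHom s hs) X) = map D (map s X) := by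
  apply dlog_eq_of
  have h1 : G.map (dualIncl g) (push (abHom s hs) X) =
      push (pairHom s (fun n => D n ∘ₗ s n) hs hr) (map (dinl g') X) := by
    rw [map_push, push_map]
    exact push_congr (fun n x => Prod.ext (by rfl) (by exact (map_zero (D n ∘ₗ s n)).symm)) X
  have h2 : push (dualEps g) (map D (map s X)) =
      push (pairHom s (fun n => D n ∘ₗ s n) hs hr) (map (dinr g') X) := by
    rw [map_map', push_map, push_map]
    exact push_congr (fun n x => Prod.ext (by exact (map_zero (s n)).symm) (by rfl)) X
  rw [h1, h2, ← push_add, ← map_add_lin, map_push, push_map]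
  exact push_congr (fun n x => Prod.ext (by exact congrArg (s n) (zero_add x).symm)
    (by exact congrArg (D n ∘ₗ s n) (add_zero x).symm)) X

theorem map_derHom_lin (hD : IsDer D) (X : LieT G g) :
    map (lin (derHom hD)) X = map (dinl g) X + map (dinr g) (map D X) := by
  rw [map_map', ← map_add_lin]
  exact map_congr (fun n x => Prod.ext (by exact (add_zero _).symm)
    (by exact (zero_add _).symm)) X

/-- Derivations of `g` induce derivations of `L(g)`. -/
theorem map_der_br (hD : IsDer D) (X Y : LieT G g) :
    map D (br X Y) = br (map D X) Y + br X (map D Y) := by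
  have h := map_br (derHom hD) X Y
  rw [map_derHom_lin, map_derHom_lin, map_derHom_lin, br_add_left, br_add_right, br_add_right,
    br_inl_inl, br_inl_inr, br_inr_inl, br_inr_inr] at h
  have h' := congrArg (map (G := G) (dsnd g)) h
  simp only [map_add, dsnd_dinl, dsnd_dinr, zero_add, add_zero] at h'
  rw [h', add_comm]

theorem Ad_eps (X Y W : LieT G g) :
    Ad (push (dualEps g) X) (map (dinl g) Y + map (dinr g) W) =
      map (dinl g) Y + map (dinr g) (br X Y + W) := by
  rw [map_add, Ad_eps_inl, Ad_eps_inr, map_add, add_assoc]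

/-- The derivative of the adjoint action: `D ∘ Ad u = Ad u ∘ D + ad (dlog u) ∘ Ad u`. -/
theorem map_der_Ad (hD : IsDer D) (u : G.obj g) (Y : LieT G g) :
    map D (Ad u Y) = Ad u (map D Y) + br (dlog hD u) (Ad u Y) := by
  have h := map_Ad (derHom hD) u Y
  rw [map_derHom_lin, map_derHom_lin, map_derHom, Ad_mul, map_add, Ad_incl_inl, Ad_incl_inr,
    Ad_eps] at h
  have h' := congrArg (map (G := G) (dsnd g)) h
  simp only [map_add, dsnd_dinl, dsnd_dinr, zero_add] at h'
  rw [h', add_comm]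

/-- The flatness equation for the logarithmic derivatives along commuting derivations. -/
theorem dlog_flat (hD : IsDer D) (hD' : IsDer D') (H : ∀ n x, D n (D' n x) = D' n (D n x))
    (u : G.obj g) : map D (dlog hD' u) =
      map D' (dlog hD u) + br (dlog hD u) (dlog hD' u) := by
  -- Compute the logarithmic derivative along `D'` of `(1 + ε D) u = (1 + ε dlog u) u` in two ways.
  have h1 := map_dlog (derHom hD) hD' hD'.dualLin (fun n x => Prod.ext (by rfl) (by exact H n x)) u
  have h2 : dlog hD'.dualLin (push (dualEps g) (dlog hD u)) =
      map (dinr g) (map D' (dlog hD u)) := by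
    refine (dlog_push (dinr g) _ hD'.dualLin
      (fun i j n e x y => Prod.ext (by simp [dinr]) (by simp [dinr, dualLin])) _).trans ?_
    rw [map_map', map_map']
    exact map_congr (fun n x => Prod.ext (by exact map_zero (D' n)) (by rfl)) _
  have h3 : dlog hD'.dualLin (G.map (dualIncl g) u) = map (dinl g) (dlog hD' u) :=
    map_dlog (dualIncl g) hD' _ (fun n x => Prod.ext (by rfl) (by exact (map_zero (D' n)).symm)) u
  rw [map_derHom, dlog_mul, h2, h3, Ad_eps_inl, map_derHom_lin] at h1
  have h' := congrArg (map (G := G) (dsnd g)) h1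
  simp only [map_add, dsnd_dinl, dsnd_dinr, zero_add] at h'
  exact h'.symm

end LieT

end GrNilpLie

/-! ### The truncated Rees algebra of the lower central series -/

open Finset Finset.HasAntidiagonal in
/-- The two ways to sum over triples of given sum. -/
theorem sum_antidiagonal_assoc {M : Type*} [AddCommMonoid M] (T : ℕ → ℕ → ℕ → M) (n : ℕ) :
    ∑ p ∈ antidiagonal n, ∑ q ∈ antidiagonal p.2, T p.1 q.1 q.2 =
      ∑ p ∈ antidiagonal n, ∑ q ∈ antidiagonal p.1, T q.1 q.2 p.2 := by
  rw [sum_sigma', sum_sigma']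
  refine sum_nbij' (fun x => ⟨(x.1.1 + x.2.1, x.2.2), (x.1.1, x.2.1)⟩)
    (fun x => ⟨(x.2.1, x.2.2 + x.1.2), (x.2.2, x.1.2)⟩) ?_ ?_ ?_ ?_ ?_ <;>
  · rintro ⟨⟨a, b⟩, ⟨c, d⟩⟩ h
    simp only [mem_sigma, HasAntidiagonal.mem_antidiagonal] at h
    obtain ⟨h1, h2⟩ := h
    subst h2
    simp [← h1, add_assoc]

open Finset Finset.HasAntidiagonal in
theorem sum_antidiagonal_left_comm {M : Type*} [AddCommMonoid M] (T : ℕ → ℕ → ℕ → M) (n : ℕ) :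
    ∑ p ∈ antidiagonal n, ∑ q ∈ antidiagonal p.2, T p.1 q.1 q.2 =
      ∑ p ∈ antidiagonal n, ∑ q ∈ antidiagonal p.2, T q.1 p.1 q.2 := by
  rw [sum_sigma', sum_sigma']
  refine sum_nbij' (fun x => ⟨(x.2.1, x.1.1 + x.2.2), (x.1.1, x.2.2)⟩)
    (fun x => ⟨(x.2.1, x.1.1 + x.2.2), (x.1.1, x.2.2)⟩) ?_ ?_ ?_ ?_ ?_ <;>
  · rintro ⟨⟨a, b⟩, ⟨c, d⟩⟩ h
    simp only [mem_sigma, HasAntidiagonal.mem_antidiagonal] at h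
    obtain ⟨h1, h2⟩ := h
    subst h2
    simp [← h1, add_left_comm]

namespace GrNilpLie

variable {k : Type u} [Field k]

/-- The degree `n` part of the truncated Rees algebra: polynomials `∑ x_w t^w`, `1 ≤ w ≤ N`, with
`x_w` in the `w`-th term (counted from `1`) of the lower central series. -/
abbrev ReesCarrier (N : ℕ) (g : GradedLie k) (n : ℕ) : Type u := ∀ j : Fin N, g.lcs j n

section carrier

variable {N : ℕ} {g : GradedLie k} {n : ℕ}

/-- The coefficient of `t^w`, which is zero unless `1 ≤ w ≤ N`. -/
def rc (w : ℕ) : ReesCarrier N g n →ₗ[k] g.carrier n :=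
  if h : 0 < w ∧ w ≤ N then (g.lcs _ n).subtype.comp (LinearMap.proj (⟨w - 1, by omega⟩ : Fin N))
  else 0

/-- The polynomial with given coefficients. -/
def rmk (N : ℕ) (F : ℕ → g.carrier n) (hF : ∀ w, F (w + 1) ∈ g.lcs w n) : ReesCarrier N g n :=
  fun j => ⟨F (j + 1), hF j⟩

theorem rc_rmk (F : ℕ → g.carrier n) (hF : ∀ w, F (w + 1) ∈ g.lcs w n) (w : ℕ) :
    rc w (rmk N F hF) = if 0 < w ∧ w ≤ N then F w else 0 := by
  by_cases h : 0 < w ∧ w ≤ N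
  · rw [rc, dif_pos h, if_pos h]
    change F (w - 1 + 1) = F w
    rw [Nat.sub_add_cancel h.1]
  · rw [rc, dif_neg h, if_neg h, LinearMap.zero_apply]

theorem rc_of_not {w : ℕ} (h : ¬ (0 < w ∧ w ≤ N)) (x : ReesCarrier N g n) : rc w x = 0 := by
  rw [rc, dif_neg h, LinearMap.zero_apply]

theorem rc_zero (x : ReesCarrier N g n) : rc 0 x = 0 := rc_of_not (by omega) x

theorem rc_mem (w : ℕ) (x : ReesCarrier N g n) : rc (w + 1) x ∈ g.lcs w n := by
  by_cases h : 0 < w + 1 ∧ w + 1 ≤ N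
  · rw [rc, dif_pos h]
    exact (x ⟨w, by omega⟩).2
  · rw [rc_of_not h]
    exact zero_mem _

theorem rees_ext {x y : ReesCarrier N g n} (h : ∀ w, 0 < w → w ≤ N → rc w x = rc w y) : x = y := by
  funext j
  have := h (j + 1) (by omega) (by omega)
  rw [rc, dif_pos (by omega)] at this
  exact Subtype.ext this

/-- Linear maps into the Rees algebra, in terms of coefficients. -/
def rlin {V : Type*} [AddCommGroup V] [Module k V] (N : ℕ) (F : ℕ → V →ₗ[k] g.carrier n)
    (hF : ∀ w x, F (w + 1) x ∈ g.lcs w n) : V →ₗ[k] ReesCarrier N g n where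
  toFun x := rmk N (fun w => F w x) fun w => hF w x
  map_add' x y := rees_ext fun w h h' => by simp [rc_rmk, h, h']
  map_smul' c x := rees_ext fun w h h' => by simp [rc_rmk, h, h']

theorem rc_rlin {V : Type*} [AddCommGroup V] [Module k V] (F : ℕ → V →ₗ[k] g.carrier n)
    (hF : ∀ w x, F (w + 1) x ∈ g.lcs w n) (w : ℕ) (x : V) :
    rc w (rlin N F hF x) = if 0 < w ∧ w ≤ N then F w x else 0 :=
  rc_rmk (fun w => F w x) (fun w => hF w x) w

end carrier

/-- The coefficients of the bracket of two polynomials. -/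
def rbr {N : ℕ} {g : GradedLie k} {i j n : ℕ} (h : i + j = n) (x : ReesCarrier N g i)
    (y : ReesCarrier N g j) (w : ℕ) : g.carrier n :=
  ∑ p ∈ Finset.HasAntidiagonal.antidiagonal w, g.bracket i j n h (rc p.1 x) (rc p.2 y)

/-- Since `[lcs (a - 1), lcs (b - 1)] ⊆ lcs (a + b - 1)`, the product of polynomials of the Rees
algebra stays in it. -/
theorem bracket_rc_mem {N : ℕ} {g : GradedLie k} {i j n : ℕ} (h : i + j = n)
    (x : ReesCarrier N g i) (y : ReesCarrier N g j) {a b w : ℕ} (hab : a + b = w + 1) :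
    g.bracket i j n h (rc a x) (rc b y) ∈ g.lcs w n := by
  rcases a with _ | a
  · rw [rc_zero, map_zero, LinearMap.zero_apply]
    exact zero_mem _
  rcases b with _ | b
  · rw [rc_zero, map_zero]
    exact zero_mem _
  obtain rfl : w = a + b + 1 := by omega
  exact g.bracket_mem_lcs h (rc_mem a x) (rc_mem b y)

theorem rbr_mem {N : ℕ} {g : GradedLie k} {i j n : ℕ} (h : i + j = n) (x : ReesCarrier N g i)
    (y : ReesCarrier N g j) (w : ℕ) : rbr h x y (w + 1) ∈ g.lcs w n :=
  sum_mem fun _ hp => bracket_rc_mem h x y (Finset.HasAntidiagonal.mem_antidiagonal.1 hp)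

theorem rbr_zero {N : ℕ} {g : GradedLie k} {i j n : ℕ} (h : i + j = n) (x : ReesCarrier N g i)
    (y : ReesCarrier N g j) : rbr h x y 0 = 0 := by
  simp [rbr, rc_zero]

/-- The truncated Rees algebra `⨁_{1 ≤ w ≤ N} lcs (w - 1) t^w` of the lower central series. -/
abbrev reesLie (N : ℕ) (g : GradedLie k) : GradedLie k where
  carrier := ReesCarrier N g
  bracket i j n h := LinearMap.mk₂ k (fun x y => rmk N (rbr h x y) (rbr_mem h x y))
    (fun x x' y => rees_ext fun w h1 h2 => by
      rw [map_add, rc_rmk, rc_rmk, rc_rmk]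
      simp [h1, h2, rbr, Finset.sum_add_distrib])
    (fun c x y => rees_ext fun w h1 h2 => by
      rw [map_smul, rc_rmk, rc_rmk]
      simp [h1, h2, rbr, Finset.smul_sum])
    (fun x y y' => rees_ext fun w h1 h2 => by
      rw [map_add, rc_rmk, rc_rmk, rc_rmk]
      simp [h1, h2, rbr, Finset.sum_add_distrib])
    (fun c x y => rees_ext fun w h1 h2 => by
      rw [map_smul, rc_rmk, rc_rmk]
      simp [h1, h2, rbr, Finset.smul_sum])
  skew i j n h h' x y := rees_ext fun w h1 h2 => by
    rw [map_neg, map_smul, LinearMap.mk₂_apply, LinearMap.mk₂_apply, rc_rmk, rc_rmk,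
      if_pos ⟨h1, h2⟩, if_pos ⟨h1, h2⟩, rbr, rbr, Finset.smul_sum, ← Finset.sum_neg_distrib,
      ← Finset.Nat.sum_antidiagonal_swap]
    exact Finset.sum_congr rfl fun p _ => g.skew i j n h h' _ _
  jacobi i j l ij il jl n hij hil hjl h₁ h₂ h₃ x y z := rees_ext fun w h1 h2 => by
    have key : ∀ {a b c : ℕ} (e : a + b = c) (x : ReesCarrier N g a) (y : ReesCarrier N g b) (v : ℕ)
        (_ : v ≤ w), rc v (rmk N (rbr e x y) (rbr_mem e x y)) = rbr e x y v := by
      intro a b c e x y v hv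
      rw [rc_rmk]
      split_ifs with h0
      · rfl
      · obtain rfl : v = 0 := by omega
        exact (rbr_zero e x y).symm
    simp only [LinearMap.mk₂_apply, map_add, map_smul]
    rw [key _ _ _ w le_rfl, key _ _ _ w le_rfl, key _ _ _ w le_rfl]
    have e1 : rbr h₁ x (rmk N (rbr hjl y z) (rbr_mem hjl y z)) w =
        ∑ p ∈ Finset.HasAntidiagonal.antidiagonal w, ∑ q ∈ Finset.HasAntidiagonal.antidiagonal p.2,
          g.bracket i jl n h₁ (rc p.1 x) (g.bracket j l jl hjl (rc q.1 y) (rc q.2 z)) := by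
      refine Finset.sum_congr rfl fun p hp => ?_
      rw [key _ _ _ _ (by have := Finset.HasAntidiagonal.mem_antidiagonal.1 hp; omega),
        rbr, map_sum]
    have e2 : rbr h₂ (rmk N (rbr hij x y) (rbr_mem hij x y)) z w =
        ∑ p ∈ Finset.HasAntidiagonal.antidiagonal w, ∑ q ∈ Finset.HasAntidiagonal.antidiagonal p.1,
          g.bracket ij l n h₂ (g.bracket i j ij hij (rc q.1 x) (rc q.2 y)) (rc p.2 z) := by
      refine Finset.sum_congr rfl fun p hp => ?_
      rw [key _ _ _ _ (by have := Finset.HasAntidiagonal.mem_antidiagonal.1 hp; omega),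
        rbr, map_sum,
        LinearMap.sum_apply]
    have e3 : rbr h₃ y (rmk N (rbr hil x z) (rbr_mem hil x z)) w =
        ∑ p ∈ Finset.HasAntidiagonal.antidiagonal w, ∑ q ∈ Finset.HasAntidiagonal.antidiagonal p.2,
          g.bracket j il n h₃ (rc p.1 y) (g.bracket i l il hil (rc q.1 x) (rc q.2 z)) := by
      refine Finset.sum_congr rfl fun p hp => ?_
      rw [key _ _ _ _ (by have := Finset.HasAntidiagonal.mem_antidiagonal.1 hp; omega),
        rbr, map_sum]
    rw [e1, e2, e3, sum_antidiagonal_left_comm fun b a c =>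
        g.bracket j il n h₃ (rc b y) (g.bracket i l il hil (rc a x) (rc c z)),
      ← sum_antidiagonal_assoc fun a b c =>
        g.bracket ij l n h₂ (g.bracket i j ij hij (rc a x) (rc b y)) (rc c z),
      Finset.smul_sum, ← Finset.sum_add_distrib]
    refine Finset.sum_congr rfl fun p _ => ?_
    rw [Finset.smul_sum, ← Finset.sum_add_distrib]
    exact Finset.sum_congr rfl fun q _ => g.jacobi i j l ij il jl n hij hil hjl h₁ h₂ h₃ _ _ _

theorem rc_bracket {N : ℕ} {g : GradedLie k} {i j n : ℕ} (h : i + j = n) (x : ReesCarrier N g i)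
    (y : ReesCarrier N g j) (w : ℕ) : rc w ((reesLie N g).bracket i j n h x y) =
      if w ≤ N then rbr h x y w else 0 := by
  change rc w (rmk N (rbr h x y) (rbr_mem h x y)) = _
  rw [rc_rmk]
  split_ifs with h1 h2 h2
  · rfl
  · omega
  · obtain rfl : w = 0 := by omega
    exact (rbr_zero h x y).symm
  · rfl

/-- Elements of the `r`-th term of the lower central series have weight greater than `r`, since all
weights are positive. -/
theorem reesLie_lcs (N : ℕ) (g : GradedLie k) (r n : ℕ) (x : (reesLie N g).carrier n)
    (hx : x ∈ (reesLie N g).lcs r n) (w : ℕ) (hw : w ≤ r) : rc w x = 0 := by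
  have key := GradedLie.lcs_le (reesLie N g)
    (fun r n => ⨅ w : Finset.range (r + 1), LinearMap.ker (rc (N := N) (g := g) (n := n) w)) ?_ ?_
      r n hx
  · rw [Submodule.mem_iInf] at key
    exact key ⟨w, Finset.mem_range.2 (by omega)⟩
  · refine fun n => eq_top_iff.2 fun x _ => (Submodule.mem_iInf _).2 fun w => ?_
    have : (w : ℕ) = 0 := by have := Finset.mem_range.1 w.2; omega
    rw [LinearMap.mem_ker, this, rc_zero]
  · intro r i j n h x y hy
    rw [Submodule.mem_iInf] at hy
    refine (Submodule.mem_iInf _).2 fun w => ?_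
    rw [LinearMap.mem_ker, rc_bracket]
    split_ifs
    · refine Finset.sum_eq_zero fun p hp => ?_
      have hp' := Finset.HasAntidiagonal.mem_antidiagonal.1 hp
      have hw := Finset.mem_range.1 w.2
      by_cases h1 : p.1 = 0
      · rw [h1, rc_zero, map_zero, LinearMap.zero_apply]
      · have h2 : rc p.2 y = 0 := hy ⟨p.2, Finset.mem_range.2 (by omega)⟩
        rw [h2, map_zero]
    · rfl

/-- The truncated Rees algebra is finite-dimensional and nilpotent. -/
abbrev rees (N : ℕ) (g : GrNilpLie k) : GrNilpLie k where
  toGradedLie := reesLie N g.toGradedLie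
  finite n := by
    have := g.finite n
    exact inferInstanceAs (Module.Finite k (ReesCarrier N g.toGradedLie n))
  bounded := by
    obtain ⟨M, hM⟩ := g.bounded
    exact ⟨M, fun n hn => by
      have := hM n hn
      exact inferInstanceAs (Subsingleton (ReesCarrier N g.toGradedLie n))⟩
  nilpotent := ⟨N, fun n => (Submodule.eq_bot_iff _).2 fun x hx => rees_ext fun w _ h => by
    rw [reesLie_lcs N _ N n x hx w h]
    exact (map_zero _).symm⟩

section maps

variable {g h : GrNilpLie k} {N M : ℕ}

theorem lcs_eq_bot_of_le {r s : ℕ} (hrs : r ≤ s) (hr : ∀ n, g.lcs r n = ⊥) (n : ℕ) :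
    g.lcs s n = ⊥ := by
  induction s, hrs using Nat.le_induction with
  | base => exact hr n
  | succ s _ ih => exact eq_bot_iff.2 ((g.lcs_antitone s n).trans ih.le)

theorem map_mem_lcs (f : g ⟶ h) (r n : ℕ) (x : g.carrier n) (hx : x ∈ g.lcs r n) :
    Hom.app f n x ∈ h.lcs r n := by
  refine GradedLie.lcs_le _ (fun r n => (h.lcs r n).comap (Hom.app f n)) ?_ ?_ r n hx
  · exact fun n => Submodule.comap_top _
  · intro r i j n e x y hy
    rw [Submodule.mem_comap, f.map_bracket]
    exact h.bracket_mem_lcs_succ e _ hy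

/-- Derivations preserve the lower central series. -/
theorem IsDer.mem_lcs {D : GLin g g} (hD : IsDer D) (r n : ℕ) (x : g.carrier n)
    (hx : x ∈ g.lcs r n) : D n x ∈ g.lcs r n := by
  have key := GradedLie.lcs_le g.toGradedLie (fun r n => (g.lcs r n) ⊓ (g.lcs r n).comap (D n))
    ?_ ?_ r n hx
  · exact key.2
  · exact fun n => eq_top_iff.2 fun x _ => ⟨trivial, trivial⟩
  · intro r i j n e x y hy
    refine ⟨g.bracket_mem_lcs_succ e _ hy.1, ?_⟩
    change D n _ ∈ g.lcs (r + 1) n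
    rw [hD]
    exact add_mem (g.bracket_mem_lcs_succ e _ hy.1) (g.bracket_mem_lcs_succ e _ hy.2)

/-- The truncation of polynomials. -/
def reesTrunc (g : GrNilpLie k) (hMN : M ≤ N) : rees N g ⟶ rees M g :=
  Hom.mk (fun _ => rlin M (fun w => rc w) fun w x => rc_mem w x) fun i j n e x y =>
    rees_ext fun w h1 h2 => by
      rw [rc_rlin, rc_bracket, rc_bracket, if_pos ⟨h1, h2⟩, if_pos h2, if_pos (h2.trans hMN)]
      refine Finset.sum_congr rfl fun p hp => ?_
      have hp' := Finset.HasAntidiagonal.mem_antidiagonal.1 hp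
      rw [rc_rlin, rc_rlin]
      split_ifs with h3 h4 h4
      · rfl
      · obtain h5 : p.2 = 0 := by omega
        rw [h5, rc_zero]
      · obtain h5 : p.1 = 0 := by omega
        rw [h5, rc_zero]
      · omega

theorem rc_trunc (hMN : M ≤ N) {n : ℕ} (x : (rees N g).carrier n) (w : ℕ) :
    rc w (Hom.app (reesTrunc g hMN) n x) = if 0 < w ∧ w ≤ M then rc w x else 0 := rc_rlin _ _ _ _

/-- The functoriality of the Rees algebra. -/
def reesMap (N : ℕ) (f : g ⟶ h) : rees N g ⟶ rees N h :=
  Hom.mk (fun n => rlin N (fun w => Hom.app f n ∘ₗ rc w)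
    fun w x => map_mem_lcs f w n _ (rc_mem w x)) fun i j n e x y =>
    rees_ext fun w h1 h2 => by
      rw [rc_rlin, rc_bracket, if_pos ⟨h1, h2⟩, if_pos h2, LinearMap.comp_apply, rc_bracket,
        if_pos h2, rbr, rbr, map_sum]
      refine Finset.sum_congr rfl fun p hp => ?_
      rw [f.map_bracket, rc_rlin, rc_rlin]
      split_ifs with h3 h4 h4
      · rfl
      · rw [rc_of_not h4, map_zero, map_zero, map_zero]
      · rw [rc_of_not h3, map_zero, map_zero, LinearMap.zero_apply, LinearMap.zero_apply]
      · rw [rc_of_not h3, map_zero, map_zero, LinearMap.zero_apply, LinearMap.zero_apply]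

/-- The linear map of Rees algebras induced by a linear map that preserves the lower central
series. -/
def reesDer (N : ℕ) {D : GLin g g} (hD : IsDer D) : GLin (rees N g) (rees N g) :=
  fun n => rlin N (fun w => D n ∘ₗ rc w) fun w x => hD.mem_lcs w n _ (rc_mem w x)

/-- The derivation `t d/dt` of the Rees algebra. -/
def reesT (N : ℕ) (g : GrNilpLie k) : GLin (rees N g) (rees N g) :=
  fun _ => rlin N (fun w => (w : k) • rc w) fun w x => Submodule.smul_mem _ _ (rc_mem w x)

theorem rc_reesDer {D : GLin g g} (hD : IsDer D) {n : ℕ} (x : (rees N g).carrier n) (w : ℕ) :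
    rc w (reesDer N hD n x) = D n (rc w x) := by
  rw [reesDer, rc_rlin]
  split_ifs with h
  · rfl
  · rw [rc_of_not h, map_zero]

theorem rc_reesT {n : ℕ} (x : (rees N g).carrier n) (w : ℕ) :
    rc w (reesT N g n x) = (w : k) • rc w x := by
  rw [reesT, rc_rlin]
  split_ifs with h
  · rfl
  · rw [rc_of_not h, smul_zero]

theorem isDer_reesDer {D : GLin g g} (hD : IsDer D) : IsDer (reesDer N hD) := by
  refine fun i j n e x y => rees_ext fun w h1 h2 => ?_
  rw [map_add, rc_reesDer, rc_bracket, rc_bracket, rc_bracket, if_pos h2, if_pos h2, if_pos h2,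
    rbr, rbr, rbr, map_sum, ← Finset.sum_add_distrib]
  refine Finset.sum_congr rfl fun p _ => ?_
  rw [hD, rc_reesDer, rc_reesDer]

theorem isDer_reesT (N : ℕ) (g : GrNilpLie k) : IsDer (reesT N g) := by
  refine fun i j n e x y => rees_ext fun w h1 h2 => ?_
  rw [map_add, rc_reesT, rc_bracket, rc_bracket, rc_bracket, if_pos h2, if_pos h2, if_pos h2,
    rbr, rbr, rbr, Finset.smul_sum, ← Finset.sum_add_distrib]
  refine Finset.sum_congr rfl fun p hp => ?_
  rw [rc_reesT, rc_reesT, ← Finset.HasAntidiagonal.mem_antidiagonal.1 hp, map_smul, map_smul,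
    LinearMap.smul_apply, Nat.cast_add, add_smul]

theorem reesDer_comm {D : GLin g g} (hD : IsDer D) (n : ℕ) (x : (rees N g).carrier n) :
    reesT N g n (reesDer N hD n x) = reesDer N hD n (reesT N g n x) :=
  rees_ext fun w _ _ => by
    rw [rc_reesT, rc_reesDer, rc_reesDer, rc_reesT, map_smul]

theorem trunc_reesT (hMN : M ≤ N) (n : ℕ) (x : (rees N g).carrier n) :
    Hom.app (reesTrunc g hMN) n (reesT N g n x) = reesT M g n (Hom.app (reesTrunc g hMN) n x) :=
  rees_ext fun w h1 h2 => by
    rw [rc_trunc, rc_reesT, rc_reesT, rc_trunc, if_pos ⟨h1, h2⟩, if_pos ⟨h1, h2⟩]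

theorem reesMap_reesT (f : g ⟶ h) (n : ℕ) (x : (rees N g).carrier n) :
    Hom.app (reesMap N f) n (reesT N g n x) = reesT N h n (Hom.app (reesMap N f) n x) :=
  rees_ext fun w h1 h2 => by
    change rc w (rlin _ _ _ _) = _
    rw [rc_rlin, rc_reesT, if_pos ⟨h1, h2⟩, LinearMap.comp_apply, rc_reesT, map_smul]
    change _ = _ • rc w (rlin _ _ _ _)
    rw [rc_rlin, if_pos ⟨h1, h2⟩]
    rfl

/-- The linear map `x ↦ x t`. -/
def reesIncl (N : ℕ) (g : GrNilpLie k) : GLin g (rees N g) :=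
  fun n => rlin N (fun w => if w = 1 then LinearMap.id else 0) fun w x => by
    by_cases hw : w = 0
    · subst hw
      exact trivial
    · simp [hw]

theorem rc_reesIncl {n : ℕ} (x : g.carrier n) (w : ℕ) :
    rc w (reesIncl N g n x) = if w = 1 ∧ w ≤ N then x else 0 := by
  rw [reesIncl, rc_rlin]
  by_cases h : w = 1
  · subst h
    simp
  · simp [h]

theorem reesT_reesIncl (n : ℕ) (x : g.carrier n) :
    reesT N g n (reesIncl N g n x) = reesIncl N g n x :=
  rees_ext fun w _ _ => by
    rw [rc_reesT, rc_reesIncl]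
    split_ifs with h
    · rw [h.1, Nat.cast_one, one_smul]
    · rw [smul_zero]

theorem reesDer_reesIncl {D : GLin g g} (hD : IsDer D) (n : ℕ) (x : g.carrier n) :
    reesDer N hD n (reesIncl N g n x) = reesIncl N g n (D n x) :=
  rees_ext fun w _ _ => by
    rw [rc_reesDer, rc_reesIncl, rc_reesIncl]
    split_ifs with h
    · rfl
    · rw [map_zero]

theorem trunc_reesIncl (hMN : M ≤ N) (n : ℕ) (x : g.carrier n) :
    Hom.app (reesTrunc g hMN) n (reesIncl N g n x) = reesIncl M g n x :=
  rees_ext fun w h1 h2 => by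
    rw [rc_trunc, rc_reesIncl, rc_reesIncl, if_pos ⟨h1, h2⟩]
    congr 1
    exact propext ⟨fun h => ⟨h.1, h2⟩, fun h => ⟨h.1, h2.trans hMN⟩⟩

theorem reesMap_reesIncl (f : g ⟶ h) (n : ℕ) (x : g.carrier n) :
    Hom.app (reesMap N f) n (reesIncl N g n x) = reesIncl N h n (Hom.app f n x) :=
  rees_ext fun w h1 h2 => by
    change rc w (rlin _ _ _ _) = _
    rw [rc_rlin, if_pos ⟨h1, h2⟩, LinearMap.comp_apply, rc_reesIncl, rc_reesIncl]
    split_ifs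
    · rfl
    · exact map_zero _

/-- The evaluation at `t = 1`, a morphism if `N` is at least the nilpotency class. -/
def reesEv (N : ℕ) (g : GrNilpLie k) (hN : ∀ n, g.lcs N n = ⊥) : rees N g ⟶ g :=
  Hom.mk (fun n => ∑ w ∈ Finset.range (N + 1), rc w) fun i j n e x y => by
    rw [LinearMap.sum_apply, LinearMap.sum_apply, LinearMap.sum_apply]
    simp only [map_sum, LinearMap.sum_apply]
    have h1 : ∀ w ∈ Finset.range (N + 1), rc w ((rees N g).bracket i j n e x y) =
        ∑ p ∈ Finset.HasAntidiagonal.antidiagonal w, g.bracket i j n e (rc p.1 x) (rc p.2 y) :=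
      fun w hw => by rw [rc_bracket, if_pos (by have := Finset.mem_range.1 hw; omega), rbr]
    rw [Finset.sum_congr rfl h1]
    refine Eq.trans ?_ Finset.sum_comm
    rw [← Finset.sum_product', Finset.sum_sigma']
    refine Finset.sum_bij_ne_zero (fun p _ _ => p.2) ?_ ?_ ?_ fun _ _ _ => rfl
    · rintro ⟨w, p⟩ hp _
      simp only [Finset.mem_sigma, Finset.mem_range, Finset.HasAntidiagonal.mem_antidiagonal] at hp
      simp only [Finset.mem_product, Finset.mem_range]
      omega
    · rintro ⟨w, p⟩ hp _ ⟨w', p'⟩ hp' _ h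
      simp only [Finset.mem_sigma, Finset.HasAntidiagonal.mem_antidiagonal] at hp hp'
      obtain rfl : p = p' := h
      obtain rfl : w = w' := hp.2.symm.trans hp'.2
      rfl
    · rintro ⟨a, b⟩ _ hab
      refine ⟨⟨a + b, (a, b)⟩, ?_, hab, rfl⟩
      simp only [Finset.mem_sigma, Finset.mem_range, Finset.HasAntidiagonal.mem_antidiagonal,
        and_true]
      by_contra h
      refine hab ?_
      have h2 := bracket_rc_mem e x y (a := a) (b := b) (w := a + b - 1) (by omega)
      rw [lcs_eq_bot_of_le (by omega) hN] at h2
      exact h2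

theorem reesEv_apply (hN : ∀ n, g.lcs N n = ⊥) (n : ℕ) (x : (rees N g).carrier n) :
    Hom.app (reesEv N g hN) n x = ∑ w ∈ Finset.range (N + 1), rc w x :=
  LinearMap.sum_apply _ _ _

theorem reesEv_reesIncl (hN : ∀ n, g.lcs N n = ⊥) (h0 : 0 < N) (n : ℕ) (x : g.carrier n) :
    Hom.app (reesEv N g hN) n (reesIncl N g n x) = x := by
  rw [reesEv_apply, Finset.sum_eq_single_of_mem 1 (by simp [h0]), rc_reesIncl, if_pos ⟨rfl, h0⟩]
  intro w _ hw
  rw [rc_reesIncl, if_neg fun h => hw h.1]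

theorem reesEv_reesMap (f : g ⟶ h) (hN : ∀ n, g.lcs N n = ⊥) (hN' : ∀ n, h.lcs N n = ⊥) (n : ℕ)
    (x : (rees N g).carrier n) : Hom.app (reesEv N h hN') n (Hom.app (reesMap N f) n x) =
      Hom.app f n (Hom.app (reesEv N g hN) n x) := by
  rw [reesEv_apply, reesEv_apply, map_sum]
  refine Finset.sum_congr rfl fun w _ => ?_
  change rc w (rlin _ _ _ _) = _
  rw [rc_rlin]
  split_ifs with h1
  · rfl
  · rw [rc_of_not h1, map_zero]

theorem reesEv_reesDer {D : GLin g g} (hD : IsDer D) (hN : ∀ n, g.lcs N n = ⊥) (n : ℕ)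
    (x : (rees N g).carrier n) : Hom.app (reesEv N g hN) n (reesDer N hD n x) =
      D n (Hom.app (reesEv N g hN) n x) := by
  rw [reesEv_apply, reesEv_apply, map_sum]
  exact Finset.sum_congr rfl fun w _ => rc_reesDer hD x w

theorem reesEv_trunc (hN : ∀ n, g.lcs N n = ⊥) (hN' : ∀ n, g.lcs (N + 1) n = ⊥) (n : ℕ)
    (x : (rees (N + 1) g).carrier n) :
    Hom.app (reesEv N g hN) n (Hom.app (reesTrunc g N.le_succ) n x) =
      Hom.app (reesEv (N + 1) g hN') n x := by
  have h0 : rc (N + 1) x = 0 := by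
    have := rc_mem N x
    rwa [hN] at this
  rw [reesEv_apply, reesEv_apply, Finset.sum_range_succ _ (N + 1), h0, add_zero]
  refine Finset.sum_congr rfl fun w hw => ?_
  have := Finset.mem_range.1 hw
  rw [rc_trunc]
  split_ifs with h1
  · rfl
  · rw [rc_of_not (by omega)]

/-- The projection to the part of top weight `N`. -/
def reesTop (N : ℕ) (g : GrNilpLie k) : GLin (rees N g) (rees N g) :=
  fun n => rlin N (fun w => if w = N then rc w else 0) fun w x => by
    by_cases hw : w + 1 = N
    · rw [if_pos hw]
      exact rc_mem w x
    · simp [hw]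

theorem rc_reesTop {n : ℕ} (x : (rees N g).carrier n) (w : ℕ) :
    rc w (reesTop N g n x) = if w = N then rc w x else 0 := by
  rw [reesTop, rc_rlin]
  by_cases h : w = N
  · subst h
    simp only [if_true]
    split_ifs with h1
    · rfl
    · rw [rc_of_not h1]
  · simp [h]

/-- The part of top weight is central. -/
theorem bracket_reesTop (i j n : ℕ) (e : i + j = n) (x : (rees N g).carrier i)
    (y : (rees N g).carrier j) : (rees N g).bracket i j n e (reesTop N g i x) y = 0 :=
  rees_ext fun w h1 h2 => by
    rw [rc_bracket, if_pos h2, map_zero]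
    refine Finset.sum_eq_zero fun p hp => ?_
    have := Finset.HasAntidiagonal.mem_antidiagonal.1 hp
    rw [rc_reesTop]
    split_ifs with h3
    · obtain h4 : p.2 = 0 := by omega
      rw [h4, rc_zero, map_zero]
    · rw [map_zero, LinearMap.zero_apply]

theorem reesT_reesTop (n : ℕ) (x : (rees N g).carrier n) :
    reesT N g n (reesTop N g n x) = (N : k) • reesTop N g n x :=
  rees_ext fun w _ _ => by
    rw [map_smul, rc_reesT, rc_reesTop]
    split_ifs with h
    · rw [h]
    · rw [smul_zero, smul_zero]

/-- The linear section of the truncation. -/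
def reesSec (N : ℕ) (g : GrNilpLie k) : GLin (rees N g) (rees (N + 1) g) :=
  fun _ => rlin (N + 1) (fun w => rc w) fun w x => rc_mem w x

theorem reesSec_decomp (n : ℕ) (x : (rees (N + 1) g).carrier n) :
    x = reesTop (N + 1) g n x + reesSec N g n (Hom.app (reesTrunc g N.le_succ) n x) :=
  rees_ext fun w h1 h2 => by
    rw [map_add, rc_reesTop, reesSec, rc_rlin, if_pos (And.intro h1 h2), rc_trunc]
    split_ifs with h3 h4 h4
    · omega
    · rw [add_zero]
    · rw [zero_add]
    · omega

theorem trunc_reesSec (n : ℕ) (x : (rees N g).carrier n) :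
    Hom.app (reesTrunc g N.le_succ) n (reesSec N g n x) = x :=
  rees_ext fun w h1 h2 => by
    rw [rc_trunc, if_pos ⟨h1, h2⟩, reesSec, rc_rlin, if_pos ⟨h1, by omega⟩]

theorem surj_trunc : Surj (reesTrunc g N.le_succ) := fun n x => ⟨_, trunc_reesSec n x⟩

theorem surj_reesEv (hN : ∀ n, g.lcs N n = ⊥) (h0 : 0 < N) : Surj (reesEv N g hN) :=
  fun n x => ⟨_, reesEv_reesIncl hN h0 n x⟩

end maps

end GrNilpLie

/-! ### Logarithmic derivatives along `t d/dt` -/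

namespace GrNilpLie

variable {k : Type u} [Field k] {G : GrNilpLie k ⥤ GrpCat.{w}}

theorem trunc_trunc {g : GrNilpLie k} {L M N : ℕ} (h : L ≤ M) (h' : M ≤ N) (n : ℕ)
    (x : (rees N g).carrier n) : Hom.app (reesTrunc g h) n (Hom.app (reesTrunc g h') n x) =
      Hom.app (reesTrunc g (h.trans h')) n x :=
  rees_ext fun w h1 h2 => by
    rw [rc_trunc, rc_trunc, rc_trunc, if_pos ⟨h1, h2⟩, if_pos ⟨h1, h2.trans h⟩, if_pos ⟨h1, h2⟩]

theorem trunc_self {g : GrNilpLie k} {N : ℕ} (h : N ≤ N) (n : ℕ)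
    (x : (rees N g).carrier n) : Hom.app (reesTrunc g h) n x = x :=
  rees_ext fun w h1 h2 => by rw [rc_trunc, if_pos ⟨h1, h2⟩]

theorem reesTop_reesTop {g : GrNilpLie k} {N n : ℕ} (x : (rees N g).carrier n) :
    reesTop N g n (reesTop N g n x) = reesTop N g n x :=
  rees_ext fun w _ _ => by
    rw [rc_reesTop, rc_reesTop]
    split_ifs <;> rfl

theorem trunc_reesTop {g : GrNilpLie k} {N n : ℕ} (x : (rees (N + 1) g).carrier n) :
    Hom.app (reesTrunc g N.le_succ) n (reesTop (N + 1) g n x) = 0 :=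
  rees_ext fun w h1 h2 => by
    rw [rc_trunc, if_pos ⟨h1, h2⟩, rc_reesTop, if_neg (by omega), map_zero]

theorem subsingleton_rees_zero (g : GrNilpLie k) (n : ℕ) : Subsingleton ((rees 0 g).carrier n) :=
  ⟨fun _ _ => rees_ext fun _ h h' => absurd h' (by omega)⟩

namespace LieT

variable [IsReduced G] [IsHomogeneous G] {g h : GrNilpLie k} {N : ℕ}

theorem lin_trunc_trunc {L M N : ℕ} (h : L ≤ M) (h' : M ≤ N) (V : LieT G (rees N g)) :
    map (lin (reesTrunc g h)) (map (lin (reesTrunc g h')) V) =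
      map (lin (reesTrunc g (h.trans h'))) V :=
  map_eq_of (fun n x => trunc_trunc h h' n x) V

theorem map_reesTop_of_trunc (V : LieT G (rees (N + 1) g))
    (hV : map (lin (reesTrunc g N.le_succ)) V = 0) : map (reesTop (N + 1) g) V = V := by
  have key : V = map (reesTop (N + 1) g) V +
      map (reesSec N g) (map (lin (reesTrunc g N.le_succ)) V) := by
    rw [map_map', ← map_add_lin]
    nth_rewrite 1 [← map_id V]
    exact map_congr (fun n x => reesSec_decomp n x) V
  rw [hV, map_zero, add_zero] at key
  exact key.symm

theorem br_reesTop (V W : LieT G (rees N g)) : br (map (reesTop N g) V) W = 0 := by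
  rw [← map_id W]
  exact br_map_map_eq_zero _ _ (fun i j n e x y => bracket_reesTop i j n e x y) V W

theorem br_reesTop' (V W : LieT G (rees N g)) : br W (map (reesTop N g) V) = 0 := by
  rw [br_skew, br_reesTop, neg_zero]

theorem map_reesT_reesTop (V : LieT G (rees N g)) :
    map (reesT N g) (map (reesTop N g) V) = (N : k) • map (reesTop N g) V := by
  rw [← map_smul_lin]
  exact map_eq_of (fun n x => reesT_reesTop n x) V

theorem map_trunc_reesT {M N : ℕ} (h : M ≤ N) (V : LieT G (rees N g)) :
    map (lin (reesTrunc g h)) (map (reesT N g) V) =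
      map (reesT M g) (map (lin (reesTrunc g h)) V) := by
  rw [map_map', map_map']
  exact map_congr (fun n x => trunc_reesT h n x) V

/-- The equation `t dV/dt = c V + [ω, V]` has no solution `V ≠ 0` of order greater than `c`
in `t`. -/
theorem eq_zero_of_map_reesT [CharZero k] {c N : ℕ} (hcN : c ≤ N) (V ω : LieT G (rees N g))
    (hT : map (reesT N g) V = (c : k) • V + br ω V)
    (h0 : map (lin (reesTrunc g hcN)) V = 0) : V = 0 := by
  -- By induction, `V` has top weight `N + 1`; then `[ω, V] = 0` and `(N + 1) V = c V`.
  induction N, hcN using Nat.le_induction with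
  | base =>
    rw [← h0]
    nth_rewrite 1 [← map_id V]
    exact map_congr (fun n x => (trunc_self _ n x).symm) V
  | succ N hcN ih =>
    have h1 := ih (map (lin (reesTrunc g N.le_succ)) V)
      (map (lin (reesTrunc g N.le_succ)) ω) ?_ ?_
    · have h2 := map_reesTop_of_trunc V h1
      rw [← h2, br_reesTop', add_zero, map_reesT_reesTop, h2, ← sub_eq_zero, ← sub_smul] at hT
      refine (smul_eq_zero.1 hT).resolve_left ?_
      rw [sub_eq_zero]
      exact fun h => absurd (Nat.cast_injective h) (by omega)
    · have := congrArg (map (lin (reesTrunc g N.le_succ))) hT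
      rw [map_add, map_smul, map_br, map_trunc_reesT] at this
      exact this
    · rw [lin_trunc_trunc]
      exact h0

/-- The central subgroup of `G(rees N g)` given by the part of top weight. -/
def reesTopHom (N : ℕ) (g : GrNilpLie k) : ab (rees N g) ⟶ rees N g :=
  abHom (reesTop N g) fun i j n e x _ => bracket_reesTop i j n e x _

theorem Ad_reesTopHom (ζ Y : LieT G (rees N g)) : Ad (push (reesTopHom N g) ζ) Y = Y := by
  rw [← map_id Y]
  exact Ad_push_map _ _ _ (fun i j n e x y => bracket_reesTop i j n e x _) ζ Y

theorem dlog_reesTopHom (ζ : LieT G (rees N g)) :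
    dlog (isDer_reesT N g) (push (reesTopHom N g) ζ) = (N : k) • map (reesTop N g) ζ := by
  rw [← map_reesT_reesTop]
  exact dlog_push _ _ _ (fun i j n e x y => bracket_reesTop i j n e x _) ζ

/-- The kernel of `G(rees (N + 1) g) → G(rees N g)` comes from the part of top weight. -/
theorem exists_push_reesTopHom (u : G.obj (rees (N + 1) g))
    (hu : G.map (reesTrunc g N.le_succ) u = 1) :
    ∃ ζ : LieT G (rees (N + 1) g), push (reesTopHom (N + 1) g) ζ = u := by
  let S : ∀ n, Submodule k ((rees (N + 1) g).carrier n) :=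
    fun n => LinearMap.ker (Hom.app (reesTrunc g N.le_succ) n)
  have hS : ∀ n (x : S n), reesTop (N + 1) g n x.1 = x.1 := fun n x => by
    have := reesSec_decomp n x.1
    rw [LinearMap.mem_ker.1 x.2, map_zero, add_zero] at this
    exact this.symm
  let s : abSub (rees (N + 1) g) S ⟶ ab (rees (N + 1) g) :=
    Hom.mk (fun n => (S n).subtype) fun _ _ _ _ _ _ => map_zero _
  obtain ⟨c, hc, -⟩ := existsUnique_of_map_eq_one G (s ≫ reesTopHom (N + 1) g)
    (reesTrunc g N.le_succ) surj_trunc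
    (fun n x y hxy => Subtype.ext (((hS n x).symm.trans hxy).trans (hS n y)))
    (fun n z => trunc_reesTop _) (fun n x hx => ⟨⟨x, hx⟩, hS n ⟨x, hx⟩⟩) u hu
  exact ⟨G.map s c, (map_map G _ _ _).trans hc⟩

/-- An element of `G(rees N g)` is determined by its logarithmic derivative along `t d/dt`,
since `rees N g` has no part of weight zero. -/
theorem dlog_reesT_injective [CharZero k] (N : ℕ) (g : GrNilpLie k) :
    Function.Injective (dlog (G := G) (isDer_reesT N g)) := by
  induction N with
  | zero =>
    have := IsReduced.subsingleton (G := G) (rees 0 g) (subsingleton_rees_zero g)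
    exact Function.injective_of_subsingleton _
  | succ N ih =>
    intro u v huv
    have h1 : G.map (reesTrunc g N.le_succ) u = G.map (reesTrunc g N.le_succ) v := by
      apply ih
      rw [map_dlog _ (isDer_reesT (N + 1) g) _ (fun n x => trunc_reesT _ n x),
        map_dlog _ (isDer_reesT (N + 1) g) _ (fun n x => trunc_reesT _ n x), huv]
    obtain ⟨ζ, hζ⟩ := exists_push_reesTopHom (u * v⁻¹) (by
      rw [map_mul, map_inv, h1, mul_inv_cancel])
    obtain rfl : u = push (reesTopHom (N + 1) g) ζ * v := by rw [hζ, inv_mul_cancel_right]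
    rw [dlog_mul, Ad_reesTopHom, dlog_reesTopHom, add_eq_right, smul_eq_zero] at huv
    have h2 := huv.resolve_left (Nat.cast_ne_zero.2 N.succ_ne_zero)
    have h3 : push (reesTopHom (N + 1) g) ζ =
        push (reesTopHom (N + 1) g) (map (reesTop _ g) ζ) := by
      rw [push_map]
      exact push_congr (fun n x => (reesTop_reesTop x).symm) ζ
    rw [h3, h2, push_zero, one_mul]

/-- Every element of `L(rees N g)` is a logarithmic derivative along `t d/dt`. -/
theorem dlog_reesT_surjective [CharZero k] (hG : IsSmooth G) (N : ℕ) (g : GrNilpLie k) :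
    Function.Surjective (dlog (G := G) (isDer_reesT N g)) := by
  induction N with
  | zero =>
    intro V
    refine ⟨1, ?_⟩
    have := IsReduced.subsingleton (G := G) (ab (rees 0 g)) (subsingleton_rees_zero g)
    exact @Subsingleton.elim (G.obj (ab (rees 0 g))) this _ _
  | succ N ih =>
    intro V
    obtain ⟨u, hu⟩ := ih (map (lin (reesTrunc g N.le_succ)) V)
    obtain ⟨u, rfl⟩ := hG _ surj_trunc u
    rw [map_dlog _ (isDer_reesT (N + 1) g) _ (fun n x => trunc_reesT _ n x)] at hu
    have h1 := map_reesTop_of_trunc (V - dlog (isDer_reesT (N + 1) g) u) (by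
      rw [map_sub, hu, sub_self])
    refine ⟨push (reesTopHom (N + 1) g) ((((N + 1 : ℕ) : k)⁻¹) •
      (V - dlog (isDer_reesT (N + 1) g) u)) * u, ?_⟩
    rw [dlog_mul, Ad_reesTopHom, dlog_reesTopHom, map_smul, h1, smul_smul,
      mul_inv_cancel₀ (Nat.cast_ne_zero.2 N.succ_ne_zero), one_smul, sub_add_cancel]

end LieT

end GrNilpLie

/-! ### Power series at nilpotent elements -/

section NilEval

open PowerSeries

variable {k : Type*} [Field k]

/-- Truncation at the order of nilpotency does not change the value of a polynomial. -/
theorem aeval_trunc_of_pow_eq_zero {A : Type*} [Ring A] [Algebra k A] {a : A} {R : ℕ}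
    (ha : a ^ R = 0) (P : Polynomial k) :
    Polynomial.aeval a ((P : k⟦X⟧).trunc R) = Polynomial.aeval a P := by
  have h1 : ((P : k⟦X⟧).trunc R).natDegree < max R (P.natDegree + 1) + 1 := by
    have := natDegree_trunc_lt (P : k⟦X⟧) (R - 1)
    rcases R with _ | R
    · simp
    · simp only [Nat.add_sub_cancel] at this
      omega
  rw [Polynomial.aeval_eq_sum_range' h1,
    Polynomial.aeval_eq_sum_range' (n := max R (P.natDegree + 1) + 1) (by omega)]
  refine Finset.sum_congr rfl fun i _ => ?_
  rw [coeff_trunc]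
  split_ifs with h
  · rw [Polynomial.coeff_coe]
  · rw [pow_eq_zero_of_le (by omega) ha, smul_zero, smul_zero]

/-- The evaluation of power series at a nilpotent element of an algebra. -/
noncomputable def nilEval {A : Type*} [Ring A] [Algebra k A] (a : A) {R : ℕ} (ha : a ^ R = 0) :
    k⟦X⟧ →ₐ[k] A :=
  AlgHom.ofLinearMap ((Polynomial.aeval a).toLinearMap ∘ₗ
    { toFun := fun p => p.trunc R
      map_add' := fun p q => by
        ext i
        rw [coeff_trunc, Polynomial.coeff_add, coeff_trunc, coeff_trunc]
        split_ifs <;> simp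
      map_smul' := fun c p => by
        ext i
        rw [coeff_trunc, RingHom.id_apply, Polynomial.coeff_smul, coeff_trunc]
        split_ifs <;> simp })
    (by
      change Polynomial.aeval a (trunc R (1 : k⟦X⟧)) = 1
      rw [← Polynomial.coe_one, aeval_trunc_of_pow_eq_zero ha, map_one])
    (by
      intro p q
      change Polynomial.aeval a (trunc R (p * q)) =
        Polynomial.aeval a (trunc R p) * Polynomial.aeval a (trunc R q)
      rw [← trunc_trunc_mul_trunc, ← Polynomial.coe_mul, aeval_trunc_of_pow_eq_zero ha, map_mul])

theorem nilEval_apply {A : Type*} [Ring A] [Algebra k A] {a : A} {R : ℕ} (ha : a ^ R = 0)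
    (p : k⟦X⟧) : nilEval a ha p = ∑ i ∈ Finset.range R, coeff i p • a ^ i := by
  change Polynomial.aeval a (trunc R p) = _
  rcases R with _ | R
  · simp
  rw [Polynomial.aeval_eq_sum_range' (natDegree_trunc_lt p R)]
  refine Finset.sum_congr rfl fun i hi => ?_
  rw [coeff_trunc, if_pos (Finset.mem_range.1 hi)]

theorem nilEval_eq_zero {A : Type*} [Ring A] [Algebra k A] {a : A} {R : ℕ} (ha : a ^ R = 0)
    {p : k⟦X⟧} (hp : (X : k⟦X⟧) ^ R ∣ p) : nilEval a ha p = 0 := by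
  rw [nilEval_apply]
  refine Finset.sum_eq_zero fun i hi => ?_
  rw [X_pow_dvd_iff.1 hp i (Finset.mem_range.1 hi), zero_smul]

variable [CharZero k]

theorem coeff_exp' (n : ℕ) : coeff n (exp k) = (n.factorial : k)⁻¹ := by
  rw [coeff_exp]
  simp

variable (k) in
/-- The power series `(e^z - 1) / z`. -/
noncomputable def expDiv : k⟦X⟧ := mk fun n => ((n + 1).factorial : k)⁻¹

theorem X_mul_expDiv : X * expDiv k = exp k - 1 := by
  ext n
  rcases n with _ | n
  · simp
  · rw [coeff_succ_X_mul, map_sub, coeff_exp', coeff_one, if_neg n.succ_ne_zero, sub_zero, expDiv,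
      coeff_mk]

variable (k) in
/-- The power series `∑ (-1)^m / (m + 1) (e^z - 1)^m`, which is `z / (e^z - 1)`, up to the terms of
order `R`. -/
noncomputable def logDiv (R : ℕ) : k⟦X⟧ :=
  ∑ m ∈ Finset.range R, ((-1) ^ m / (m + 1) : k) • (exp k - 1) ^ m

/-- Up to terms of order `R`, `logDiv` is the inverse of `(e^z - 1) / z`. This is the expansion of
`log (e^z) = z`, obtained by comparing derivatives. -/
theorem X_pow_dvd_logDiv (R : ℕ) : (X : k⟦X⟧) ^ R ∣ logDiv k R * expDiv k - 1 := by
  set e := exp k - 1 with he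
  have hX : (X : k⟦X⟧) ∣ e := ⟨_, X_mul_expDiv.symm⟩
  have hd : derivative k e = e + 1 := by
    rw [he, map_sub, derivative_exp, Derivation.map_one_eq_zero, sub_zero, sub_add_cancel]
  set F : k⟦X⟧ := ∑ m ∈ Finset.range R, ((-1) ^ m / (m + 1) : k) • e ^ (m + 1) with hF
  -- The geometric series: `dF/dz = e^z ∑ (-1)^m (e^z - 1)^m`.
  have hF' : derivative k F = 1 - (-e) ^ R := by
    have h := geom_sum_mul_neg (-e) R
    rw [← h, hF, map_sum, Finset.sum_mul]
    refine Finset.sum_congr rfl fun m _ => ?_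
    have hm : (m + 1 : k) ≠ 0 := by exact_mod_cast m.succ_ne_zero
    rw [Derivation.map_smul, Derivation.leibniz_pow, hd, Nat.add_sub_cancel,
      ← Nat.cast_smul_eq_nsmul k,
      smul_smul, Nat.cast_succ, div_mul_cancel₀ _ hm, neg_pow e m, smul_eq_mul,
      Algebra.smul_def, map_pow, map_neg, map_one]
    ring
  have h1 : (X : k⟦X⟧) ^ (R + 1) ∣ F - X := by
    rw [X_pow_dvd_iff]
    intro n hn
    rcases n with _ | n
    · have : (X : k⟦X⟧) ∣ F :=
        Finset.dvd_sum fun m _ => dvd_smul_of_dvd _ (hX.trans (dvd_pow_self e m.succ_ne_zero))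
      simpa [X_dvd_iff] using this
    · have h2 : coeff n (derivative k F) = coeff n (1 : k⟦X⟧) := by
        rw [hF', map_sub, X_pow_dvd_iff.1 (pow_dvd_pow_of_dvd ((dvd_neg).2 hX) R) n (by omega),
          sub_zero]
      rw [coeff_derivative, coeff_one] at h2
      rw [map_sub, coeff_X]
      have hn : (n + 1 : k) ≠ 0 := by exact_mod_cast n.succ_ne_zero
      by_cases h0 : n = 0
      · subst h0
        simpa [sub_eq_zero] using h2
      · rw [if_neg h0] at h2
        rw [if_neg (by omega), sub_zero]
        exact (mul_eq_zero.1 h2).resolve_right hn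
  have h2 : F - X = X * (logDiv k R * expDiv k - 1) := by
    have : F = logDiv k R * e := by
      rw [hF, logDiv, Finset.sum_mul]
      exact Finset.sum_congr rfl fun m _ => by rw [pow_succ, smul_mul_assoc]
    rw [this, he, ← X_mul_expDiv]
    ring
  rw [h2, pow_succ'] at h1
  exact (mul_dvd_mul_iff_left X_ne_zero).1 h1

theorem nilEval_logDiv {A : Type*} [Ring A] [Algebra k A] {a : A} {R : ℕ} (ha : a ^ R = 0) :
    nilEval a ha (logDiv k R) =
      ∑ m ∈ Finset.range R, ((-1) ^ m / (m + 1) : k) • (nilEval a ha (exp k) - 1) ^ m := by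
  rw [logDiv, map_sum]
  simp only [map_smul, map_pow, map_sub, map_one]

theorem nilEval_logDiv_mul {A : Type*} [Ring A] [Algebra k A] {a : A} {R : ℕ} (ha : a ^ R = 0) :
    nilEval a ha (logDiv k R) * nilEval a ha (expDiv k) = 1 := by
  rw [← map_mul, ← sub_eq_zero, ← map_one (nilEval (k := k) a ha), ← map_sub]
  exact nilEval_eq_zero ha (X_pow_dvd_logDiv R)

end NilEval

/-! ### The Baker–Campbell–Hausdorff product in a nilpotent Lie algebra -/

section BCH

variable {k : Type*} [Field k] {L L' : Type*} [LieRing L] [LieAlgebra k L] [LieRing L']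
  [LieAlgebra k L']

variable (L) in
/-- All iterated brackets of at least `R` elements vanish. -/
def NilBound (R : ℕ) : Prop := ∀ l : List L, R ≤ l.length → nestedBracket l = 0

theorem NilBound.mono {R S : ℕ} (h : NilBound L R) (hRS : R ≤ S) : NilBound L S :=
  fun l hl => h l (hRS.trans hl)

theorem nestedBracket_cons (x : L) {l : List L} (hl : l ≠ []) :
    nestedBracket (x :: l) = ⁅x, nestedBracket l⁆ := by
  rcases l with _ | ⟨y, l⟩
  · exact absurd rfl hl
  · rfl

theorem nestedBracket_replicate (r : ℕ) (x : L) {l : List L} (hl : l ≠ []) :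
    nestedBracket (List.replicate r x ++ l) = (LieAlgebra.ad k L x ^ r) (nestedBracket l) := by
  induction r with
  | zero => rfl
  | succ r ih =>
    rw [List.replicate_succ, List.cons_append, nestedBracket_cons _ (by simp [hl]), ih, pow_succ']
    rfl

theorem NilBound.ad_pow {R : ℕ} (h : NilBound L R) (x : L) : LieAlgebra.ad k L x ^ R = 0 := by
  ext y
  have := h (List.replicate R x ++ [y]) (by simp)
  rwa [nestedBracket_replicate (k := k) R x (by simp)] at this

theorem map_nestedBracket {F : L →ₗ[k] L'} (hF : ∀ x y, F ⁅x, y⁆ = ⁅F x, F y⁆) (l : List L) :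
    F (nestedBracket l) = nestedBracket (l.map F) := by
  induction l with
  | nil => exact map_zero F
  | cons x l ih =>
    rcases l with _ | ⟨y, l⟩
    · rfl
    · rw [nestedBracket_cons x (List.cons_ne_nil y l), hF, ih]
      rfl

theorem map_dynkinWord (F : L → L') (p : List (ℕ × ℕ)) (x y : L) :
    (dynkinWord p x y).map F = dynkinWord p (F x) (F y) := by
  simp [dynkinWord, List.map_flatMap]

theorem length_dynkinWord (p : List (ℕ × ℕ)) (x y : L) :
    (dynkinWord p x y).length = (p.map fun q => q.1 + q.2).sum := by
  simp [dynkinWord, List.length_flatMap]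

theorem le_sum_of_mem {p : List (ℕ × ℕ)} {q : ℕ × ℕ} (hq : q ∈ p) :
    q.1 + q.2 ≤ (p.map fun q => q.1 + q.2).sum :=
  List.single_le_sum (fun _ _ => Nat.zero_le _) _ (List.mem_map_of_mem hq)

theorem length_le_sum {p : List (ℕ × ℕ)} (hp : ∀ q ∈ p, q ≠ (0, 0)) :
    p.length ≤ (p.map fun q => q.1 + q.2).sum := by
  induction p with
  | nil => exact le_rfl
  | cons q p ih =>
    have h1 := ih fun q hq => hp q (List.mem_cons_of_mem _ hq)
    have h2 : q.1 + q.2 ≠ 0 := fun h => hp q List.mem_cons_self (Prod.ext (by omega) (by omega))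
    rw [List.length_cons, List.map_cons, List.sum_cons]
    omega

/-- The pairs of exponents that are relevant if iterated brackets of `R` elements vanish. -/
def dynkinPairs (R : ℕ) : Finset (ℕ × ℕ) := (Finset.range R ×ˢ Finset.range R).erase (0, 0)

/-- The lists of `m` elements of a finite set. -/
def listsOf (B : Finset (ℕ × ℕ)) : ℕ → Finset (List (ℕ × ℕ))
  | 0 => {[]}
  | m + 1 => (B ×ˢ listsOf B m).map ⟨fun q => q.1 :: q.2, fun q q' h => by
      simpa [Prod.ext_iff] using h⟩

theorem mem_listsOf (B : Finset (ℕ × ℕ)) (m : ℕ) (p : List (ℕ × ℕ)) :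
    p ∈ listsOf B m ↔ p.length = m ∧ ∀ q ∈ p, q ∈ B := by
  induction m generalizing p with
  | zero =>
    rw [listsOf, Finset.mem_singleton, List.length_eq_zero_iff]
    constructor
    · rintro rfl
      simp
    · exact fun h => h.1
  | succ m ih =>
    rw [listsOf, Finset.mem_map]
    constructor
    · rintro ⟨⟨q, p⟩, h, rfl⟩
      rw [Finset.mem_product, ih] at h
      exact ⟨congrArg Nat.succ h.2.1, fun q' hq' => (List.mem_cons.1 hq').elim
        (fun e => e ▸ h.1) (h.2.2 q')⟩
    · rcases p with _ | ⟨q, p⟩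
      · simp
      · rintro ⟨h1, h2⟩
        refine ⟨⟨q, p⟩, Finset.mem_product.2 ⟨h2 q List.mem_cons_self, (ih p).2 ⟨by simpa using h1,
          fun q' hq' => h2 q' (List.mem_cons_of_mem _ hq')⟩⟩, rfl⟩

theorem sum_listsOf_succ {M : Type*} [AddCommMonoid M] (B : Finset (ℕ × ℕ)) (m : ℕ)
    (f : List (ℕ × ℕ) → M) :
    ∑ p ∈ listsOf B (m + 1), f p = ∑ q ∈ B, ∑ p ∈ listsOf B m, f (q :: p) := by
  rw [listsOf, Finset.sum_map, Finset.sum_product]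
  rfl

variable [CharZero k]

/-- Dynkin's formula as a finite sum. -/
theorem bch_eq_sum {R : ℕ} (h : NilBound L R) (x y : L) : bch k x y =
    ∑ m ∈ Finset.range R, ∑ p ∈ listsOf (dynkinPairs R) (m + 1),
      (dynkinCoeff p : k) • nestedBracket (dynkinWord p x y) := by
  classical
  rw [← Finset.sum_biUnion]
  · refine finsum_mem_eq_sum_of_inter_support_eq (s := {p | ∀ q ∈ p, q ≠ (0, 0)}) _ ?_
    ext p
    simp only [Set.mem_inter_iff, Set.mem_ofPred_eq, Finset.coe_biUnion, Set.mem_iUnion,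
      Finset.mem_coe, mem_listsOf, Finset.mem_range, exists_prop, Function.mem_support]
    refine and_congr_left fun hp => ⟨fun hq => ?_, ?_⟩
    · have h1 : (p.map fun q => q.1 + q.2).sum < R := by
        rw [← length_dynkinWord p x y]
        by_contra hlt
        exact hp (by rw [h _ (by omega), smul_zero])
      have h2 := length_le_sum hq
      have h3 : p.length ≠ 0 := fun h0 => hp (by
        rw [List.length_eq_zero_iff] at h0
        subst h0
        exact smul_zero _)
      refine ⟨p.length - 1, by omega, by omega, fun q hqp => ?_⟩
      have h4 := le_sum_of_mem hqp
      simp only [dynkinPairs, Finset.mem_erase, Finset.mem_product, Finset.mem_range]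
      exact ⟨hq q hqp, by omega, by omega⟩
    · rintro ⟨m, -, -, hq⟩ q hqp
      exact (Finset.mem_erase.1 (hq q hqp)).1
  · intro m _ m' _ hm
    refine Finset.disjoint_left.2 fun p hp hp' => hm ?_
    have h1 := ((mem_listsOf _ _ _).1 hp).1
    have h2 := ((mem_listsOf _ _ _).1 hp').1
    omega

theorem map_bch {R : ℕ} (h : NilBound L R) (h' : NilBound L' R) {F : L →ₗ[k] L'}
    (hF : ∀ x y, F ⁅x, y⁆ = ⁅F x, F y⁆) (x y : L) : F (bch k x y) = bch k (F x) (F y) := by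
  rw [bch_eq_sum h, bch_eq_sum h', map_sum]
  refine Finset.sum_congr rfl fun m _ => ?_
  rw [map_sum]
  refine Finset.sum_congr rfl fun p _ => ?_
  rw [map_smul, map_nestedBracket hF, map_dynkinWord]

/-- The factor of `dynkinCoeff p` given by a pair in `p`. -/
def pairCoeff (q : ℕ × ℕ) : ℚ := 1 / (q.1.factorial * q.2.factorial)

/-- The sum over one pair of exponents is `e^a e^b - 1`. -/
theorem sum_pairCoeff {R : ℕ} (hR : 0 < R) {A : Type*} [Ring A] [Algebra k A] {a b : A}
    (ha : a ^ R = 0) (hb : b ^ R = 0) :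
    ∑ q ∈ dynkinPairs R, (pairCoeff q : k) • (a ^ q.1 * b ^ q.2) =
      nilEval a ha (PowerSeries.exp k) * nilEval b hb (PowerSeries.exp k) - 1 := by
  rw [eq_sub_iff_add_eq, nilEval_apply, nilEval_apply, Finset.sum_mul_sum, ← Finset.sum_product',
    dynkinPairs, ← Finset.sum_erase_add (Finset.range R ×ˢ Finset.range R) _
      (a := (0, 0)) (by simp [hR])]
  congr 1
  · refine Finset.sum_congr rfl fun q _ => ?_
    rw [coeff_exp', coeff_exp', smul_mul_smul_comm, pairCoeff]
    congr 1
    push_cast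
    rw [one_div, mul_inv]
  · simp

theorem nestedBracket_dynkinWord_cons (q : ℕ × ℕ) (p : List (ℕ × ℕ)) (x y : L)
    (hp : dynkinWord p x y ≠ []) : nestedBracket (dynkinWord (q :: p) x y) =
      (LieAlgebra.ad k L x ^ q.1 * LieAlgebra.ad k L y ^ q.2)
        (nestedBracket (dynkinWord p x y)) := by
  have : dynkinWord (q :: p) x y =
      List.replicate q.1 x ++ (List.replicate q.2 y ++ dynkinWord p x y) := by
    simp [dynkinWord]
  rw [this, nestedBracket_replicate (k := k) _ _ (by simp [hp]),
    nestedBracket_replicate (k := k) _ _ hp, Module.End.mul_apply]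

/-- Since `[y, y] = 0` and `[x, x] = 0`, few words with a single pair of exponents contribute. -/
theorem nestedBracket_singleton_pair (r s : ℕ) (x y : L) :
    nestedBracket (dynkinWord [(r, s)] x y) =
      if s = 0 then (if r = 1 then x else 0) else
        if s = 1 then (LieAlgebra.ad k L x ^ r) y else 0 := by
  have e : dynkinWord [(r, s)] x y = List.replicate r x ++ List.replicate s y := by
    simp [dynkinWord]
  have hrep : ∀ (r : ℕ) (x : L), nestedBracket (List.replicate (r + 2) x) = 0 := by
    intro r x
    rw [show r + 2 = r + (1 + 1) by rfl, List.replicate_add,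
      nestedBracket_replicate (k := k) _ _ (by simp)]
    simp [nestedBracket]
  rw [e]
  rcases s with _ | _ | s
  · rcases r with _ | _ | r
    · simp [nestedBracket]
    · simp [nestedBracket]
    · simpa using hrep r x
  · rw [nestedBracket_replicate (k := k) _ _ (by simp)]
    simp [nestedBracket]
  · rw [nestedBracket_replicate (k := k) _ _ (by simp), hrep]
    simp

/-- The sum over words with a single pair of exponents is `x + e^{ad x} y`, the logarithmic
derivative of `e^{tx} e^{ty}`. -/
theorem sum_pairCoeff_nestedBracket {R : ℕ} (hR : 2 ≤ R) (h : NilBound L R) (x y : L) :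
    ∑ q ∈ dynkinPairs R, (pairCoeff q : k) • nestedBracket (dynkinWord [q] x y) =
      x + nilEval _ (h.ad_pow (k := k) x) (PowerSeries.exp k) y := by
  rw [dynkinPairs, Finset.sum_erase _ (by simp [dynkinWord, nestedBracket]), Finset.sum_product,
    nilEval_apply, LinearMap.sum_apply]
  have key : ∀ r ∈ Finset.range R, ∑ s ∈ Finset.range R,
      (pairCoeff (r, s) : k) • nestedBracket (dynkinWord [(r, s)] x y) =
        (if r = 1 then x else 0) +
          (PowerSeries.coeff r (PowerSeries.exp k) • LieAlgebra.ad k L x ^ r) y := by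
    intro r _
    obtain ⟨S, rfl⟩ : ∃ S, R = S + 2 := ⟨R - 2, by omega⟩
    rw [Finset.sum_range_succ', Finset.sum_range_succ', Finset.sum_eq_zero]
    · rw [zero_add, add_comm]
      congr 1
      · rw [nestedBracket_singleton_pair (k := k), if_pos rfl]
        split_ifs with hr
        · subst hr
          simp [pairCoeff]
        · rw [smul_zero]
      · rw [nestedBracket_singleton_pair (k := k), if_neg (by simp), if_pos (by simp),
          LinearMap.smul_apply, coeff_exp']
        simp [pairCoeff]
    · intro s _
      rw [nestedBracket_singleton_pair (k := k), if_neg (by simp), if_neg (by simp), smul_zero]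
  rw [Finset.sum_congr rfl key, Finset.sum_add_distrib, Finset.sum_ite_eq' (Finset.range R) 1,
    if_pos (by simp; omega)]

/-- The sum over words with `m + 1` pairs of exponents. The last pair gives `x + e^{ad x} y`, and
each of the others gives a factor `e^{ad x} e^{ad y} - 1`. -/
theorem sum_listsOf_nestedBracket {R : ℕ} (hR : 2 ≤ R) (h : NilBound L R) (x y : L) (m : ℕ) :
    ∑ p ∈ listsOf (dynkinPairs R) (m + 1),
      ((p.map pairCoeff).prod : k) • nestedBracket (dynkinWord p x y) =
    ((nilEval _ (h.ad_pow (k := k) x) (PowerSeries.exp k) *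
        nilEval _ (h.ad_pow (k := k) y) (PowerSeries.exp k) - 1) ^ m)
      (x + nilEval _ (h.ad_pow (k := k) x) (PowerSeries.exp k) y) := by
  induction m with
  | zero =>
    rw [sum_listsOf_succ, ← sum_pairCoeff_nestedBracket hR h, pow_zero]
    refine Finset.sum_congr rfl fun q _ => ?_
    simp [listsOf]
  | succ m ih =>
    rw [sum_listsOf_succ, pow_succ', Module.End.mul_apply, ← ih,
      ← sum_pairCoeff (k := k) (by omega : 0 < R) (h.ad_pow x) (h.ad_pow y), LinearMap.sum_apply]
    refine Finset.sum_congr rfl fun q _ => ?_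
    rw [map_sum]
    refine Finset.sum_congr rfl fun p hp => ?_
    rw [mem_listsOf] at hp
    have hw : dynkinWord p x y ≠ [] := by
      rw [← List.length_pos_iff, length_dynkinWord]
      have := length_le_sum (p := p) fun q hq => (Finset.mem_erase.1 (hp.2 q hq)).1
      omega
    rw [nestedBracket_dynkinWord_cons (k := k) q p x y hw, List.map_cons, List.prod_cons,
      LinearMap.smul_apply, map_smul, smul_smul]
    push_cast
    rfl

theorem map_nestedBracket_of_derivation {T : L →ₗ[k] L} (hT : ∀ x y, T ⁅x, y⁆ = ⁅T x, y⁆ + ⁅x, T y⁆)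
    (l : List L) (hl : ∀ x ∈ l, T x = x) :
    T (nestedBracket l) = (l.length : k) • nestedBracket l := by
  induction l with
  | nil => exact (map_zero T).trans (smul_zero _).symm
  | cons x l ih =>
    rcases l with _ | ⟨y, l⟩
    · simpa [nestedBracket] using hl
    · rw [nestedBracket_cons _ (by simp), hT, hl x List.mem_cons_self,
        ih fun x hx => hl x (List.mem_cons_of_mem _ hx), lie_smul]
      simp only [List.length_cons, Nat.cast_add, Nat.cast_one, add_smul, one_smul]
      abel

/-- The differential equation of Dynkin's series. A derivation `T` with `T x = x` and `T y = y`
multiplies each word by its length, which cancels the denominator `∑ (r_i + s_i)`. -/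
theorem map_bch_of_derivation {T : L →ₗ[k] L} (hT : ∀ x y, T ⁅x, y⁆ = ⁅T x, y⁆ + ⁅x, T y⁆) {R : ℕ}
    (hR : 2 ≤ R) (h : NilBound L R) (x y : L) (hx : T x = x) (hy : T y = y) :
    T (bch k x y) = ∑ m ∈ Finset.range R, ((-1) ^ m / (m + 1) : k) •
      ((nilEval _ (h.ad_pow (k := k) x) (PowerSeries.exp k) *
        nilEval _ (h.ad_pow (k := k) y) (PowerSeries.exp k) - 1) ^ m)
      (x + nilEval _ (h.ad_pow (k := k) x) (PowerSeries.exp k) y) := by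
  rw [bch_eq_sum h, map_sum]
  refine Finset.sum_congr rfl fun m _ => ?_
  rw [← sum_listsOf_nestedBracket hR h, map_sum, Finset.smul_sum]
  refine Finset.sum_congr rfl fun p hp => ?_
  rw [mem_listsOf] at hp
  rw [map_smul, map_nestedBracket_of_derivation hT, smul_smul, smul_smul, length_dynkinWord,
    dynkinCoeff, hp.1]
  · congr 1
    have h1 := length_le_sum (p := p) fun q hq => (Finset.mem_erase.1 (hp.2 q hq)).1
    have h2 : (((p.map fun q => q.1 + q.2).sum : ℕ) : k) ≠ 0 := by
      rw [Nat.cast_ne_zero]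
      omega
    have h3 : (m + 1 : k) ≠ 0 := by exact_mod_cast m.succ_ne_zero
    change (((-1) ^ (m + 1 + 1) / ((m + 1 : ℕ) : ℚ) / ((p.map fun q => q.1 + q.2).sum : ℕ) *
      (p.map pairCoeff).prod : ℚ) : k) * _ = _
    rw [Rat.cast_mul, Rat.cast_div, Rat.cast_natCast, Rat.cast_div, Rat.cast_natCast, Rat.cast_pow,
      Rat.cast_neg, Rat.cast_one, mul_right_comm, div_mul_cancel₀ _ h2, Nat.cast_succ]
    ring
  · intro z hz
    simp only [dynkinWord, List.mem_flatMap, List.mem_append, List.mem_replicate] at hz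
    obtain ⟨q, -, ⟨-, rfl⟩ | ⟨-, rfl⟩⟩ := hz
    · exact hx
    · exact hy

end BCH

/-! ### The exponential map `L(g) → G(g)` -/

theorem nilEval_congr {k A : Type*} [Field k] [Ring A] [Algebra k A] {a : A} {R S : ℕ}
    (ha : a ^ R = 0) (hb : a ^ S = 0) (p : PowerSeries k) : nilEval a ha p = nilEval a hb p := by
  wlog hRS : R ≤ S generalizing R S
  · exact (this hb ha (by omega)).symm
  rw [nilEval_apply, nilEval_apply]
  refine Finset.sum_subset (Finset.range_mono hRS) fun i _ hi => ?_
  rw [pow_eq_zero_of_le (by simpa using hi) ha, smul_zero]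

theorem nilEval_X {k A : Type*} [Field k] [Ring A] [Algebra k A] {a : A} {R : ℕ}
    (ha : a ^ R = 0) : nilEval a ha (PowerSeries.X : PowerSeries k) = a := by
  have := aeval_trunc_of_pow_eq_zero (k := k) ha Polynomial.X
  rwa [Polynomial.coe_X, Polynomial.aeval_X] at this

namespace GrNilpLie

variable {k : Type u} [Field k] {G : GrNilpLie k ⥤ GrpCat.{w}}

/-- A bound for the nilpotency class, chosen to be at least `2`. -/
noncomputable def cls (g : GrNilpLie k) : ℕ := g.nilpotent.choose + 2

theorem lcs_cls (g : GrNilpLie k) (n : ℕ) : g.lcs g.cls n = ⊥ :=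
  lcs_eq_bot_of_le (Nat.le_add_right _ 2) g.nilpotent.choose_spec n

theorem two_le_cls (g : GrNilpLie k) : 2 ≤ g.cls := Nat.le_add_left _ _

theorem obj_map_congr {g h : GrNilpLie k} {f f' : g ⟶ h}
    (H : ∀ n x, Hom.app f n x = Hom.app f' n x) (u : G.obj g) : G.map f u = G.map f' u := by
  rw [hom_ext H]

namespace LieT

variable [IsReduced G] [IsHomogeneous G] [CharZero k] {g h : GrNilpLie k}

variable (G) in
/-- The subspace of `L(g)` spanned by the tensors of elements of `A^*` with elements of the lower
central series of `g`. -/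
def lcsSpan (g : GrNilpLie k) (r : ℕ) : Submodule k (LieT G g) :=
  Submodule.span k {z | ∃ (n : ℕ) (x : g.carrier n) (a : Tangent G n), x ∈ g.lcs r n ∧ tens x a = z}

theorem lie_mem_lcsSpan (X : LieT G g) {Y : LieT G g} {r : ℕ} (hY : Y ∈ lcsSpan G g r) :
    ⁅X, Y⁆ ∈ lcsSpan G g (r + 1) := by
  induction hY using Submodule.span_induction with
  | zero => rw [lie_zero]; exact zero_mem _
  | add Y Z _ _ hY hZ => rw [lie_add]; exact add_mem hY hZ
  | smul c Y _ hY => rw [lie_smul]; exact Submodule.smul_mem _ c hY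
  | mem z hz =>
    obtain ⟨j, y, b, hy, rfl⟩ := hz
    induction X using LieT.induction with
    | zero => rw [zero_lie]; exact zero_mem _
    | add X X' hX hX' => rw [add_lie]; exact add_mem hX hX'
    | tens i x a =>
      rw [lie_def, br_tens (n := i + j) (h := rfl)]
      exact Submodule.smul_mem _ _ (Submodule.subset_span
        ⟨_, _, _, g.bracket_mem_lcs_succ rfl x hy, rfl⟩)

theorem nestedBracket_mem_lcsSpan (l : List (LieT G g)) :
    nestedBracket l ∈ lcsSpan G g (l.length - 1) := by
  induction l with
  | nil => exact zero_mem _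
  | cons X l ih =>
    rcases l with _ | ⟨Y, l⟩
    · refine LieT.induction X (zero_mem _) (fun n x a => ?_) fun _ _ => add_mem
      exact Submodule.subset_span ⟨n, x, a, trivial, rfl⟩
    · exact lie_mem_lcsSpan X ih

theorem nilBound_of_lcs {r : ℕ} (hr : ∀ n, g.lcs r n = ⊥) : NilBound (LieT G g) (r + 1) := by
  intro l hl
  have h1 := nestedBracket_mem_lcsSpan l
  have h2 : lcsSpan G g (l.length - 1) = ⊥ := by
    rw [lcsSpan, Submodule.span_eq_bot]
    rintro z ⟨n, x, a, hx, rfl⟩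
    rw [lcs_eq_bot_of_le (by omega) hr, Submodule.mem_bot] at hx
    rw [hx, tens_zero]
  rwa [h2] at h1

variable (G g) in
theorem nilBound : NilBound (LieT G g) (g.cls + 1) := nilBound_of_lcs g.lcs_cls

/-- The value of a power series at the nilpotent endomorphism `ad X` of `L(g)`. -/
noncomputable def adS (p : PowerSeries k) (X : LieT G g) : Module.End k (LieT G g) :=
  nilEval _ ((nilBound G g).ad_pow (k := k) X) p

theorem adS_eq (p : PowerSeries k) (X : LieT G g) {R : ℕ} (h : NilBound (LieT G g) R) :
    adS p X = nilEval _ (h.ad_pow (k := k) X) p := nilEval_congr _ _ p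

theorem adS_add (p q : PowerSeries k) (X Y : LieT G g) :
    adS (p + q) X Y = adS p X Y + adS q X Y := by
  rw [adS, map_add]
  rfl

theorem adS_X_mul (p : PowerSeries k) (X Y : LieT G g) :
    adS (PowerSeries.X * p) X Y = br X (adS p X Y) := by
  rw [adS, map_mul, nilEval_X]
  rfl

theorem adS_of_br_eq_zero (p : PowerSeries k) {X Y : LieT G g} (h : br X Y = 0) :
    adS p X Y = PowerSeries.constantCoeff p • Y := by
  rw [adS, nilEval_apply, LinearMap.sum_apply, Finset.sum_eq_single_of_mem 0 (by simp)]
  · simp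
  · intro i _ hi
    obtain ⟨i, rfl⟩ := Nat.exists_eq_succ_of_ne_zero hi
    rw [pow_succ, LinearMap.smul_apply, Module.End.mul_apply]
    change _ • (LieAlgebra.ad k (LieT G g) X ^ i) (br X Y) = 0
    rw [h, map_zero, smul_zero]

theorem map_ad_pow (f : g ⟶ h) (X Y : LieT G g) (i : ℕ) :
    map (lin f) ((LieAlgebra.ad k _ X ^ i) Y) =
      (LieAlgebra.ad k _ (map (lin f) X) ^ i) (map (lin f) Y) := by
  induction i with
  | zero => rfl
  | succ i ih =>
    rw [pow_succ', pow_succ', Module.End.mul_apply, Module.End.mul_apply, ← ih]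
    exact map_br f X _

theorem map_adS (f : g ⟶ h) (p : PowerSeries k) (X Y : LieT G g) :
    map (lin f) (adS p X Y) = adS p (map (lin f) X) (map (lin f) Y) := by
  rw [adS_eq p _ ((nilBound G g).mono (le_max_left _ (h.cls + 1))),
    adS_eq p _ ((nilBound G h).mono (le_max_right (g.cls + 1) _)), nilEval_apply, nilEval_apply,
    LinearMap.sum_apply, LinearMap.sum_apply, map_sum]
  refine Finset.sum_congr rfl fun i _ => ?_
  rw [LinearMap.smul_apply, LinearMap.smul_apply, map_smul, map_ad_pow]

/-- If `D X = X` and `D Y = Y`, then `D (ad X)^i Y = (i + 1) (ad X)^i Y`, so that `D` acts on the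
power series as `d/dz ∘ z`. -/
theorem map_adS_of_map_eq {D : GLin g g} (hD : IsDer D) (p : PowerSeries k) {X Y : LieT G g}
    (hX : map D X = X) (hY : map D Y = Y) :
    map D (adS p X Y) = adS (PowerSeries.derivative k (PowerSeries.X * p)) X Y := by
  have key : ∀ i : ℕ, map D ((LieAlgebra.ad k _ X ^ i) Y) =
      (i + 1 : k) • (LieAlgebra.ad k _ X ^ i) Y := by
    intro i
    induction i with
    | zero => simpa using hY
    | succ i ih =>
      rw [pow_succ', Module.End.mul_apply]
      change map D (br X _) = _ • br X _
      rw [map_der_br hD, hX, ih, br_smul_right, Nat.cast_succ, add_smul (_ + _ : k), one_smul,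
        add_comm]
  rw [adS, adS, nilEval_apply, nilEval_apply, LinearMap.sum_apply, LinearMap.sum_apply, map_sum]
  refine Finset.sum_congr rfl fun i _ => ?_
  rw [LinearMap.smul_apply, LinearMap.smul_apply, map_smul, key, smul_smul,
    PowerSeries.coeff_derivative, PowerSeries.coeff_succ_X_mul]

section Phi

variable (hG : IsSmooth G)

/-- The solution `u ∈ G(rees N g)` of the equation `t du/dt = (X t) u`, that is, `u = e^{t X}`. -/
noncomputable def flow (N : ℕ) (X : LieT G g) : G.obj (rees N g) :=
  (dlog_reesT_surjective hG N g (map (reesIncl N g) X)).choose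

theorem dlog_flow (N : ℕ) (X : LieT G g) :
    dlog (isDer_reesT N g) (flow hG N X) = map (reesIncl N g) X :=
  (dlog_reesT_surjective hG N g (map (reesIncl N g) X)).choose_spec

theorem eq_flow {N : ℕ} {X : LieT G g} {u : G.obj (rees N g)}
    (hu : dlog (isDer_reesT N g) u = map (reesIncl N g) X) : u = flow hG N X :=
  dlog_reesT_injective N g (hu.trans (dlog_flow hG N X).symm)

theorem trunc_flow {M N : ℕ} (hMN : M ≤ N) (X : LieT G g) :
    G.map (reesTrunc g hMN) (flow hG N X) = flow hG M X := by
  apply eq_flow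
  rw [map_dlog _ (isDer_reesT N g) _ (fun n x => trunc_reesT _ n x), dlog_flow]
  exact map_eq_of (fun n x => trunc_reesIncl hMN n x) X

theorem map_flow (N : ℕ) (f : g ⟶ h) (X : LieT G g) :
    G.map (reesMap N f) (flow hG N X) = flow hG N (map (lin f) X) := by
  apply eq_flow
  rw [map_dlog _ (isDer_reesT N g) _ (fun n x => reesMap_reesT f n x), dlog_flow, map_map',
    map_map']
  exact map_congr (fun n x => reesMap_reesIncl f n x) X

/-- The exponential map: the value of `e^{t X}` at `t = 1`. -/
noncomputable def Phi (X : LieT G g) : G.obj g :=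
  G.map (reesEv g.cls g g.lcs_cls) (flow hG g.cls X)

theorem ev_flow_of_le {M N : ℕ} (hMN : M ≤ N) (hM : ∀ n, g.lcs M n = ⊥) (hN : ∀ n, g.lcs N n = ⊥)
    (X : LieT G g) :
    G.map (reesEv N g hN) (flow hG N X) = G.map (reesEv M g hM) (flow hG M X) := by
  induction N, hMN using Nat.le_induction with
  | base => rfl
  | succ N hMN ih =>
    rw [← ih (lcs_eq_bot_of_le hMN hM), ← trunc_flow hG N.le_succ, map_map]
    exact obj_map_congr (fun n x => (reesEv_trunc _ hN n x).symm) _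

/-- The exponential map can be computed in any Rees algebra of sufficiently large weight. -/
theorem Phi_eq {N : ℕ} (hN : ∀ n, g.lcs N n = ⊥) (X : LieT G g) :
    Phi hG X = G.map (reesEv N g hN) (flow hG N X) := by
  rcases le_total g.cls N with hle | hle
  · exact (ev_flow_of_le hG hle _ hN X).symm
  · exact ev_flow_of_le hG hle hN _ X

theorem map_Phi (f : g ⟶ h) (X : LieT G g) : G.map f (Phi hG X) = Phi hG (map (lin f) X) := by
  have h1 : ∀ n, g.lcs (max g.cls h.cls) n = ⊥ := lcs_eq_bot_of_le (le_max_left _ _) g.lcs_cls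
  have h2 : ∀ n, h.lcs (max g.cls h.cls) n = ⊥ := lcs_eq_bot_of_le (le_max_right _ _) h.lcs_cls
  rw [Phi_eq hG h1, Phi_eq hG h2, ← map_flow, map_map, map_map]
  exact obj_map_congr (fun n x => (reesEv_reesMap f h1 h2 n x).symm) _

theorem Phi_zero : Phi hG (0 : LieT G g) = 1 := by
  rw [Phi, ← eq_flow hG (u := 1) (by rw [dlog_one, map_zero]), map_one]

/-- For abelian `g`, where `L(g) = G(g)`, the exponential map is the identity. -/
theorem Phi_of_abelian (hg : ∀ i j n e x y, g.bracket i j n e x y = 0) (X : LieT G g) :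
    Phi hG X = push (abHom (fun _ => LinearMap.id) hg) X := by
  have h0 : ∀ i j n e x y, (rees g.cls g).bracket i j n e x y = 0 := fun i j n e x y =>
    rees_ext fun w _ _ => by
      rw [rc_bracket, map_zero]
      split_ifs
      · exact Finset.sum_eq_zero fun _ _ => hg _ _ _ _ _ _
  have h1 := eq_flow hG (u := push (abHom (reesIncl g.cls g) fun i j n e _ _ => h0 i j n e _ _) X)
    ((dlog_push _ _ _ (fun i j n e _ _ => h0 i j n e _ _) X).trans
      (map_eq_of (fun n x => reesT_reesIncl n x) X))
  rw [Phi, ← h1, map_push]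
  exact push_congr (fun n x => reesEv_reesIncl g.lcs_cls (by have := g.two_le_cls; omega) n x) X

theorem map_ev_incl (X : LieT G g) :
    map (lin (reesEv g.cls g g.lcs_cls)) (map (reesIncl g.cls g) X) = X :=
  (map_eq_of (fun n x => reesEv_reesIncl g.lcs_cls (by have := g.two_le_cls; omega) n x) X).trans
    (map_id X)

theorem map_reesT_incl (N : ℕ) (X : LieT G g) :
    map (reesT N g) (map (reesIncl N g) X) = map (reesIncl N g) X :=
  map_eq_of (fun n x => reesT_reesIncl n x) X

theorem br_sub_right (X Y Z : LieT G g) : br X (Y - Z) = br X Y - br X Z :=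
  lie_sub X Y Z

theorem adS_exp (X Y : LieT G g) :
    adS (PowerSeries.exp k) X Y = Y + br X (adS (expDiv k) X Y) := by
  rw [← adS_X_mul, X_mul_expDiv]
  nth_rewrite 1 [← sub_add_cancel (PowerSeries.exp k) 1]
  rw [adS_add, add_comm]
  congr 1
  rw [adS, map_one]
  rfl

/-- The logarithmic derivative of `e^X` along a derivation. -/
theorem dlog_Phi {D : GLin g g} (hD : IsDer D) (X : LieT G g) :
    dlog hD (Phi hG X) = adS (expDiv k) X (map D X) := by
  set N := g.cls
  set ξ := map (reesIncl N g) X with hξ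
  have hDξ : map (reesDer N hD) ξ = map (reesIncl N g) (map D X) := by
    rw [hξ, map_map', map_map']
    exact map_congr (fun n x => reesDer_reesIncl hD n x) X
  -- Both sides solve the equation `t dV/dt = (D X) t + [X t, V]`.
  have key : dlog (isDer_reesDer hD) (flow hG N X) = adS (expDiv k) ξ (map (reesDer N hD) ξ) := by
    rw [← sub_eq_zero]
    refine eq_zero_of_map_reesT (c := 0) N.zero_le _ ξ ?_ ?_
    · rw [map_sub, dlog_flat (isDer_reesT N g) (isDer_reesDer hD) (fun n x => reesDer_comm hD n x),
        dlog_flow, ← hξ, map_adS_of_map_eq (isDer_reesT N g) _ (map_reesT_incl N X)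
          (by rw [hDξ, map_reesT_incl]), X_mul_expDiv, map_sub, PowerSeries.derivative_exp,
        Derivation.map_one_eq_zero, sub_zero, Nat.cast_zero, zero_smul, zero_add,
        adS_exp, br_sub_right]
      abel
    · have := IsReduced.subsingleton (G := G) (ab (rees 0 g)) (subsingleton_rees_zero g)
      exact @Subsingleton.elim (G.obj (ab (rees 0 g))) this _ _
  rw [Phi, map_dlog _ (isDer_reesDer hD) hD (fun n x => reesEv_reesDer hD _ n x), key, map_adS,
    hDξ, map_ev_incl, map_ev_incl]

theorem eq_reesTop_of_rees_one (V : LieT G (rees 1 g)) : map (reesTop 1 g) V = V := by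
  apply map_reesTop_of_trunc
  have := IsReduced.subsingleton (G := G) (ab (rees 0 g)) (subsingleton_rees_zero g)
  exact @Subsingleton.elim (G.obj (ab (rees 0 g))) this _ _

theorem Ad_rees_one (u : G.obj (rees 1 g)) (Y : LieT G (rees 1 g)) : Ad u Y = Y := by
  have := IsReduced.subsingleton (G := G) (rees 0 g) (subsingleton_rees_zero g)
  obtain ⟨ζ, rfl⟩ := exists_push_reesTopHom u (Subsingleton.elim _ _)
  exact Ad_reesTopHom ζ Y

/-- The adjoint action of `e^X`. -/
theorem Ad_Phi (X : LieT G g) : Ad (Phi hG X) = adS (PowerSeries.exp k) X := by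
  refine LinearMap.ext fun Y => ?_
  set N := g.cls
  set ξ := map (reesIncl N g) X with hξ
  set η := map (reesIncl N g) Y with hη
  -- Both sides solve the equation `t dV/dt = V + [X t, V]`, and both equal `Y t` up to order `t`.
  have key : Ad (flow hG N X) η = adS (PowerSeries.exp k) ξ η := by
    rw [← sub_eq_zero]
    refine eq_zero_of_map_reesT (c := 1) (by have := g.two_le_cls; omega) _ ξ ?_ ?_
    · rw [map_sub, map_der_Ad (isDer_reesT N g), hη, map_reesT_incl, ← hη, dlog_flow, ← hξ,
        map_adS_of_map_eq (isDer_reesT N g) _ (map_reesT_incl N X) (map_reesT_incl N Y),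
        Derivation.leibniz, PowerSeries.derivative_exp, PowerSeries.derivative_X, smul_eq_mul,
        smul_eq_mul, mul_one, adS_add, adS_X_mul, Nat.cast_one, one_smul,
        br_sub_right]
      abel
    · rw [map_sub, map_Ad, Ad_rees_one, map_adS, adS_exp, ← eq_reesTop_of_rees_one (map _ ξ),
        br_reesTop, add_zero, sub_self]
  have := congrArg (map (lin (reesEv N g g.lcs_cls))) key
  rwa [map_Ad, map_adS, map_ev_incl, map_ev_incl] at this

end Phi

end LieT

end GrNilpLie

/-! ### Bijectivity and multiplicativity of the exponential map -/

namespace GrNilpLie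

namespace LieT

variable {k : Type u} [Field k] [CharZero k] {G : GrNilpLie k ⥤ GrpCat.{w}} [IsReduced G]
  [IsHomogeneous G] {g h : GrNilpLie k} (hG : IsSmooth G)

/-- The part of top weight acts on `e^W` by translation of `W`. -/
theorem push_reesTopHom_mul_Phi {N : ℕ} (ζ W : LieT G (rees (N + 1) g)) :
    push (reesTopHom (N + 1) g) ζ * Phi hG W = Phi hG (map (reesTop (N + 1) g) ζ + W) := by
  apply dlog_reesT_injective
  have had : LieAlgebra.ad k _ (map (reesTop (N + 1) g) ζ + W) = LieAlgebra.ad k _ W := by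
    ext Y
    change br _ Y = br W Y
    rw [br_add_left, br_reesTop, zero_add]
  have h1 : adS (expDiv k) (map (reesTop (N + 1) g) ζ + W) = adS (expDiv k) W := by
    rw [adS, adS, nilEval_apply, nilEval_apply, had]
  rw [dlog_mul, Ad_reesTopHom, dlog_reesTopHom, dlog_Phi, dlog_Phi, h1, map_add, map_add,
    map_reesT_reesTop, map_smul, adS_of_br_eq_zero _ (br_reesTop' _ _)]
  simp [expDiv]

theorem Phi_rees_surjective (N : ℕ) (g : GrNilpLie k) :
    Function.Surjective (Phi hG (g := rees N g)) := by
  induction N with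
  | zero =>
    have := IsReduced.subsingleton (G := G) (rees 0 g) (subsingleton_rees_zero g)
    exact fun u => ⟨0, Subsingleton.elim _ _⟩
  | succ N ih =>
    intro u
    obtain ⟨V, hV⟩ := ih (G.map (reesTrunc g N.le_succ) u)
    -- The solution in `rees N g` is lifted arbitrarily; the error is central.
    set W := map (reesSec N g) V
    have hW : map (lin (reesTrunc g N.le_succ)) W = V :=
      (map_eq_of (fun n x => trunc_reesSec n x) V).trans (map_id V)
    obtain ⟨ζ, hζ⟩ := exists_push_reesTopHom (u * (Phi hG W)⁻¹) (by
      rw [map_mul, map_inv, map_Phi, hW, hV, mul_inv_cancel])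
    refine ⟨map (reesTop (N + 1) g) ζ + W, ?_⟩
    rw [← push_reesTopHom_mul_Phi, hζ, inv_mul_cancel_right]

/-- The inversion of `dlog_Phi`: the derivative of `W` in terms of `e^W`. -/
theorem map_der_eq_sum {D : GLin g g} (hD : IsDer D) {R : ℕ} (hR : NilBound (LieT G g) R)
    (W : LieT G g) : map D W = ∑ m ∈ Finset.range R, ((-1) ^ m / (m + 1) : k) •
      ((Ad (Phi hG W) - 1 : Module.End k (LieT G g)) ^ m) (dlog hD (Phi hG W)) := by
  have h1 := nilEval_logDiv (k := k) (hR.ad_pow (k := k) W)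
  have h2 := congrArg (fun F : Module.End k (LieT G g) => F (map D W))
    (nilEval_logDiv_mul (k := k) (hR.ad_pow (k := k) W))
  rw [← adS_eq (expDiv k) W hR, h1, ← adS_eq (PowerSeries.exp k) W hR, ← Ad_Phi hG W] at h2
  simp only [Module.End.mul_apply, LinearMap.sum_apply, LinearMap.smul_apply,
    ← dlog_Phi hG hD W] at h2
  exact h2.symm

theorem map_reesT_injective (N : ℕ) (g : GrNilpLie k) :
    Function.Injective (map (G := G) (reesT N g)) := by
  rw [injective_iff_map_eq_zero]
  intro V hV
  refine eq_zero_of_map_reesT N.zero_le V 0 ?_ ?_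
  · rw [hV, Nat.cast_zero, zero_smul, zero_add]
    exact (zero_lie (L := LieT G (rees N g)) V).symm
  · have := IsReduced.subsingleton (G := G) (ab (rees 0 g)) (subsingleton_rees_zero g)
    exact @Subsingleton.elim (G.obj (ab (rees 0 g))) this _ _

theorem Phi_rees_injective (N : ℕ) (g : GrNilpLie k) :
    Function.Injective (Phi hG (g := rees N g)) := by
  intro V W hVW
  apply map_reesT_injective
  rw [map_der_eq_sum hG (isDer_reesT N g) (nilBound G _),
    map_der_eq_sum hG (isDer_reesT N g) (nilBound G _), hVW]

/-- The Baker–Campbell–Hausdorff formula for elements of weight one of the Rees algebra. -/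
theorem Phi_bch_rees {N : ℕ} (x y : LieT G (rees N g)) (hx : map (reesT N g) x = x)
    (hy : map (reesT N g) y = y) : Phi hG (bch k x y) = Phi hG x * Phi hG y := by
  obtain ⟨W, hW⟩ := Phi_rees_surjective hG N g (Phi hG x * Phi hG y)
  rw [← hW]
  congr 1
  apply map_reesT_injective
  have hR := nilBound G (rees N g)
  have hself : ∀ x : LieT G (rees N g), adS (expDiv k) x x = x := fun x => by
    rw [adS_of_br_eq_zero _ (lie_self x)]
    simp [expDiv]
  have hAd : (Ad (Phi hG x * Phi hG y) : Module.End k (LieT G (rees N g))) =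
      adS (PowerSeries.exp k) x * adS (PowerSeries.exp k) y := by
    rw [← Ad_Phi hG x, ← Ad_Phi hG y]
    exact LinearMap.ext fun Y => Ad_mul _ _ Y
  rw [map_der_eq_sum hG (isDer_reesT N g) hR W, hW, hAd, dlog_mul, dlog_Phi, dlog_Phi, hx, hy,
    hself, hself, Ad_Phi]
  exact map_bch_of_derivation (fun X Y => map_der_br (isDer_reesT N g) X Y)
    (by have := (rees N g).two_le_cls; omega) hR x y hx hy

theorem map_lin_bch (f : g ⟶ h) (X Y : LieT G g) :
    map (lin f) (bch k X Y) = bch k (map (lin f) X) (map (lin f) Y) :=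
  map_bch ((nilBound G g).mono (le_max_left _ (h.cls + 1)))
    ((nilBound G h).mono (le_max_right (g.cls + 1) _)) (map_lie f) X Y

/-- The Baker–Campbell–Hausdorff formula. -/
theorem Phi_bch (X Y : LieT G g) : Phi hG (bch k X Y) = Phi hG X * Phi hG Y := by
  have key := congrArg (G.map (reesEv g.cls g g.lcs_cls))
    (Phi_bch_rees hG (map (reesIncl g.cls g) X) (map (reesIncl g.cls g) Y)
      (map_reesT_incl _ X) (map_reesT_incl _ Y))
  rwa [map_mul, map_Phi, map_Phi, map_Phi, map_lin_bch, map_ev_incl, map_ev_incl] at key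

theorem surj_ev (g : GrNilpLie k) : Surj (reesEv g.cls g g.lcs_cls) :=
  surj_reesEv _ (by have := g.two_le_cls; omega)

theorem Phi_surjective (g : GrNilpLie k) : Function.Surjective (Phi hG (g := g)) := by
  intro u
  obtain ⟨v, rfl⟩ := hG _ (surj_ev g) u
  obtain ⟨W, rfl⟩ := Phi_rees_surjective hG g.cls g v
  exact ⟨_, (map_Phi hG _ W).symm⟩

/-- Injectivity of the exponential map: preimages in `L(rees N g)` differ by an element of `L` of
the kernel of the evaluation at `t = 1`. -/
theorem Phi_injective (g : GrNilpLie k) : Function.Injective (Phi hG (g := g)) := by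
  intro X Y hXY
  set ev := reesEv g.cls g g.lcs_cls with hev
  set X' := map (reesIncl g.cls g) X with hX'
  set Y' := map (reesIncl g.cls g) Y with hY'
  have hinj := Phi_rees_injective hG g.cls g
  obtain ⟨c, hc, -⟩ := existsUnique_of_map_eq_one G (kerIncl ev) ev (surj_ev g)
    (fun n => Subtype.val_injective) (fun n z => LinearMap.mem_ker.1 z.2)
    (fun n x hx => ⟨⟨x, LinearMap.mem_ker.2 hx⟩, rfl⟩) ((Phi hG X')⁻¹ * Phi hG Y') (by
      rw [map_mul, map_inv, map_Phi, map_Phi, map_ev_incl, map_ev_incl, hXY, inv_mul_cancel])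
  obtain ⟨V, rfl⟩ := Phi_surjective hG _ c
  set W := map (lin (kerIncl ev)) V
  have hW : map (lin ev) W = 0 :=
    (map_eq_of (f := lin (kerIncl ev)) (q := 0) (fun n z => LinearMap.mem_ker.1 z.2) V).trans
      (map_zero_lin V)
  -- `e^Y = e^X e^W` in the Rees algebra, and `W` vanishes at `t = 1`.
  have h1 : Y' = bch k X' W := by
    apply hinj
    rw [Phi_bch, ← map_Phi, hc, mul_inv_cancel_left]
  have h2 : X' = bch k X' 0 := by
    apply hinj
    rw [Phi_bch, Phi_zero, mul_one]
  have h3 := congrArg (map (lin ev)) h1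
  have h4 := congrArg (map (lin ev)) h2
  rw [map_lin_bch, map_ev_incl, map_ev_incl, hW] at h3
  rw [map_lin_bch, map_ev_incl, map_zero] at h4
  exact h4.trans h3.symm

theorem totalEquiv_bch (X Y : TotalLie (algebraT G) g.toGradedLie) :
    totalEquiv g (bch k X Y) = bch k (totalEquiv g X) (totalEquiv g Y) := by
  have hlie : ∀ X Y : TotalLie (algebraT G) g.toGradedLie,
      totalEquiv g ⁅X, Y⁆ = ⁅totalEquiv g X, totalEquiv g Y⁆ := fun X Y => totalEquiv_lie X Y
  have hnil : NilBound (TotalLie (algebraT G) g.toGradedLie) (g.cls + 1) := by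
    intro l hl
    apply (totalEquiv g).injective
    rw [map_zero]
    refine (map_nestedBracket (F := (totalEquiv g).toLinearMap) hlie l).trans ?_
    exact nilBound G g _ (by simpa using hl)
  exact map_bch (F := (totalEquiv g).toLinearMap) hnil (nilBound G g) hlie X Y

/-- The isomorphism `exp (⨁ A^n ⊗ g_n) ≅ G(g)`. -/
noncomputable def expEquiv (g : GrNilpLie k) :
    ExpLie k (TotalLie (algebraT G) g.toGradedLie) ≃* G.obj g :=
  MulEquiv.mk ((totalEquiv g).toEquiv.trans (Equiv.ofBijective (Phi hG)
    ⟨Phi_injective hG g, Phi_surjective hG g⟩)) fun X Y => by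
    change Phi hG (totalEquiv g (bch k (ExpLie.log k X) (ExpLie.log k Y))) =
      Phi hG (totalEquiv g (ExpLie.log k X)) * Phi hG (totalEquiv g (ExpLie.log k Y))
    rw [totalEquiv_bch, Phi_bch]

theorem map_expEquiv (f : g ⟶ h) (X : TotalLie (algebraT G) g.toGradedLie) :
    G.map f (expEquiv hG g (ExpLie.of k X)) =
      expEquiv hG h (ExpLie.of k (TotalLie.map _ f X)) := by
  change G.map f (Phi hG (totalEquiv g X)) = Phi hG (totalEquiv h (TotalLie.map _ f X))
  rw [map_Phi, totalEquiv_map]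

theorem expEquiv_line (n : ℕ) (a : Tangent G n) :
    expEquiv hG (line k n) (ExpLie.of k (TotalLie.incl _ _ n (a ⊗ₜ eps k n))) =
      Tangent.toGroup G a := by
  change Phi hG (totalEquiv (line k n) (TotalLie.incl _ _ n (a ⊗ₜ eps k n))) = _
  rw [totalEquiv_incl, tens_eps, Phi_of_abelian hG fun _ _ _ _ _ _ => rfl]
  exact map_id_apply G (g := line k n) a

end LieT

end GrNilpLie

theorem mainTheorem9 {k : Type u} [Field k] [CharZero k] (G : GrNilpLie k ⥤ GrpCat.{w})
    [GrNilpLie.IsReduced G] [GrNilpLie.IsHomogeneous G] (hG : GrNilpLie.IsSmooth G) :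
    ∃ (M : GAStructure k (GrNilpLie.Tangent G))
      (Φ : ∀ g : GrNilpLie k, ExpLie k (TotalLie M g.toGradedLie) ≃* G.obj g),
      -- functoriality
      (∀ (g h : GrNilpLie k) (f : g ⟶ h) (x : TotalLie M g.toGradedLie),
        G.map f (Φ g (ExpLie.of k x)) = Φ h (ExpLie.of k (TotalLie.map M f x))) ∧
      -- on the tangent space, the isomorphism is the identity
      (∀ (n : ℕ) (a : GrNilpLie.Tangent G n),
        Φ (GrNilpLie.line k n) (ExpLie.of k (TotalLie.incl M _ n (a ⊗ₜ GrNilpLie.eps k n))) =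
          GrNilpLie.Tangent.toGroup G a) :=
  ⟨GrNilpLie.LieT.algebraT G, GrNilpLie.LieT.expEquiv hG,
    fun _ _ f x => GrNilpLie.LieT.map_expEquiv hG f x, GrNilpLie.LieT.expEquiv_line hG⟩
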